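/- **Setting.** Let $R$ be a relation symbol of arity $n\ge 1$ whose first $l$ positions ($0\le l\le n$) form the primary key. A *fact* (resp. *atom*) is a term $R(\bar t)$ with $\bar t$ an $n$-tuple of elements of an infinite domain (resp. of variables). For a term $t$, $\overline{\mathrm{key}}(t)$ is the tuple of its first $l$ entries, $\mathrm{key}(t)$ the set of entries of that tuple, and for an atom $\mathrm{vars}(t)$ is the set of all its entries; $s\sim t$ means $\overline{\mathrm{key}}(s)=\overline{\mathrm{key}}(t)$. A *database* $D$ is a finite set of facts; its *blocks* are its $\sim$-classes; a *repair* of $D$ is a $\subseteq$-maximal subset of $D$ without two distinct key-equal facts. A *query* $q=AB$ consists of two atoms $A,B$. Write $q(ab)$ if some assignment $\mu$ of elements to variables satisfies $\mu(A)=a$ and $\mu(B)=b$, and $q\{ab\}$ if $q(ab)$ or $q(ba)$. $D\models q$ if $q(ab)$ for some (not necessarily distinct) $a,b\in D$, and $D\in\mathsf{certain}(q)$ if every repair of $D$ satisfies $q$. The query is *2way-determined* if $\mathrm{key}(A)\not\subseteq\mathrm{key}(B)$, $\mathrm{key}(B)\not\subseteq\mathrm{key}(A)$, $\mathrm{key}(A)\subseteq\mathrm{vars}(B)$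 and $\mathrm{key}(B)\subseteq\mathrm{vars}(A)$. **The algorithm $\mathsf{Cert}_k(q)$.** A *$k$-set* of $D$ is a set of at most $k$ facts contained in some repair of $D$. $\Delta_k(q,D)$ is the least family of $k$-sets of $D$ that contains every $k$-set $S$ with $S\models q$, and contains every $k$-set $S$ for which there is a block $B$ of $D$ such that for every $u\in B$ some $S'\subseteq S\cup\{u\}$ belongs to the family. $D\in\mathsf{Cert}_k(q)$ means $\emptyset\in\Delta_k(q,D)$. **Tripaths.** For facts $d,e,f$ with $q(de)$ and $q(ef)$ let $g(e)$ be: $\mathrm{key}(d)$ if $\mathrm{key}(d)\subseteq\mathrm{key}(e)$ and $\mathrm{key}(f)\not\subseteq\mathrm{key}(e)$; $\mathrm{key}(f)$ if $\mathrm{key}(d)\not\subseteq\mathrm{key}(e)$ and $\mathrm{key}(f)\subseteq\mathrm{key}(e)$; $\mathrm{key}(d)$ if $\mathrm{key}(d)\subseteq\mathrm{key}(f)\subseteq\mathrm{key}(e)$; $\mathrm{key}(f)$ if $\mathrm{key}(f)\subseteq\mathrm{key}(d)\subseteq\mathrm{key}(e)$; and $\mathrm{key}(e)$ in all remaining cases.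 A *tripath* of $q$ is a database $\Theta$ whose blocks can be arranged as a rooted tree with exactly two leaf blocks (hence with a unique block having two children, the branching block), together with facts $a(B)$, $b(B)$ such that: * the root block is $\{a(B)\}$, each leaf block is $\{b(B)\}$, and every other block is $\{a(B),b(B)\}$ with $a(B)\ne b(B)$; * $q\{a(B)\,b(B')\}$ whenever $B$ is the parent of $B'$; * with $e=a(B)$ for the branching block $B$, and its two children named $B',B''$ so that $d=b(B')$ and $f=b(B'')$ satisfy $q(de)$ and $q(ef)$, we have $g(e)\not\subseteq\mathrm{key}(u)$ for each $u\in\{a(B_0),b(B_1),b(B_2)\}$, where $B_0$ is the root block and $B_1,B_2$ are the leaf blocks. A database *contains a tripath* of $q$ if some subset of it is a tripath of $q$; $q$ *admits a tripath* if some database contains one. **Theorem.** Let $q$ be a 2way-determined query, and let $\kappa=l^{\,l}$ and $k=2^{2\kappa+1}+\kappa-1$. 1. For every database $D$ that does not contain a tripath of $q$: $D\in\mathsf{certain}(q)$ if and only if $D\in\mathsf{Cert}_k(q)$. 2. If $q$ does not admit a tripath, then $\mathsf{certain}(q)$ is in PTIME (in data complexity, i.e. for fixed $q$): with $\mathbb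 N$ as domain, some Turing machine decides, given any listing of the facts of a database $D$ with elements written in binary, whether $D\in\mathsf{certain}(q)$, in time polynomial in the length of the input. -/

import Mathlib

namespace TwoAtomCQA

/-- The signature of the single relation symbol `R`: its arity, and the number of its leading
positions that form the primary key. -/
structure Signature where
  arity : ℕ
  keyLen : ℕ
  arity_pos : 1 ≤ arity
  keyLen_le : keyLen ≤ arity

variable {σ : Signature} {V α : Type*}

/-- A term `R(t₁ … t_n)`: a fact if `T` is the domain of elements, an atom if `T` is the set of
variables. -/
abbrev Term (σ : Signature) (T : Type*) := Fin σ.arity → T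

/-- The key tuple of a term: its first `keyLen` entries. -/
def keyTuple {T : Type*} (t : Term σ T) : Fin σ.keyLen → T :=
  fun i => t (Fin.castLE σ.keyLen_le i)

/-- The set of elements (or variables) that occur in the key of a term. -/
def keySet {T : Type*} (t : Term σ T) : Set T := Set.range (keyTuple t)

/-- The set of all variables of an atom. -/
def vars (t : Term σ V) : Set V := Set.range t

/-- Key-equality of terms. -/
def KeyEq {T : Type*} (s t : Term σ T) : Prop := keyTuple s = keyTuple t

instance {T : Type*} [DecidableEq T] (s t : Term σ T) : Decidable (KeyEq s t) :=
  inferInstanceAs (Decidable (keyTuple s = keyTuple t))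

/-- A database is a finite set of facts. -/
abbrev Database (σ : Signature) (α : Type*) := Finset (Term σ α)

/-- A database is consistent if it does not contain two distinct key-equal facts. -/
def Consistent (D : Database σ α) : Prop := ∀ a ∈ D, ∀ b ∈ D, KeyEq a b → a = b

/-- A repair of `D` is a `⊆`-maximal consistent subset of `D`. -/
def IsRepair (D r : Database σ α) : Prop := Maximal (fun s => s ⊆ D ∧ Consistent s) r

/-- The block of `D` of the facts that are key-equal to `u`. -/
def blockOf [DecidableEq α] (D : Database σ α) (u : Term σ α) : Finset (Term σ α) :=
  D.filter fun v => KeyEq v u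

/-- The set of all blocks of `D`. -/
def blocks [DecidableEq α] (D : Database σ α) : Finset (Finset (Term σ α)) :=
  D.image (blockOf D)

/-- A two-atom Boolean conjunctive query `q = AB`, with variables from `V`. -/
structure Query (σ : Signature) (V : Type*) where
  A : Term σ V
  B : Term σ V

namespace Query

variable (q : Query σ V)

/-- `q(ab)`: one assignment of the variables maps `A` to the fact `a` and `B` to the fact `b`. -/
def Sol (a b : Term σ α) : Prop := ∃ μ : V → α, μ ∘ q.A = a ∧ μ ∘ q.B = b

/-- `q{ab}`: `q(ab)` or `q(ba)`. -/
def SolSymm (a b : Term σ α) : Prop := q.Sol a b ∨ q.Sol b a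

/-- `D ⊨ q`. -/
def Sat (D : Database σ α) : Prop := ∃ a ∈ D, ∃ b ∈ D, q.Sol a b

/-- `D ∈ certain(q)`: every repair of `D` satisfies `q`. -/
def Certain (D : Database σ α) : Prop := ∀ r, IsRepair D r → q.Sat r

/-- `q` is 2way-determined. -/
def TwoWayDetermined : Prop :=
  ¬ keySet q.A ⊆ keySet q.B ∧ ¬ keySet q.B ⊆ keySet q.A ∧
    keySet q.A ⊆ vars q.B ∧ keySet q.B ⊆ vars q.A

end Query

/-- A `k`-set of `D`: a set of at most `k` facts that can be extended to a repair of `D`. -/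
def IsKSet (k : ℕ) (D S : Database σ α) : Prop := S.card ≤ k ∧ ∃ r, IsRepair D r ∧ S ⊆ r

/-- The set `Δ_k(q, D)` computed by the greedy fixpoint algorithm: it starts with all `k`-sets that
satisfy `q`, and a `k`-set `S` is added as soon as there is a block of `D` (the block of some
`b ∈ D`) such that for every fact `u` of this block some `S' ⊆ S ∪ {u}` (here `S' = T u`) is
already in `Δ_k(q, D)`. -/
inductive Delta [DecidableEq α] (q : Query σ V) (k : ℕ) (D : Database σ α) : Database σ α → Prop
  | base (S : Database σ α) (hS : IsKSet k D S) (hq : q.Sat S) : Delta q k D S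
  | step (S : Database σ α) (hS : IsKSet k D S) (b : Term σ α) (hb : b ∈ D)
      (T : Term σ α → Database σ α) (hT : ∀ u ∈ blockOf D b, T u ⊆ insert u S)
      (hΔ : ∀ u ∈ blockOf D b, Delta q k D (T u)) : Delta q k D S

/-- `D ∈ Cert_k(q)`: the greedy fixpoint algorithm answers yes on `D`, that is, it eventually puts
the empty set into `Δ_k(q, D)`. -/
def Query.Cert [DecidableEq α] (q : Query σ V) (k : ℕ) (D : Database σ α) : Prop := Delta q k D ∅

/-- The number `κ = l ^ l`, where `l` is the number of key positions. -/
def Signature.kappa (σ : Signature) : ℕ := σ.keyLen ^ σ.keyLen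

open Classical in
/-- The set `g(e)`, for a fact `e` that is branching with `d` and `f`. -/
noncomputable def gSet (d e f : Term σ α) : Set α :=
  if keySet d ⊆ keySet e ∧ ¬ keySet f ⊆ keySet e then keySet d
  else if ¬ keySet d ⊆ keySet e ∧ keySet f ⊆ keySet e then keySet f
  else if keySet d ⊆ keySet f ∧ keySet f ⊆ keySet e then keySet d
  else if keySet f ⊆ keySet d ∧ keySet d ⊆ keySet e then keySet f
  else keySet e

/-- The data and conditions that make the database `Θ` a tripath of `q`: its blocks form a rooted
tree with exactly two leaves. The value of `parent` at the root (and outside `blocks Θ`) plays no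
role. -/
structure Tripath [DecidableEq α] (q : Query σ V) (Θ : Database σ α) where
  /-- the parent function of the tree -/
  parent : Finset (Term σ α) → Finset (Term σ α)
  /-- the facts `a(B)` and `b(B)` -/
  a : Finset (Term σ α) → Term σ α
  b : Finset (Term σ α) → Term σ α
  root : Finset (Term σ α)
  leaf₁ : Finset (Term σ α)
  leaf₂ : Finset (Term σ α)
  /-- the branching block and its two children -/
  branch : Finset (Term σ α)
  child₁ : Finset (Term σ α)
  child₂ : Finset (Term σ α)
  /- The blocks form a tree: following `parent` from any block leads to the root. -/
  root_mem : root ∈ blocks Θ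
  parent_mem : ∀ B ∈ blocks Θ, B ≠ root → parent B ∈ blocks Θ
  reach_root : ∀ B ∈ blocks Θ, ∃ n : ℕ, parent^[n] B = root
  /- Exactly two blocks have no children. -/
  leaf₁_mem : leaf₁ ∈ blocks Θ
  leaf₂_mem : leaf₂ ∈ blocks Θ
  leaf_ne : leaf₁ ≠ leaf₂
  leaf_iff : ∀ B ∈ blocks Θ,
    (∀ B' ∈ blocks Θ, B' ≠ root → parent B' ≠ B) ↔ (B = leaf₁ ∨ B = leaf₂)
  /- The branching block has two children. -/
  branch_mem : branch ∈ blocks Θ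
  child₁_mem : child₁ ∈ blocks Θ
  child₂_mem : child₂ ∈ blocks Θ
  child₁_ne_root : child₁ ≠ root
  child₂_ne_root : child₂ ≠ root
  child_ne : child₁ ≠ child₂
  parent_child₁ : parent child₁ = branch
  parent_child₂ : parent child₂ = branch
  /- The facts of the blocks. -/
  root_eq : root = {a root}
  leaf₁_eq : leaf₁ = {b leaf₁}
  leaf₂_eq : leaf₂ = {b leaf₂}
  inner_eq : ∀ B ∈ blocks Θ, B ≠ root → B ≠ leaf₁ → B ≠ leaf₂ → a B ≠ b B ∧ B = {a B, b B}
  /- The solutions along the edges of the tree. -/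
  edge : ∀ B ∈ blocks Θ, B ≠ root → q.SolSymm (a (parent B)) (b B)
  /- The center `d e f`, with `d = b child₁`, `e = a branch` and `f = b child₂`. -/
  center : q.Sol (b child₁) (a branch) ∧ q.Sol (a branch) (b child₂)
  /- The key conditions at the root and at the leaves. -/
  g_root : ¬ gSet (b child₁) (a branch) (b child₂) ⊆ keySet (a root)
  g_leaf₁ : ¬ gSet (b child₁) (a branch) (b child₂) ⊆ keySet (b leaf₁)
  g_leaf₂ : ¬ gSet (b child₁) (a branch) (b child₂) ⊆ keySet (b leaf₂)

/-- `D` contains a tripath of `q`. -/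
def Query.ContainsTripath [DecidableEq α] (q : Query σ V) (D : Database σ α) : Prop :=
  ∃ Θ ⊆ D, Nonempty (Tripath q Θ)

/-- `q` admits a tripath: some database over the (countably infinite) domain `ℕ` contains one. -/
def Query.AdmitsTripath (q : Query σ V) : Prop :=
  ∃ D : Database σ ℕ, q.ContainsTripath D

/-- The input word for a listing of the facts of a database: every element is written in binary and
closed by a comma, every fact is closed by a bracket. -/
def encodeFacts (L : List (Term σ ℕ)) : List Computability.Γ' :=
  L.flatMap fun t =>
    ((List.ofFn t).flatMap fun x =>
      (Computability.encodeNat x).map Computability.Γ'.bit ++ [Computability.Γ'.comma]) ++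
      [Computability.Γ'.ket]

open Classical in
/-- The decision problem `P` on the type `I`, with instances presented as words through `enc`, is in
PTIME: a multi-stack Turing machine decides it in time polynomial in the length of the input. -/
def InPTIME {I : Type} (enc : I → List Computability.Γ') (P : I → Prop) : Prop :=
  Nonempty (Turing.TM2ComputableInPolyTime enc Computability.encodeBool fun x => decide (P x))

/-- The problem `certain(q)` is in PTIME. The query is fixed (data complexity); the input is a
database over the domain `ℕ`, given by any listing of its facts. -/
def Query.CertainInPTIME (q : Query σ V) : Prop :=
  InPTIME (encodeFacts (σ := σ)) fun L => q.Certain L.toFinset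

end TwoAtomCQA

namespace TwoAtomCQA

/-! ### Key-equality, consistent sets and repairs -/

variable {σ : Signature} {V α : Type*}

/-! Derivations in `Delta` are sound because every repair meets every block. The content of the
first claim is therefore that a failure of `Cert` yields a repair without solutions. Call a set of
facts underived if none of its subsets is in `Delta`. An underived set contains no solution
(`Underived.not_sol`), and if it has at most `k` facts, it can be extended by a fact of any block
that it misses (`Underived.exists_insert`). Only the bound `k` prevents a direct greedy
construction, so facts have to be forgotten on the way.

By 2way-determinacy the solution partners of a fact lie in at most two blocks. Once these blocks
have been visited, facts picked later in other blocks cannot form a solution with that fact, and it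
may be dropped. Following solutions in this way grows a tree (`ExpTree`) of which only the leaves
must stay underived. When no leaf remains, all solution partners of picked facts lie in visited
blocks. These blocks are deleted, and induction on the database supplies the rest of the repair
(`Query.exists_isRepair_not_sat`).

It remains to keep the number of leaves at most `k`. In each block below the root, the fact that is
a solution partner of the parent's pick differs from the picked fact, so the two act as `b` and `a`
of a tripath. Let `g` be the set of a branching node, not contained in the key set `Z` of the root.
If both subtrees contained a key that does not include `g`, the paths to these keys and to the root
would form a tripath. Hence in one subtree all keys include `g` (`balanced_of_not_containsTripath`),
and the exploration works there as long as this has not failed. If `g ⊆ Z`, it finishes one subtree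
before opening the other. With this strategy the number of leaves is exponential in the longest
chain of increasing sets `g`, plus the number of branching nodes with `g ⊆ Z` (`width_lt`). Both
quantities are bounded because each `g` is the key set of the node or of a child, keys are distinct,
and at most `κ` key tuples have all entries in a given set of at most `l` elements (`width_le`).

For the second claim, `Cert` with fixed `k` is a fixpoint over polynomially many lists of at most
`k` facts. A small language of loops over words is compiled to multi-stack machines with an exact
step count (`Prog.steps_run`). The condition for adding a list is a first-order formula, evaluated
by nested loops (`Form.tests_comp`), and a polynomial number of rounds reaches the fixpoint
(`closed_iterate_addLists`). -/

theorem KeyEq.refl {T : Type*} (s : Term σ T) : KeyEq s s := rfl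

theorem KeyEq.symm {T : Type*} {s t : Term σ T} (h : KeyEq s t) : KeyEq t s := Eq.symm h

theorem KeyEq.trans {T : Type*} {s t u : Term σ T} (h : KeyEq s t) (h' : KeyEq t u) :
    KeyEq s u := Eq.trans h h'

theorem KeyEq.keySet_eq {T : Type*} {s t : Term σ T} (h : KeyEq s t) : keySet s = keySet t :=
  congrArg Set.range h

theorem mem_blockOf [DecidableEq α] {D : Database σ α} {u v : Term σ α} :
    v ∈ blockOf D u ↔ v ∈ D ∧ KeyEq v u := Finset.mem_filter

theorem Consistent.mono {D S : Database σ α} (h : Consistent D) (hS : S ⊆ D) : Consistent S :=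
  fun a ha b hb => h a (hS ha) b (hS hb)

theorem exists_isRepair_superset {D S : Database σ α} (hS : S ⊆ D) (hc : Consistent S) :
    ∃ r, IsRepair D r ∧ S ⊆ r := by
  have hfin : {s : Database σ α | s ⊆ D ∧ Consistent s}.Finite :=
    (D.powerset.finite_toSet).subset fun s hs => by simpa using hs.1
  obtain ⟨r, hr, hmax⟩ := hfin.exists_le_maximal (a := S) ⟨hS, hc⟩
  exact ⟨r, hmax, hr⟩

/-- A consistent subset of a finite database always extends to a maximal one. This turns the
quantifier over repairs into a condition that can be checked on `S` alone. -/
theorem isKSet_iff {k : ℕ} {D S : Database σ α} :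
    IsKSet k D S ↔ S.card ≤ k ∧ S ⊆ D ∧ Consistent S := by
  constructor
  · rintro ⟨hk, r, hr, hS⟩
    exact ⟨hk, hS.trans hr.prop.1, hr.prop.2.mono hS⟩
  · rintro ⟨hk, hS, hc⟩
    exact ⟨hk, exists_isRepair_superset hS hc⟩

theorem Consistent.insert [DecidableEq α] {S : Database σ α} (hc : Consistent S) {u : Term σ α}
    (hu : ∀ v ∈ S, KeyEq v u → v = u) : Consistent (insert u S) := by
  intro a ha b hb hab
  rw [Finset.mem_insert] at ha hb
  rcases ha with rfl | ha <;> rcases hb with rfl | hb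
  · rfl
  · exact (hu b hb hab.symm).symm
  · exact hu a ha hab
  · exact hc a ha b hb hab

theorem IsRepair.exists_keyEq [DecidableEq α] {D r : Database σ α} (hr : IsRepair D r)
    {b : Term σ α} (hb : b ∈ D) : ∃ u ∈ r, KeyEq u b := by
  by_contra! h
  have hc : Consistent (insert b r) := hr.prop.2.insert fun v hv hvb => (h v hv hvb).elim
  have := hr.le_of_ge ⟨Finset.insert_subset hb hr.prop.1, hc⟩ (Finset.subset_insert b r)
  exact h b (this (Finset.mem_insert_self b r)) (KeyEq.refl b)

/-! ### Blocks of solution partners, and soundness of the algorithm -/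

namespace Query
variable {q : Query σ V}

theorem Sat.mono {S T : Database σ α} (h : q.Sat S) (hST : S ⊆ T) : q.Sat T := by
  obtain ⟨a, ha, b, hb, hab⟩ := h
  exact ⟨a, hST ha, b, hST hb, hab⟩

/-- As `key(B) ⊆ vars(A)`, the fact matched by `A` already fixes the assignment on `key(B)`.
Together with the mirror statement `keyEq_left`, this confines the solution partners of a fact to
two blocks. -/
theorem TwoWayDetermined.keyEq_right (hq : q.TwoWayDetermined) {a b b' : Term σ α}
    (h : q.Sol a b) (h' : q.Sol a b') : KeyEq b b' := by
  obtain ⟨μ, rfl, rfl⟩ := h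
  obtain ⟨ν, hA, rfl⟩ := h'
  funext i
  obtain ⟨j, hj⟩ := hq.2.2.2 ⟨i, rfl⟩
  have := congrFun hA j
  simp only [Function.comp_apply, hj] at this
  exact this.symm

theorem TwoWayDetermined.keyEq_left (hq : q.TwoWayDetermined) {a a' b : Term σ α}
    (h : q.Sol a b) (h' : q.Sol a' b) : KeyEq a a' := by
  obtain ⟨μ, rfl, rfl⟩ := h
  obtain ⟨ν, rfl, hB⟩ := h'
  funext i
  obtain ⟨j, hj⟩ := hq.2.2.1 ⟨i, rfl⟩
  have := congrFun hB j
  simp only [Function.comp_apply, hj] at this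
  exact this.symm

theorem TwoWayDetermined.keyLen_pos (hq : q.TwoWayDetermined) : 1 ≤ σ.keyLen := by
  by_contra h
  refine hq.1 ?_
  rintro _ ⟨i, -⟩
  exact absurd i.2 (by omega)

/-- A repair that contains `S` also contains some fact `u` of the block used in the step, hence the
derived subset of `S ∪ {u}`. -/
theorem Delta.sat_of_isRepair [DecidableEq α] {k : ℕ} {D S : Database σ α} (h : Delta q k D S) :
    ∀ r, IsRepair D r → S ⊆ r → q.Sat r := by
  induction h with
  | base S hS hq => exact fun r _ hSr => hq.mono hSr
  | step S hS b hb T hT hΔ ih =>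
    intro r hr hSr
    obtain ⟨u, hu, hub⟩ := hr.exists_keyEq hb
    have hmem : u ∈ blockOf D b := mem_blockOf.2 ⟨hr.prop.1 hu, hub⟩
    exact ih u hmem r hr ((hT u hmem).trans (Finset.insert_subset hu hSr))

theorem Cert.certain [DecidableEq α] {k : ℕ} {D : Database σ α} (h : q.Cert k D) : q.Certain D :=
  fun r hr => Delta.sat_of_isRepair h r hr (Finset.empty_subset r)

/-- The hypothesis `hblock` says that `D` is a union of blocks of `E`, so a step over a block of `D`
stays a step in `E`. It is applied after deleting explored blocks: the smaller database is not
accepted either. -/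
theorem Delta.mono_database [DecidableEq α] {k : ℕ} {D E S : Database σ α} (hDE : D ⊆ E)
    (hblock : ∀ b ∈ D, blockOf E b ⊆ D) (h : Delta q k D S) : Delta q k E S := by
  have hK : ∀ S, IsKSet k D S → IsKSet k E S := fun S hS => by
    rw [isKSet_iff] at hS ⊢
    exact ⟨hS.1, hS.2.1.trans hDE, hS.2.2⟩
  induction h with
  | base S hS hq => exact Delta.base S (hK S hS) hq
  | step S hS b hb T hT hΔ ih =>
    have hmem : ∀ u ∈ blockOf E b, u ∈ blockOf D b := fun u hu =>
      mem_blockOf.2 ⟨hblock b hb hu, (mem_blockOf.1 hu).2⟩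
    exact Delta.step S (hK S hS) b (hDE hb) T (fun u hu => hT u (hmem u hu))
      fun u hu => ih u (hmem u hu)

end Query

/-! ### Underived sets and their extension -/

/-- `S` is a consistent set of facts of `D` no subset of which is derived by the algorithm. -/
structure Underived [DecidableEq α] (q : Query σ V) (k : ℕ) (D S : Database σ α) : Prop where
  subset : S ⊆ D
  consistent : Consistent S
  not_delta : ∀ T ⊆ S, ¬ Delta q k D T

namespace Underived
variable [DecidableEq α] {q : Query σ V} {k : ℕ} {D S : Database σ α}

theorem mono (h : Underived q k D S) {T : Database σ α} (hT : T ⊆ S) : Underived q k D T :=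
  ⟨hT.trans h.subset, h.consistent.mono hT, fun U hU => h.not_delta U (hU.trans hT)⟩

theorem empty (h : ¬ q.Cert k D) : Underived q k D ∅ :=
  ⟨Finset.empty_subset _, fun a ha => absurd ha (Finset.notMem_empty a), fun T hT => by
    rwa [Finset.subset_empty.1 hT]⟩

theorem not_sol (h : Underived q k D S) (hk : 2 ≤ k) {a b : Term σ α} (ha : a ∈ S) (hb : b ∈ S) :
    ¬ q.Sol a b := by
  intro hab
  have hsub : {a, b} ⊆ S := by
    intro x hx
    rcases Finset.mem_insert.1 hx with rfl | hx
    · exact ha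
    · rwa [Finset.mem_singleton.1 hx]
  refine h.not_delta {a, b} hsub (Delta.base _ (isKSet_iff.2 ⟨?_, hsub.trans h.subset,
    h.consistent.mono hsub⟩) ⟨a, by simp, b, by simp, hab⟩)
  exact Finset.card_le_two.trans hk

/-- This is the step rule read backwards: if every `insert u S` had a derived subset, `S` would be
derived. Only `S` has to respect the bound `k`, the extended set may be larger by one. The condition
`hnew` keeps the extension consistent. -/
theorem exists_insert (h : Underived q k D S) (hS : S.card ≤ k) {b : Term σ α} (hb : b ∈ D)
    (hnew : ∀ s ∈ S, ¬ KeyEq s b) : ∃ u ∈ blockOf D b, Underived q k D (insert u S) := by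
  by_contra! hcon
  have key : ∀ u ∈ blockOf D b, ∃ T ⊆ insert u S, Delta q k D T := by
    intro u hu
    by_contra! hT
    have hub := mem_blockOf.1 hu
    exact hcon u hu ⟨Finset.insert_subset hub.1 h.subset,
      h.consistent.insert fun v hv hvu => (hnew v hv (hvu.trans hub.2)).elim, hT⟩
  choose! T hT hΔ using key
  exact h.not_delta S subset_rfl
    (Delta.step S (isKSet_iff.2 ⟨hS, h.subset, h.consistent⟩) b hb T hT hΔ)

end Underived

/-- Of the case distinction that defines `gSet`, the argument uses no more than this and
`gSet_subset`. -/
theorem gSet_cases (d e f : Term σ α) :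
    gSet d e f = keySet d ∨ gSet d e f = keySet e ∨ gSet d e f = keySet f := by
  unfold gSet
  split_ifs <;> simp

theorem gSet_subset (d e f : Term σ α) : gSet d e f ⊆ keySet e := by
  unfold gSet
  split_ifs with h₁ h₂ h₃ h₄
  · exact h₁.1
  · exact h₂.2
  · exact h₃.1.trans h₃.2
  · exact h₄.1.trans h₄.2
  · exact subset_rfl

/-! ### Exploration trees -/

/-- An exploration tree. Every node carries the fact `b` through which its block is entered and the
fact `a` picked in the block. A `leaf` is still to be explored; the blocks that contain the
solution partners of all other nodes are explored already. -/
inductive ExpTree (F : Type*)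
  | leaf (b a : F)
  | nil (b a : F)
  | one (b a : F) (T : ExpTree F)
  | two (b a : F) (Td Tf : ExpTree F)

namespace ExpTree

section Basic
variable {F β : Type*}

/-- The entry fact of the root. -/
def entry : ExpTree F → F
  | leaf b _ => b
  | nil b _ => b
  | one b _ _ => b
  | two b _ _ _ => b

/-- The picked fact of the root. -/
def pick : ExpTree F → F
  | leaf _ a => a
  | nil _ a => a
  | one _ a _ => a
  | two _ a _ _ => a

/-- The nodes in preorder. -/
def nodes : ExpTree F → List (F × F)
  | leaf b a => [(b, a)]
  | nil b a => [(b, a)]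
  | one b a T => (b, a) :: nodes T
  | two b a Td Tf => (b, a) :: (nodes Td ++ nodes Tf)

/-- The sum of the contributions `f b a` of the leaves and `g b a` of the other nodes. -/
def collect (f g : F → F → Multiset β) : ExpTree F → Multiset β
  | leaf b a => f b a
  | nil b a => g b a
  | one b a T => g b a + collect f g T
  | two b a Td Tf => g b a + (collect f g Td + collect f g Tf)

/-- The picked facts of the leaves. -/
def active (T : ExpTree F) : Multiset F := collect (fun _ a => {a}) (fun _ _ => 0) T

/-- The picked facts of the explored nodes. -/
def processed (T : ExpTree F) : Multiset F := collect (fun _ _ => 0) (fun _ a => {a}) T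

/-- The picked facts. -/
def picks (T : ExpTree F) : Multiset F := collect (fun _ a => {a}) (fun _ a => {a}) T

/-- The number of leaves. -/
def width (T : ExpTree F) : ℕ := Multiset.card (active T)

@[simp] theorem width_leaf (b a : F) : width (leaf b a) = 1 := rfl

@[simp] theorem width_nil (b a : F) : width (nil b a) = 0 := rfl

@[simp] theorem width_one (b a : F) (T : ExpTree F) : width (one b a T) = width T := by
  simp [width, active, collect]

@[simp] theorem width_two (b a : F) (Td Tf : ExpTree F) :
    width (two b a Td Tf) = width Td + width Tf := by
  simp [width, active, collect]

theorem picks_eq (T : ExpTree F) : picks T = processed T + active T := by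
  induction T with
  | leaf b a => simp [picks, processed, active, collect]
  | nil b a => simp [picks, processed, active, collect]
  | one b a T ih =>
    simp only [picks, processed, active, collect, zero_add] at *
    rw [ih, add_assoc]
  | two b a Td Tf ihd ihf =>
    simp only [picks, processed, active, collect, zero_add] at *
    rw [ihd, ihf]
    abel

theorem coe_map_nodes (T : ExpTree F) : ((T.nodes.map Prod.snd : List F) : Multiset F) = picks T := by
  induction T with
  | leaf b a => rfl
  | nil b a => rfl
  | one b a T ih =>
    simp only [picks, collect, nodes, List.map_cons] at *
    rw [← ih]; rfl
  | two b a Td Tf ihd ihf =>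
    simp only [picks, collect, nodes, List.map_cons, List.map_append] at *
    rw [← ihd, ← ihf]; rfl

theorem root_mem_nodes (T : ExpTree F) : (T.entry, T.pick) ∈ T.nodes := by
  cases T <;> simp [entry, pick, nodes]

/-- `R` arises from `leaf b a` by exploring at most two blocks. -/
inductive IsExpansion (b a : F) : ExpTree F → Prop
  | nil : IsExpansion b a (nil b a)
  | one (b₁ a₁ : F) : IsExpansion b a (one b a (leaf b₁ a₁))
  | two (b₁ a₁ b₂ a₂ : F) : IsExpansion b a (two b a (leaf b₁ a₁) (leaf b₂ a₂))

theorem IsExpansion.width_le {b a : F} {R : ExpTree F} (h : IsExpansion b a R) : width R ≤ 2 := by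
  cases h <;> simp

end Basic

/-! ### The exploration strategy and the bound on the number of leaves -/

section Strategy

/-- The set `g` of a node with two children. -/
noncomputable def gNode (a : Term σ α) (Td Tf : ExpTree (Term σ α)) : Set α :=
  gSet Td.entry a Tf.entry

/-- All keys of the tree contain `G`. -/
def Above (G : Set α) (T : ExpTree (Term σ α)) : Prop := ∀ n ∈ T.nodes, G ⊆ keySet n.2

open Classical in
/-- The length of a longest descending chain of nodes with two children whose sets `g` contain `G`
and are increasing. -/
noncomputable def chain : ExpTree (Term σ α) → Set α → ℕ
  | leaf _ _, _ => 0
  | nil _ _, _ => 0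
  | one _ _ T, G => chain T G
  | two _ a Td Tf, G => max (max (chain Td G) (chain Tf G))
      (if G ⊆ gNode a Td Tf then
        1 + max (chain Td (gNode a Td Tf)) (chain Tf (gNode a Td Tf)) else 0)

open Classical in
/-- The number of nodes with two children whose set `g` lies between `G` and `Z`. -/
noncomputable def cnt (G Z : Set α) : ExpTree (Term σ α) → ℕ
  | leaf _ _ => 0
  | nil _ _ => 0
  | one _ _ T => cnt G Z T
  | two _ a Td Tf => (if G ⊆ gNode a Td Tf ∧ gNode a Td Tf ⊆ Z then 1 else 0) +
      (cnt G Z Td + cnt G Z Tf)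

/-- The tree is linked through solutions: the entry fact of a child is key-equal to, but different
from its picked fact, and forms a solution with the picked fact of the parent. -/
def Linked (q : Query σ V) (D : Database σ α) : ExpTree (Term σ α) → Prop
  | leaf _ a => a ∈ D
  | nil _ a => a ∈ D
  | one _ a T => a ∈ D ∧ q.SolSymm a T.entry ∧
      (T.entry ∈ D ∧ KeyEq T.entry T.pick ∧ T.entry ≠ T.pick) ∧ Linked q D T
  | two _ a Td Tf => a ∈ D ∧ (q.Sol Td.entry a ∧ q.Sol a Tf.entry) ∧
      (Td.entry ∈ D ∧ KeyEq Td.entry Td.pick ∧ Td.entry ≠ Td.pick) ∧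
      (Tf.entry ∈ D ∧ KeyEq Tf.entry Tf.pick ∧ Tf.entry ≠ Tf.pick) ∧
      Linked q D Td ∧ Linked q D Tf

/-- Every node with two children and `g ⊄ Z` has a child below which all keys contain `g`. -/
def Balanced (Z : Set α) : ExpTree (Term σ α) → Prop
  | leaf _ _ => True
  | nil _ _ => True
  | one _ _ T => Balanced Z T
  | two _ a Td Tf =>
      (gNode a Td Tf ⊆ Z ∨ Above (gNode a Td Tf) Td ∨ Above (gNode a Td Tf) Tf) ∧
      Balanced Z Td ∧ Balanced Z Tf

/-- The bound on the numbers of leaves that the exploration maintains. -/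
def Narrow (Z : Set α) : ExpTree (Term σ α) → Prop
  | leaf _ _ => True
  | nil _ _ => True
  | one _ _ T => Narrow Z T
  | two _ a Td Tf =>
      (width Td = 0 ∨ width Tf = 0 ∨ (gNode a Td Tf ⊆ Z ∧ width Tf ≤ 1) ∨
        (¬ gNode a Td Tf ⊆ Z ∧
          width Td ≤ 2 ^ (1 + max (chain Td (gNode a Td Tf)) (chain Tf (gNode a Td Tf))) ∧
          width Tf ≤ 2 ^ (1 + max (chain Td (gNode a Td Tf)) (chain Tf (gNode a Td Tf))))) ∧
      Narrow Z Td ∧ Narrow Z Tf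

/-- The exploration continues in the subtree `Td` of a node with two children. -/
def GoLeft (Z : Set α) (a : Term σ α) (Td Tf : ExpTree (Term σ α)) : Prop :=
  0 < width Td ∧ (gNode a Td Tf ⊆ Z ∨ width Tf = 0 ∨ Above (gNode a Td Tf) Td)

open Classical in
/-- The leaf to be explored next. -/
noncomputable def sel (Z : Set α) : ExpTree (Term σ α) → Term σ α × Term σ α
  | leaf b a => (b, a)
  | nil b a => (b, a)
  | one _ _ T => sel Z T
  | two _ a Td Tf => if GoLeft Z a Td Tf then sel Z Td else sel Z Tf

open Classical in
/-- The tree with `R` in place of the leaf to be explored next. -/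
noncomputable def expand (Z : Set α) (R : ExpTree (Term σ α)) :
    ExpTree (Term σ α) → ExpTree (Term σ α)
  | leaf _ _ => R
  | nil b a => nil b a
  | one b a T => one b a (expand Z R T)
  | two b a Td Tf => if GoLeft Z a Td Tf then two b a (expand Z R Td) Tf
      else two b a Td (expand Z R Tf)

variable {q : Query σ V} {D : Database σ α} {Z G : Set α} {T R : ExpTree (Term σ α)}

theorem goLeft_or (b a : Term σ α) (Td Tf : ExpTree (Term σ α))
    (h : 0 < width (two b a Td Tf)) : GoLeft Z a Td Tf ∨ (¬ GoLeft Z a Td Tf ∧ 0 < width Tf) := by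
  by_cases hg : GoLeft Z a Td Tf
  · exact Or.inl hg
  · refine Or.inr ⟨hg, ?_⟩
    by_contra h0
    simp only [width_two] at h
    exact hg ⟨by omega, Or.inr (Or.inl (by omega))⟩

theorem expand_root (hT : 0 < width T) (hR : IsExpansion (sel Z T).1 (sel Z T).2 R) :
    (expand Z R T).entry = T.entry ∧ (expand Z R T).pick = T.pick := by
  cases T with
  | leaf b a => cases hR <;> exact ⟨rfl, rfl⟩
  | nil b a => exact ⟨rfl, rfl⟩
  | one b a T => exact ⟨rfl, rfl⟩
  | two b a Td Tf => unfold expand; split_ifs <;> exact ⟨rfl, rfl⟩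

/-- Any additive statistic of the tree changes only by the contribution of the replaced leaf. The
widths, the picks, the processed facts and the active facts after an expansion are all read off from
this. -/
theorem expand_collect {β : Type*} (f g : Term σ α → Term σ α → Multiset β) (hT : 0 < width T) :
    ∃ rest, collect f g T = f (sel Z T).1 (sel Z T).2 + rest ∧
      collect f g (expand Z R T) = collect f g R + rest := by
  induction T with
  | leaf b a => exact ⟨0, by simp [collect, sel, expand]⟩
  | nil b a => simp at hT
  | one b a T ih =>
    obtain ⟨rest, h₁, h₂⟩ := ih (by simpa using hT)
    refine ⟨g b a + rest, ?_, ?_⟩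
    · simp only [collect, sel, h₁]; abel
    · simp only [collect, expand, h₂]; abel
  | two b a Td Tf ihd ihf =>
    rcases goLeft_or (Z := Z) b a Td Tf hT with hl | ⟨hl, hw⟩
    · obtain ⟨rest, h₁, h₂⟩ := ihd hl.1
      refine ⟨g b a + (rest + collect f g Tf), ?_, ?_⟩
      · simp only [collect, sel, if_pos hl, h₁]; abel
      · simp only [collect, expand, if_pos hl, h₂]; abel
    · obtain ⟨rest, h₁, h₂⟩ := ihf hw
      refine ⟨g b a + (collect f g Td + rest), ?_, ?_⟩
      · simp only [collect, sel, if_neg hl, h₁]; abel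
      · simp only [collect, expand, if_neg hl, h₂]; abel

theorem width_expand_le (hT : 0 < width T) (hR : IsExpansion (sel Z T).1 (sel Z T).2 R) :
    width (expand Z R T) ≤ width T + 1 := by
  obtain ⟨rest, h₁, h₂⟩ := expand_collect (Z := Z) (R := R)
    (fun _ a => ({a} : Multiset (Term σ α))) (fun _ _ => 0) hT
  have := hR.width_le
  simp only [width, active] at *
  rw [h₁, h₂]
  simp only [Multiset.card_add, Multiset.card_singleton]
  omega

theorem gNode_expand_left {a : Term σ α} {Td Tf : ExpTree (Term σ α)} (hT : 0 < width Td)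
    (hR : IsExpansion (sel Z Td).1 (sel Z Td).2 R) :
    gNode a (expand Z R Td) Tf = gNode a Td Tf := by
  rw [gNode, (expand_root hT hR).1, gNode]

theorem gNode_expand_right {a : Term σ α} {Td Tf : ExpTree (Term σ α)} (hT : 0 < width Tf)
    (hR : IsExpansion (sel Z Tf).1 (sel Z Tf).2 R) :
    gNode a Td (expand Z R Tf) = gNode a Td Tf := by
  rw [gNode, (expand_root hT hR).1, gNode]

/-- An expansion keeps the entry and pick of every old node, hence every old set `g`. The bounds in
`Narrow` involve chains of the current subtrees, so they can only become weaker when either subtree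
grows. -/
theorem chain_le_expand (hT : 0 < width T) (hR : IsExpansion (sel Z T).1 (sel Z T).2 R)
    (G : Set α) : chain T G ≤ chain (expand Z R T) G := by
  induction T generalizing G with
  | leaf b a => exact Nat.zero_le _
  | nil b a => simp at hT
  | one b a T ih => exact ih (by simpa using hT) hR G
  | two b a Td Tf ihd ihf =>
    rcases goLeft_or (Z := Z) b a Td Tf hT with hl | ⟨hl, hw⟩
    · rw [sel, if_pos hl] at hR
      rw [expand, if_pos hl, chain, chain, gNode_expand_left hl.1 hR]
      have h₁ := ihd hl.1 hR G
      have h₂ := ihd hl.1 hR (gNode a Td Tf)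
      split_ifs <;> omega
    · rw [sel, if_neg hl] at hR
      rw [expand, if_neg hl, chain, chain, gNode_expand_right hw hR]
      have h₁ := ihf hw hR G
      have h₂ := ihf hw hR (gNode a Td Tf)
      split_ifs <;> omega

theorem Linked.expand (hT : 0 < width T) (hR : IsExpansion (sel Z T).1 (sel Z T).2 R)
    (h : Linked q D T) (hLR : Linked q D R) : Linked q D (expand Z R T) := by
  induction T with
  | leaf b a => exact hLR
  | nil b a => simp at hT
  | one b a T ih =>
    have hw : 0 < width T := by simpa using hT
    obtain ⟨he, hp⟩ := expand_root hw hR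
    obtain ⟨h₁, h₂, h₃, h₄⟩ := h
    rw [ExpTree.expand, Linked, he, hp]
    exact ⟨h₁, h₂, h₃, ih hw hR h₄⟩
  | two b a Td Tf ihd ihf =>
    obtain ⟨h₁, h₂, h₃, h₄, h₅, h₆⟩ := h
    rcases goLeft_or (Z := Z) b a Td Tf hT with hl | ⟨hl, hw⟩
    · rw [sel, if_pos hl] at hR
      obtain ⟨he, hp⟩ := expand_root hl.1 hR
      rw [ExpTree.expand, if_pos hl, Linked, he, hp]
      exact ⟨h₁, h₂, h₃, h₄, ihd hl.1 hR h₅, h₆⟩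
    · rw [sel, if_neg hl] at hR
      obtain ⟨he, hp⟩ := expand_root hw hR
      rw [ExpTree.expand, if_neg hl, Linked, he, hp]
      exact ⟨h₁, h₂, h₃, h₄, h₅, ihf hw hR h₆⟩

theorem Above.left {b a : Term σ α} {Td Tf : ExpTree (Term σ α)} (h : Above G (two b a Td Tf)) :
    Above G Td := fun n hn => h n (by simp [nodes, hn])

theorem Above.right {b a : Term σ α} {Td Tf : ExpTree (Term σ α)} (h : Above G (two b a Td Tf)) :
    Above G Tf := fun n hn => h n (by simp [nodes, hn])

theorem Above.child {b a : Term σ α} (h : Above G (one b a T)) :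
    Above G T := fun n hn => h n (by simp [nodes, hn])

theorem Above.pick (h : Above G T) : G ⊆ keySet T.pick := h _ T.root_mem_nodes

/-- The set `g` is the key set of the node itself or of a child, because entry facts are key-equal
to picked facts. -/
theorem Above.subset_gNode {b a : Term σ α} {Td Tf : ExpTree (Term σ α)}
    (h : Above G (two b a Td Tf)) (hL : Linked q D (two b a Td Tf)) : G ⊆ gNode a Td Tf := by
  obtain ⟨-, -, hd, hf, -, -⟩ := hL
  rcases gSet_cases Td.entry a Tf.entry with h' | h' | h' <;> rw [gNode, h']
  · rw [hd.2.1.keySet_eq]; exact h.left.pick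
  · exact h.pick
  · rw [hf.2.1.keySet_eq]; exact h.right.pick

/-- Every set `g` in the tree includes `G`, so none of them fits into `Z`. This removes the linear
term when `width_lt` is applied below a branching with `g ⊄ Z`. -/
theorem cnt_eq_zero (hL : Linked q D T) (h : Above G T) (hG : ¬ G ⊆ Z) : cnt ∅ Z T = 0 := by
  induction T with
  | leaf b a => rfl
  | nil b a => rfl
  | one b a T ih => exact ih hL.2.2.2 h.child
  | two b a Td Tf ihd ihf =>
    have hsub := h.subset_gNode hL
    rw [cnt, ihd hL.2.2.2.2.1 h.left, ihf hL.2.2.2.2.2 h.right, if_neg]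
    exact fun h' => hG (hsub.trans h'.2)

/-- Induction on the tree. At a branching with `g ⊆ Z` and both widths positive, the right subtree
has at most one leaf, which is paid for by the increase of `cnt`. At a branching with `g ⊄ Z`, one
child has all keys above `g`. The induction hypothesis for `g` in place of `G` bounds its width
strictly, without linear term, and `Narrow` bounds the other child by the same power. The doubling
is paid for by the chain, which grows by one since `G ⊆ g`. The strictness is what later absorbs the
additional leaf of an expansion. -/
theorem width_lt (hL : Linked q D T) (hN : Narrow Z T) (hB : Balanced Z T) (h : Above G T) :
    width T + 1 ≤ 2 ^ (chain T G + 1) + cnt ∅ Z T := by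
  induction T generalizing G with
  | leaf b a => simp [chain, cnt]
  | nil b a => simp [chain, cnt]
  | one b a T ih =>
    rw [width_one]
    exact ih hL.2.2.2 hN hB h.child
  | two b a Td Tf ihd ihf =>
    have hsub := h.subset_gNode hL
    obtain ⟨-, -, -, -, hLd, hLf⟩ := hL
    obtain ⟨hw, hNd, hNf⟩ := hN
    obtain ⟨hb, hBd, hBf⟩ := hB
    have hd := ihd hLd hNd hBd h.left
    have hf := ihf hLf hNf hBf h.right
    have hcd : chain Td G ≤ chain (two b a Td Tf) G :=
      (le_max_left _ _).trans (le_max_left _ _)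
    have hcf : chain Tf G ≤ chain (two b a Td Tf) G :=
      (le_max_right _ _).trans (le_max_left _ _)
    have hcg : 1 + max (chain Td (gNode a Td Tf)) (chain Tf (gNode a Td Tf)) ≤
        chain (two b a Td Tf) G := by
      rw [chain, if_pos hsub]
      exact le_max_right _ _
    have hpd : 2 ^ (chain Td G + 1) ≤ 2 ^ (chain (two b a Td Tf) G + 1) :=
      Nat.pow_le_pow_right (by norm_num) (by omega)
    have hpf : 2 ^ (chain Tf G + 1) ≤ 2 ^ (chain (two b a Td Tf) G + 1) :=
      Nat.pow_le_pow_right (by norm_num) (by omega)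
    have hcnt : cnt ∅ Z Td + cnt ∅ Z Tf ≤ cnt ∅ Z (two b a Td Tf) := Nat.le_add_left _ _
    rw [width_two]
    rcases hw with hw | hw | ⟨hg, hw⟩ | ⟨hg, hwd, hwf⟩
    · omega
    · omega
    · have : cnt ∅ Z (two b a Td Tf) = 1 + (cnt ∅ Z Td + cnt ∅ Z Tf) := by
        rw [cnt, if_pos ⟨Set.empty_subset _, hg⟩]
      omega
    · have hp : 2 ^ (1 + max (chain Td (gNode a Td Tf)) (chain Tf (gNode a Td Tf))) ≤
          2 ^ (chain (two b a Td Tf) G) := Nat.pow_le_pow_right (by norm_num) hcg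
      have hp2 : 2 ^ (chain (two b a Td Tf) G + 1) = 2 ^ (chain (two b a Td Tf) G) * 2 :=
        pow_succ _ _
      -- With `P` the power in `Narrow`, the child above `g` has at most `P - 1` leaves and the
      -- other at most `P`, so the sum is below `2 * P`.
      rcases hb with hb | hb | hb
      · exact absurd hb hg
      · have h₁ := ihd hLd hNd hBd hb
        rw [cnt_eq_zero hLd hb hg] at h₁
        have h₂ : 2 ^ (chain Td (gNode a Td Tf) + 1) ≤
          2 ^ (1 + max (chain Td (gNode a Td Tf)) (chain Tf (gNode a Td Tf))) :=
          Nat.pow_le_pow_right (by norm_num) (by omega)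
        omega
      · have h₁ := ihf hLf hNf hBf hb
        rw [cnt_eq_zero hLf hb hg] at h₁
        have h₂ : 2 ^ (chain Tf (gNode a Td Tf) + 1) ≤
          2 ^ (1 + max (chain Td (gNode a Td Tf)) (chain Tf (gNode a Td Tf))) :=
          Nat.pow_le_pow_right (by norm_num) (by omega)
        omega

theorem IsExpansion.narrow {b a : Term σ α} (h : IsExpansion b a R) : Narrow Z R := by
  cases h with
  | nil => trivial
  | one => trivial
  | two b₁ a₁ b₂ a₂ =>
    refine ⟨?_, trivial, trivial⟩
    by_cases hg : gNode a (leaf b₁ a₁) (leaf b₂ a₂) ⊆ Z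
    · exact Or.inr (Or.inr (Or.inl ⟨hg, le_rfl⟩))
    · exact Or.inr (Or.inr (Or.inr ⟨hg, Nat.one_le_two_pow, Nat.one_le_two_pow⟩))

/-- Only the subtree that is entered changes its width. When `g ⊄ Z` and both subtrees have leaves,
the strategy enters the left one while all its keys include `g`. Afterwards the left one is left
alone with the width it had, and balancedness guarantees that all keys of the right one include `g`.
-/
theorem Narrow.expand (hL : Linked q D T) (hLR : Linked q D R) (hT : 0 < width T)
    (hR : IsExpansion (sel Z T).1 (sel Z T).2 R) (hN : Narrow Z T) (hB : Balanced Z T)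
    (hB' : Balanced Z (expand Z R T)) : Narrow Z (expand Z R T) := by
  induction T with
  | leaf b a => exact hR.narrow
  | nil b a => simp at hT
  | one b a T ih => exact ih hL.2.2.2 (by simpa using hT) hR hN hB hB'
  | two b a Td Tf ihd ihf =>
    obtain ⟨-, -, -, -, hLd, hLf⟩ := hL
    obtain ⟨hw, hNd, hNf⟩ := hN
    obtain ⟨hb, hBd, hBf⟩ := hB
    rcases goLeft_or (Z := Z) b a Td Tf hT with hl | ⟨hl, hwf⟩
    · rw [sel, if_pos hl] at hR
      rw [ExpTree.expand, if_pos hl] at hB' ⊢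
      obtain ⟨hb', hBd', -⟩ := hB'
      refine ⟨?_, ihd hLd hl.1 hR hNd hBd hBd', hNf⟩
      have hwe := width_expand_le hl.1 hR
      have hce := chain_le_expand hl.1 hR (gNode a Td Tf)
      rw [gNode_expand_left hl.1 hR]
      by_cases hf0 : width Tf = 0
      · exact Or.inr (Or.inl hf0)
      by_cases hg : gNode a Td Tf ⊆ Z
      · refine Or.inr (Or.inr (Or.inl ⟨hg, ?_⟩))
        have := hl.1
        rcases hw with hw | hw | hw | hw
        · omega
        · omega
        · exact hw.2
        · exact absurd hg hw.1
      · refine Or.inr (Or.inr (Or.inr ⟨hg, ?_, ?_⟩))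
        -- Before the expansion all keys of the left subtree include `g`. The expansion may destroy
        -- this, but the strict bound for the old subtree leaves room for one more leaf.
        · have hab : Above (gNode a Td Tf) Td := by
            rcases hl.2 with h | h | h
            · exact absurd h hg
            · exact absurd h hf0
            · exact h
          have h₁ := width_lt hLd hNd hBd hab
          rw [cnt_eq_zero hLd hab hg] at h₁
          have : 2 ^ (chain Td (gNode a Td Tf) + 1) ≤
            2 ^ (1 + max (chain (ExpTree.expand Z R Td) (gNode a Td Tf))
              (chain Tf (gNode a Td Tf))) :=
            Nat.pow_le_pow_right (by norm_num) (by omega)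
          omega
        · have h0 := hl.1
          rcases hw with hw | hw | hw | hw
          · omega
          · omega
          · exact absurd hw.1 hg
          · exact hw.2.2.trans (Nat.pow_le_pow_right (by norm_num) (by omega))
    · rw [sel, if_neg hl] at hR
      rw [ExpTree.expand, if_neg hl] at hB' ⊢
      obtain ⟨hb', -, hBf'⟩ := hB'
      have hNf' := ihf hLf hwf hR hNf hBf hBf'
      refine ⟨?_, hNd, hNf'⟩
      have hce := chain_le_expand hwf hR (gNode a Td Tf)
      rw [gNode_expand_right hwf hR] at hb' ⊢
      by_cases hd0 : width Td = 0
      · exact Or.inl hd0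
      have hg : ¬ gNode a Td Tf ⊆ Z := fun hg => hl ⟨by omega, Or.inl hg⟩
      have hnd : ¬ Above (gNode a Td Tf) Td := fun h => hl ⟨by omega, Or.inr (Or.inr h)⟩
      refine Or.inr (Or.inr (Or.inr ⟨hg, ?_, ?_⟩))
      · rcases hw with hw | hw | hw | hw
        · omega
        · omega
        · exact absurd hw.1 hg
        · exact hw.2.1.trans (Nat.pow_le_pow_right (by norm_num) (by omega))
      -- The left subtree already has a key that does not include `g`. Balancedness of the expanded
      -- tree thus forces the right subtree, including its new leaves, to stay above `g`, and
      -- `width_lt` applies to the new subtree itself.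
      · have hab : Above (gNode a Td Tf) (ExpTree.expand Z R Tf) := by
          rcases hb' with h | h | h
          · exact absurd h hg
          · exact absurd h hnd
          · exact h
        have hLf' := Linked.expand hwf hR hLf hLR
        have h₁ := width_lt hLf' hNf' hBf' hab
        rw [cnt_eq_zero hLf' hab hg] at h₁
        have : 2 ^ (chain (ExpTree.expand Z R Tf) (gNode a Td Tf) + 1) ≤
            2 ^ (1 + max (chain Td (gNode a Td Tf))
              (chain (ExpTree.expand Z R Tf) (gNode a Td Tf))) :=
            Nat.pow_le_pow_right (by norm_num) (by omega)
        omega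

end Strategy
end ExpTree

/-! ### Counting keys: the numerical bound on the number of leaves -/

theorem exists_finset_keySet (t : Term σ α) :
    ∃ Z : Finset α, Z.card ≤ σ.keyLen ∧ (Z : Set α) = keySet t := by
  classical
  refine ⟨Finset.univ.image (keyTuple t), ?_, ?_⟩
  · exact Finset.card_image_le.trans (by simp)
  · simp [keySet]

theorem keySet_nonempty (hl : 1 ≤ σ.keyLen) (t : Term σ α) : (keySet t).Nonempty :=
  ⟨_, ⟨0, hl⟩, rfl⟩

namespace ExpTree

/-- The keys of the nodes are pairwise distinct. -/
def KeyNodup (T : ExpTree (Term σ α)) : Prop := (T.nodes.map fun n => keyTuple n.2).Nodup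

open Classical in
/-- The number of nodes whose key lies between `G` and `Z`. -/
noncomputable def num (G Z : Set α) (T : ExpTree (Term σ α)) : ℕ :=
  T.nodes.countP fun n => decide (G ⊆ keySet n.2 ∧ keySet n.2 ⊆ Z)

variable {q : Query σ V} {D : Database σ α} {Z G : Set α} {T : ExpTree (Term σ α)}

open Classical in
/-- `1` if `S` lies between `G` and `Z`, and `0` otherwise. -/
noncomputable def ind (G Z S : Set α) : ℕ := if G ⊆ S ∧ S ⊆ Z then 1 else 0

theorem ind_pos {S : Set α} (h : G ⊆ S ∧ S ⊆ Z) : ind G Z S = 1 := if_pos h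

theorem cnt_two (b a : Term σ α) (Td Tf : ExpTree (Term σ α)) :
    cnt G Z (two b a Td Tf) = ind G Z (gNode a Td Tf) + (cnt G Z Td + cnt G Z Tf) := rfl

theorem countP_cons_nodes (n : Term σ α × Term σ α) (L : List (Term σ α × Term σ α)) :
    (open Classical in (n :: L).countP fun n => decide (G ⊆ keySet n.2 ∧ keySet n.2 ⊆ Z)) =
      (open Classical in L.countP fun n => decide (G ⊆ keySet n.2 ∧ keySet n.2 ⊆ Z)) +
        ind G Z (keySet n.2) := by
  rw [List.countP_cons, ind]
  by_cases h : G ⊆ keySet n.2 ∧ keySet n.2 ⊆ Z <;> simp [h]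

theorem num_leaf (b a : Term σ α) : num G Z (leaf b a) = ind G Z (keySet a) := by
  rw [num, nodes, countP_cons_nodes]; simp

theorem num_nil (b a : Term σ α) : num G Z (nil b a) = ind G Z (keySet a) := by
  rw [num, nodes, countP_cons_nodes]; simp

theorem num_one (b a : Term σ α) : num G Z (one b a T) = num G Z T + ind G Z (keySet a) := by
  rw [num, nodes, countP_cons_nodes]; rfl

theorem num_two (b a : Term σ α) (Td Tf : ExpTree (Term σ α)) :
    num G Z (two b a Td Tf) = num G Z Td + num G Z Tf + ind G Z (keySet a) := by
  rw [num, nodes, countP_cons_nodes, List.countP_append]; rfl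

/-- Charge each branching node to the node whose key set is its `g`, which is itself or a child. A
node is charged at most twice, by itself and by its parent. The root has no parent, which accounts
for the extra summand. -/
theorem cnt_add_le (hL : Linked q D T) :
    cnt G Z T + ind G Z (keySet T.pick) ≤ 2 * num G Z T := by
  induction T with
  | leaf b a => rw [num_leaf, cnt, pick]; omega
  | nil b a => rw [num_nil, cnt, pick]; omega
  | one b a T ih =>
    have := ih hL.2.2.2
    rw [num_one, cnt, pick]
    omega
  | two b a Td Tf ihd ihf =>
    obtain ⟨-, -, hd, hf, hLd, hLf⟩ := hL
    have h₁ := ihd hLd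
    have h₂ := ihf hLf
    rw [num_two, cnt_two, pick]
    rcases gSet_cases Td.entry a Tf.entry with h' | h' | h' <;> rw [gNode, h']
    · rw [hd.2.1.keySet_eq]; omega
    · omega
    · rw [hf.2.1.keySet_eq]; omega

theorem exists_num_eq (hT : KeyNodup T) (Z : Finset α) : ∃ s : Finset (Fin σ.keyLen → α),
    s.card = num G Z T ∧ s ⊆ Fintype.piFinset (fun _ => Z) ∧ ∀ t ∈ s, G ⊆ Set.range t := by
  classical
  set L := T.nodes.filter fun n => decide (G ⊆ keySet n.2 ∧ keySet n.2 ⊆ Z) with hL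
  have hmem : ∀ t ∈ L.map (fun n => keyTuple n.2), G ⊆ Set.range t ∧ Set.range t ⊆ Z := by
    intro t ht
    obtain ⟨n, hn, rfl⟩ := List.mem_map.1 ht
    rw [hL, List.mem_filter] at hn
    exact of_decide_eq_true hn.2
  refine ⟨(L.map fun n => keyTuple n.2).toFinset, ?_, ?_, ?_⟩
  · rw [List.toFinset_card_of_nodup, List.length_map, num, List.countP_eq_length_filter]
    exact hT.sublist ((List.filter_sublist).map _)
  · intro t ht
    rw [Fintype.mem_piFinset]
    exact fun i => (hmem t (List.mem_toFinset.1 ht)).2 ⟨i, rfl⟩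
  · exact fun t ht => (hmem t (List.mem_toFinset.1 ht)).1

theorem num_le (hT : KeyNodup T) {Z : Finset α} (hZ : Z.card ≤ σ.keyLen) :
    num G Z T ≤ σ.kappa := by
  obtain ⟨s, hs, hsub, -⟩ := exists_num_eq (G := G) hT Z
  have := Finset.card_le_card hsub
  rw [hs, Fintype.card_piFinset_const] at this
  exact this.trans (Nat.pow_le_pow_left hZ _)

/-- If `Z` has an element `c` other than a fixed `x ∈ G`, the constant tuple `c` has entries in `Z`
but does not include `G`, so it is not counted. Otherwise `Z` has at most one element and there is
at most one tuple, whereas `κ > 1`. -/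
theorem num_lt (hT : KeyNodup T) {Z : Finset α} (hZ : Z.card ≤ σ.keyLen) (hG : G.Nonempty)
    (hl : 2 ≤ σ.keyLen) : num G Z T < σ.kappa := by
  obtain ⟨s, hs, hsub, hsG⟩ := exists_num_eq (G := G) hT Z
  obtain ⟨x, hx⟩ := hG
  by_cases hc : ∃ c ∈ Z, c ≠ x
  · obtain ⟨c, hcZ, hcx⟩ := hc
    have hss : s ⊂ Fintype.piFinset (fun _ => Z) := by
      refine Finset.ssubset_iff_subset_ne.2 ⟨hsub, fun heq => ?_⟩
      have hmem : (fun _ => c) ∈ s := by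
        rw [heq, Fintype.mem_piFinset]; exact fun _ => hcZ
      obtain ⟨i, hi⟩ := hsG _ hmem hx
      exact hcx hi
    have := Finset.card_lt_card hss
    rw [hs, Fintype.card_piFinset_const] at this
    exact this.trans_le (Nat.pow_le_pow_left hZ _)
  · push Not at hc
    have h1 : Z.card ≤ 1 := Finset.card_le_one.2 fun a ha b hb => (hc a ha).trans (hc b hb).symm
    have := Finset.card_le_card hsub
    rw [hs, Fintype.card_piFinset_const] at this
    have h2 : Z.card ^ σ.keyLen ≤ 1 := Nat.pow_le_one_iff (by omega) |>.2 h1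
    have h3 : 1 < σ.keyLen ^ σ.keyLen := Nat.one_lt_pow (by omega) (by omega)
    exact lt_of_le_of_lt (this.trans h2) h3

theorem cnt_mono {G' : Set α} (h : G ⊆ G') : cnt G' Z T ≤ cnt G Z T := by
  induction T with
  | leaf b a => rfl
  | nil b a => rfl
  | one b a T ih => exact ih
  | two b a Td Tf ihd ihf =>
    rw [cnt, cnt]
    by_cases h' : G' ⊆ gNode a Td Tf ∧ gNode a Td Tf ⊆ Z
    · rw [if_pos h', if_pos ⟨h.trans h'.1, h'.2⟩]; omega
    · rw [if_neg h']; omega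

/-- Along a longest chain the sets `g` increase, so all of them lie between the first, `G₀`, and the
last, `Z`. Both are key sets: `G₀` is therefore nonempty and `Z` has at most `l` elements, as the
counting lemmas require. -/
theorem exists_chain_le_cnt (hl : 1 ≤ σ.keyLen) (G : Set α) (T : ExpTree (Term σ α))
    (hT : 0 < chain T G) :
    ∃ (G₀ : Set α) (Z : Finset α), G ⊆ G₀ ∧ G₀ ⊆ Z ∧ G₀.Nonempty ∧ Z.card ≤ σ.keyLen ∧
      chain T G ≤ cnt G₀ Z T := by
  induction T generalizing G with
  | leaf b a => simp [chain] at hT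
  | nil b a => simp [chain] at hT
  | one b a T ih => exact ih G hT
  | two b a Td Tf ihd ihf =>
    set g := gNode a Td Tf with hg
    have hfin : g.Nonempty ∧ ∃ Z : Finset α, Z.card ≤ σ.keyLen ∧ (Z : Set α) = g := by
      rcases gSet_cases Td.entry a Tf.entry with h' | h' | h' <;> rw [hg, gNode, h'] <;>
        exact ⟨keySet_nonempty hl _, exists_finset_keySet _⟩
    have htwo : ∀ (G₀ : Set α) (Z : Finset α),
        cnt G₀ Z Td ≤ cnt G₀ Z (two b a Td Tf) ∧ cnt G₀ Z Tf ≤ cnt G₀ Z (two b a Td Tf) := by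
      intro G₀ Z
      rw [cnt]
      constructor <;> omega
    have hone : ∀ (G₀ : Set α) (Z : Finset α), g ⊆ G₀ → g ⊆ Z →
        1 + cnt G₀ Z Td ≤ cnt g Z (two b a Td Tf) ∧
        1 + cnt G₀ Z Tf ≤ cnt g Z (two b a Td Tf) := by
      intro G₀ Z h₁ h₂
      have e₁ := cnt_mono (Z := (Z : Set α)) (T := Td) h₁
      have e₂ := cnt_mono (Z := (Z : Set α)) (T := Tf) h₁
      rw [cnt, if_pos ⟨subset_rfl, h₂⟩]
      constructor <;> omega
    have hstep : ∀ T' : ExpTree (Term σ α), (T' = Td ∨ T' = Tf) → G ⊆ g →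
        (0 < chain T' g → ∃ (G₀ : Set α) (Z : Finset α), g ⊆ G₀ ∧ G₀ ⊆ Z ∧ G₀.Nonempty ∧
          Z.card ≤ σ.keyLen ∧ chain T' g ≤ cnt G₀ Z T') →
        ∃ (G₀ : Set α) (Z : Finset α), G ⊆ G₀ ∧ G₀ ⊆ Z ∧ G₀.Nonempty ∧ Z.card ≤ σ.keyLen ∧
          1 + chain T' g ≤ cnt G₀ Z (two b a Td Tf) := by
      intro T' hT' hGg ih
      rcases Nat.eq_zero_or_pos (chain T' g) with h0 | h0
      · obtain ⟨hne, Z, hZ, hZg⟩ := hfin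
        refine ⟨g, Z, hGg, hZg.ge, hne, hZ, ?_⟩
        have := (hone g Z subset_rfl hZg.ge).1
        omega
      · obtain ⟨G₀, Z, h₁, h₂, h₃, h₄, h₅⟩ := ih h0
        refine ⟨g, Z, hGg, h₁.trans h₂, hfin.1, h₄, ?_⟩
        have := hone G₀ Z h₁ (h₁.trans h₂)
        rcases hT' with rfl | rfl <;> omega
    have hcases : chain (two b a Td Tf) G = chain Td G ∨ chain (two b a Td Tf) G = chain Tf G ∨
        (G ⊆ g ∧ (chain (two b a Td Tf) G = 1 + chain Td g ∨
          chain (two b a Td Tf) G = 1 + chain Tf g)) := by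
      rw [chain, ← hg]
      by_cases h : G ⊆ g
      · simp only [h, true_and, if_true]
        omega
      · simp only [h, if_false]
        omega
    rcases hcases with h | h | ⟨hGg, h | h⟩
    · obtain ⟨G₀, Z, h₁, h₂, h₃, h₄, h₅⟩ := ihd G (h ▸ hT)
      exact ⟨G₀, Z, h₁, h₂, h₃, h₄, by have := htwo G₀ Z; omega⟩
    · obtain ⟨G₀, Z, h₁, h₂, h₃, h₄, h₅⟩ := ihf G (h ▸ hT)
      exact ⟨G₀, Z, h₁, h₂, h₃, h₄, by have := htwo G₀ Z; omega⟩
    · rw [h]; exact hstep Td (Or.inl rfl) hGg (ihd g)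
    · rw [h]; exact hstep Tf (Or.inr rfl) hGg (ihf g)

/-- By `width_lt` with `G = ∅`, the width is less than `2 ^ (chain + 1) + cnt`. The number `cnt` is
at most `2κ - 1`, and the chain is bounded by twice a number of key tuples. -/
theorem width_le (hl : 1 ≤ σ.keyLen) (hL : Linked q D T) (hT : KeyNodup T)
    (hN : Narrow (keySet T.pick) T) (hB : Balanced (keySet T.pick) T) :
    width T ≤ 2 ^ (2 * σ.kappa + 1) + σ.kappa - 1 := by
  have hw := width_lt (G := ∅) hL hN hB fun n _ => Set.empty_subset _
  have hκ : 1 ≤ σ.kappa := Nat.one_le_pow _ _ hl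
  -- The key of the root lies in `Z` and is charged at most once, which saves one.
  have ht : cnt ∅ (keySet T.pick) T + 1 ≤ 2 * σ.kappa := by
    obtain ⟨Z, hZ, hZk⟩ := exists_finset_keySet T.pick
    have h₁ := cnt_add_le (G := ∅) (Z := keySet T.pick) hL
    rw [ind_pos ⟨Set.empty_subset _, subset_rfl⟩] at h₁
    have h₂ := num_le (G := ∅) hT hZ
    rw [hZk] at h₂
    omega
  rcases Nat.eq_zero_or_pos (chain T ∅) with h0 | h0
  · rw [h0] at hw
    have : 2 ^ 1 ≤ 2 ^ (2 * σ.kappa + 1) := Nat.pow_le_pow_right (by norm_num) (by omega)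
    have := Nat.lt_two_pow_self (n := 2 * σ.kappa)
    rw [pow_succ] at *
    omega
  · obtain ⟨G₀, Z, -, -, hG₀, hZ, hc⟩ := exists_chain_le_cnt hl ∅ T h0
    have h₁ := cnt_add_le (G := G₀) (Z := Z) hL
    rcases Nat.lt_or_ge σ.keyLen 2 with h2 | h2
    -- For `l = 1` the strict count is not available. Then `κ = 1`, the chain has length at most `2`
    -- and `cnt` is at most `1`, so the width is at most `8`, which is exactly the claimed bound.
    · have hl1 : σ.keyLen = 1 := by omega
      have hκ1 : σ.kappa = 1 := by simp [Signature.kappa, hl1]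
      have h₂ := num_le (G := G₀) hT hZ
      have : 2 ^ (chain T ∅ + 1) ≤ 2 ^ 3 := Nat.pow_le_pow_right (by norm_num) (by omega)
      rw [hκ1] at h₂ ht ⊢
      omega
    · have h₂ := num_lt hT hZ hG₀ h2
      have h₃ : 2 ^ (chain T ∅ + 1) ≤ 2 ^ (2 * σ.kappa) :=
        Nat.pow_le_pow_right (by norm_num) (by omega)
      have := Nat.lt_two_pow_self (n := 2 * σ.kappa)
      rw [pow_succ]
      omega

end ExpTree

/-! ### Tripaths from unbalanced exploration trees -/

/-- A tripath from a numbering of its blocks: `0, …, p` lead from the root to the branching block,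
`p + 1, …, p + m` and `p + m + 1, …, p + m + n` from its two children to the leaves. -/
theorem Query.containsTripath_of_numbering [DecidableEq α] {q : Query σ V} {D : Database σ α}
    (a b : ℕ → Term σ α) (p m n : ℕ) (hp : 1 ≤ p) (hm : 1 ≤ m) (hn : 1 ≤ n)
    (haD : ∀ i ≤ p + m + n, a i ∈ D)
    (hkey : ∀ i ≤ p + m + n, ∀ j ≤ p + m + n, KeyEq (a i) (a j) → i = j)
    (hb : ∀ i ≤ p + m + n, 1 ≤ i → b i ∈ D ∧ KeyEq (b i) (a i) ∧ b i ≠ a i)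
    (hedge : ∀ i ≤ p + m + n, 1 ≤ i → q.SolSymm (a (if i = p + m + 1 then p else i - 1)) (b i))
    (hd : q.Sol (b (p + 1)) (a p)) (hf : q.Sol (a p) (b (p + m + 1)))
    (hg₀ : ¬ gSet (b (p + 1)) (a p) (b (p + m + 1)) ⊆ keySet (a 0))
    (hg₁ : ¬ gSet (b (p + 1)) (a p) (b (p + m + 1)) ⊆ keySet (b (p + m)))
    (hg₂ : ¬ gSet (b (p + 1)) (a p) (b (p + m + 1)) ⊆ keySet (b (p + m + n))) :
    q.ContainsTripath D := by
  classical
  set N := p + m + n with hN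
  let par : ℕ → ℕ := fun i => if i = p + m + 1 then p else i - 1
  -- The root block keeps only `a` and the leaf blocks keep only `b`, as a tripath demands. In
  -- particular `b 0` plays no role.
  let Bl : ℕ → Finset (Term σ α) := fun i =>
    if i = 0 then {a 0} else if i = p + m ∨ i = N then {b i} else {a i, b i}
  have hBl : ∀ i ≤ N, ∀ u ∈ Bl i, KeyEq u (a i) ∧ u ∈ D := by
    intro i hi u hu
    simp only [Bl] at hu
    split_ifs at hu with h₁ h₂
    · rw [Finset.mem_singleton] at hu
      subst hu h₁
      exact ⟨KeyEq.refl _, haD _ hi⟩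
    · rw [Finset.mem_singleton] at hu
      subst hu
      have := hb i hi (by omega)
      exact ⟨this.2.1, this.1⟩
    · rw [Finset.mem_insert, Finset.mem_singleton] at hu
      rcases hu with rfl | rfl
      · exact ⟨KeyEq.refl _, haD _ hi⟩
      · have := hb i hi (by omega)
        exact ⟨this.2.1, this.1⟩
  have hBlne : ∀ i, (Bl i).Nonempty := by
    intro i
    simp only [Bl]
    split_ifs <;> simp
  let Θ : Database σ α := (Finset.range (N + 1)).biUnion Bl
  have hΘ : ∀ u, u ∈ Θ ↔ ∃ i ≤ N, u ∈ Bl i := by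
    intro u
    simp [Θ, Finset.mem_biUnion]
  have hblock : ∀ i ≤ N, ∀ u ∈ Bl i, blockOf Θ u = Bl i := by
    intro i hi u hu
    ext v
    rw [mem_blockOf, hΘ]
    constructor
    · rintro ⟨⟨j, hj, hv⟩, hvu⟩
      have := hkey j hj i hi (((hBl j hj v hv).1.symm.trans hvu).trans (hBl i hi u hu).1)
      exact this ▸ hv
    · exact fun hv => ⟨⟨i, hi, hv⟩, (hBl i hi v hv).1.trans (hBl i hi u hu).1.symm⟩
  have hblocks : ∀ B, B ∈ blocks Θ ↔ ∃ i ≤ N, Bl i = B := by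
    intro B
    rw [blocks, Finset.mem_image]
    constructor
    · rintro ⟨u, hu, rfl⟩
      obtain ⟨i, hi, hui⟩ := (hΘ u).1 hu
      exact ⟨i, hi, (hblock i hi u hui).symm⟩
    · rintro ⟨i, hi, rfl⟩
      obtain ⟨u, hu⟩ := hBlne i
      exact ⟨u, (hΘ u).2 ⟨i, hi, hu⟩, hblock i hi u hu⟩
  have hinj : ∀ i ≤ N, ∀ j ≤ N, Bl i = Bl j → i = j := by
    intro i hi j hj hij
    obtain ⟨u, hu⟩ := hBlne i
    exact hkey i hi j hj ((hBl i hi u hu).1.symm.trans (hBl j hj u (hij ▸ hu)).1)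
  -- The tripath data are functions of blocks, so the numbering has to be inverted; outside the
  -- blocks the value `0` is arbitrary.
  let idx : Finset (Term σ α) → ℕ := fun B => if h : ∃ i ≤ N, Bl i = B then h.choose else 0
  have hidx : ∀ i ≤ N, idx (Bl i) = i := by
    intro i hi
    have h : ∃ j ≤ N, Bl j = Bl i := ⟨i, hi, rfl⟩
    simp only [idx, dif_pos h]
    exact hinj _ h.choose_spec.1 _ hi h.choose_spec.2
  have hpar : ∀ i ≤ N, par i ≤ N := by
    intro i hi; simp only [par]; split_ifs <;> omega
  have hmem : ∀ i ≤ N, Bl i ∈ blocks Θ := fun i hi => (hblocks _).2 ⟨i, hi, rfl⟩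
  have hne : ∀ i ≤ N, ∀ j ≤ N, i ≠ j → Bl i ≠ Bl j := fun i hi j hj h h' => h (hinj i hi j hj h')
  have e0 := hidx 0 (by omega)
  have e1 := hidx p (by omega)
  have e2 := hidx (p + 1) (by omega)
  have e3 := hidx (p + m + 1) (by omega)
  have e4 := hidx (p + m) (by omega)
  have e5 := hidx N le_rfl
  refine ⟨Θ, fun u hu => ?_, ⟨{
    parent := fun B => Bl (par (idx B))
    a := fun B => a (idx B)
    b := fun B => b (idx B)
    root := Bl 0
    leaf₁ := Bl (p + m)
    leaf₂ := Bl N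
    branch := Bl p
    child₁ := Bl (p + 1)
    child₂ := Bl (p + m + 1)
    root_mem := hmem _ (by omega)
    parent_mem := ?_
    reach_root := ?_
    leaf₁_mem := hmem _ (by omega)
    leaf₂_mem := hmem _ (by omega)
    leaf_ne := hne _ (by omega) _ (by omega) (by omega)
    leaf_iff := ?_
    branch_mem := hmem _ (by omega)
    child₁_mem := hmem _ (by omega)
    child₂_mem := hmem _ (by omega)
    child₁_ne_root := hne _ (by omega) _ (by omega) (by omega)
    child₂_ne_root := hne _ (by omega) _ (by omega) (by omega)
    child_ne := hne _ (by omega) _ (by omega) (by omega)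
    parent_child₁ := ?_
    parent_child₂ := ?_
    root_eq := ?_
    leaf₁_eq := ?_
    leaf₂_eq := ?_
    inner_eq := ?_
    edge := ?_
    center := ?_
    g_root := ?_
    g_leaf₁ := ?_
    g_leaf₂ := ?_ }⟩⟩
  · obtain ⟨i, hi, hui⟩ := (hΘ u).1 hu
    exact (hBl i hi u hui).2
  · rintro B hB -
    obtain ⟨i, hi, rfl⟩ := (hblocks B).1 hB
    rw [hidx i hi]
    exact hmem _ (hpar i hi)
  · intro B hB
    obtain ⟨i, hi, rfl⟩ := (hblocks B).1 hB
    clear hB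
    induction i using Nat.strong_induction_on with
    | _ i ih =>
      rcases Nat.eq_zero_or_pos i with rfl | h0
      · exact ⟨0, rfl⟩
      · have hlt : par i < i := by simp only [par]; split_ifs <;> omega
        obtain ⟨k, hk⟩ := ih (par i) hlt (hpar i hi)
        refine ⟨k + 1, ?_⟩
        rw [Function.iterate_succ_apply, hidx i hi]
        exact hk
  · intro B hB
    obtain ⟨i, hi, rfl⟩ := (hblocks B).1 hB
    constructor
    · intro h
      by_contra hcon
      push Not at hcon
      have h1 : i ≠ p + m := fun h => hcon.1 (by rw [h])
      have h2 : i ≠ N := fun h => hcon.2 (by rw [h])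
      refine h (Bl (i + 1)) (hmem _ (by omega)) (hne _ (by omega) _ (by omega) (by omega)) ?_
      rw [hidx _ (by omega)]
      simp only [par]
      rw [if_neg (by omega), Nat.add_sub_cancel]
    · intro h B' hB' hB'r hB'p
      obtain ⟨j, hj, rfl⟩ := (hblocks B').1 hB'
      have hj0 : j ≠ 0 := fun h => hB'r (by rw [h])
      rw [hidx j hj] at hB'p
      have hpj := hinj _ (hpar j hj) _ hi hB'p
      have hi' : i = p + m ∨ i = N := h.imp (hinj _ hi _ (by omega)) (hinj _ hi _ le_rfl)
      simp only [par] at hpj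
      split_ifs at hpj <;> omega
  · rw [e2]; simp only [par]; rw [if_neg (by omega), Nat.add_sub_cancel]
  · rw [e3]; simp [par]
  · rw [e0]; simp [Bl]
  · rw [e4]; simp only [Bl]; rw [if_neg (by omega)]; simp
  · rw [e5]; simp only [Bl]; rw [if_neg (by omega)]; simp
  · intro B hB h1 h2 h3
    obtain ⟨i, hi, rfl⟩ := (hblocks B).1 hB
    have hi0 : i ≠ 0 := fun h => h1 (by rw [h])
    have hi1 : i ≠ p + m := fun h => h2 (by rw [h])
    have hi2 : i ≠ N := fun h => h3 (by rw [h])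
    rw [hidx i hi]
    refine ⟨((hb i hi (by omega)).2.2).symm, ?_⟩
    simp only [Bl]
    rw [if_neg hi0, if_neg (by omega)]
  · intro B hB h1
    obtain ⟨i, hi, rfl⟩ := (hblocks B).1 hB
    have hi0 : i ≠ 0 := fun h => h1 (by rw [h])
    rw [hidx i hi, hidx _ (hpar i hi)]
    exact hedge i hi (by omega)
  · rw [e1, e2, e3]; exact ⟨hd, hf⟩
  · rw [e0, e1, e2, e3]; exact hg₀
  · rw [e1, e2, e3, e4]; exact hg₁
  · rw [e1, e2, e3, e5]; exact hg₂

namespace ExpTree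
variable {q : Query σ V} {D : Database σ α} {Z G : Set α} {T : ExpTree (Term σ α)}

/-- Separates the root, which is not entered through a solution and whose entry fact may equal its
pick, from the other nodes, whose entry and pick are distinct key-equal facts as in the inner blocks
of a tripath. -/
theorem Linked.link (h : Linked q D T) :
    T.pick ∈ D ∧ ∃ L, T.nodes = (T.entry, T.pick) :: L ∧
      ∀ n ∈ L, n.2 ∈ D ∧ n.1 ∈ D ∧ KeyEq n.1 n.2 ∧ n.1 ≠ n.2 := by
  induction T with
  | leaf b a => exact ⟨h, [], rfl, by simp⟩
  | nil b a => exact ⟨h, [], rfl, by simp⟩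
  | one b a T ih =>
    obtain ⟨ha, -, hT, hL⟩ := h
    obtain ⟨hp, L, hn, hLn⟩ := ih hL
    refine ⟨ha, T.nodes, rfl, ?_⟩
    rw [hn]
    intro n hn
    rcases List.mem_cons.1 hn with rfl | hn
    · exact ⟨hp, hT⟩
    · exact hLn n hn
  | two b a Td Tf ihd ihf =>
    obtain ⟨ha, -, hTd, hTf, hLd, hLf⟩ := h
    obtain ⟨hpd, L₁, hn₁, hL₁⟩ := ihd hLd
    obtain ⟨hpf, L₂, hn₂, hL₂⟩ := ihf hLf
    refine ⟨ha, Td.nodes ++ Tf.nodes, rfl, ?_⟩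
    rw [hn₁, hn₂]
    intro n hn
    rcases List.mem_append.1 hn with hn | hn <;> rcases List.mem_cons.1 hn with rfl | hn
    · exact ⟨hpd, hTd⟩
    · exact hL₁ n hn
    · exact ⟨hpf, hTf⟩
    · exact hL₂ n hn

/-- `L` lists the nodes on a path that starts at the root of `T`. -/
structure IsPath (q : Query σ V) (T : ExpTree (Term σ α)) (L : List (Term σ α × Term σ α)) :
    Prop where
  head : L.head? = some (T.entry, T.pick)
  chain : L.IsChain fun x y => q.SolSymm x.2 y.1

theorem IsPath.cons {U : ExpTree (Term σ α)} {L : List (Term σ α × Term σ α)}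
    (h : IsPath q U L) {b a : Term σ α} (hTb : T.entry = b) (hTa : T.pick = a)
    (hs : q.SolSymm a U.entry) : IsPath q T ((b, a) :: L) := by
  refine ⟨by simp [hTb, hTa], ?_⟩
  rw [List.isChain_cons]
  refine ⟨fun y hy => ?_, h.chain⟩
  rw [h.head, Option.mem_some_iff] at hy
  subst hy
  exact hs

theorem IsPath.singleton {b a : Term σ α} (hTb : T.entry = b) (hTa : T.pick = a) :
    IsPath q T [(b, a)] := ⟨by simp [hTb, hTa], by simp⟩

theorem exists_path (h : Linked q D T) {n : Term σ α × Term σ α} (hn : n ∈ T.nodes) :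
    ∃ L, IsPath q T L ∧ L.Sublist T.nodes ∧ L.getLast? = some n := by
  induction T with
  | leaf b a =>
    obtain rfl : n = (b, a) := by simpa [nodes] using hn
    exact ⟨[(b, a)], .singleton rfl rfl, by simp [nodes], by simp⟩
  | nil b a =>
    obtain rfl : n = (b, a) := by simpa [nodes] using hn
    exact ⟨[(b, a)], .singleton rfl rfl, by simp [nodes], by simp⟩
  | one b a T ih =>
    rcases List.mem_cons.1 hn with rfl | hn
    · exact ⟨[(b, a)], .singleton rfl rfl, by simp [nodes], by simp⟩
    · obtain ⟨L, hL, hs, hl⟩ := ih h.2.2.2 hn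
      exact ⟨(b, a) :: L, hL.cons rfl rfl h.2.1, hs.cons_cons _, by simp [List.getLast?_cons, hl]⟩
  | two b a Td Tf ihd ihf =>
    rcases List.mem_cons.1 hn with rfl | hn
    · exact ⟨[(b, a)], .singleton rfl rfl, by simp [nodes], by simp⟩
    · rcases List.mem_append.1 hn with hn | hn
      · obtain ⟨L, hL, hs, hl⟩ := ihd h.2.2.2.2.1 hn
        exact ⟨(b, a) :: L, hL.cons rfl rfl (Or.inr h.2.1.1),
          (hs.trans (List.sublist_append_left _ _)).cons_cons _,
          by simp [List.getLast?_cons, hl]⟩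
      · obtain ⟨L, hL, hs, hl⟩ := ihf h.2.2.2.2.2 hn
        exact ⟨(b, a) :: L, hL.cons rfl rfl (Or.inl h.2.1.2),
          (hs.trans (List.sublist_append_right _ _)).cons_cons _,
          by simp [List.getLast?_cons, hl]⟩

/-- Descend to a branching node that violates the condition itself. The two keys that do not include
its `g` are the ends of the lower branches. Having the concatenated paths as a sublist of the
preorder makes their blocks pairwise distinct. -/
theorem exists_paths_of_not_balanced (h : Linked q D T) (hB : ¬ Balanced Z T) :
    ∃ (L₁ L₂ L₃ : List (Term σ α × Term σ α)) (e x₂ x₃ : Term σ α × Term σ α)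
      (Td Tf : ExpTree (Term σ α)),
      (L₁ ++ (L₂ ++ L₃)).Sublist T.nodes ∧ IsPath q T L₁ ∧ IsPath q Td L₂ ∧ IsPath q Tf L₃ ∧
      L₁.getLast? = some e ∧ L₂.getLast? = some x₂ ∧ L₃.getLast? = some x₃ ∧
      q.Sol Td.entry e.2 ∧ q.Sol e.2 Tf.entry ∧
      ¬ gSet Td.entry e.2 Tf.entry ⊆ Z ∧ ¬ gSet Td.entry e.2 Tf.entry ⊆ keySet x₂.2 ∧
      ¬ gSet Td.entry e.2 Tf.entry ⊆ keySet x₃.2 := by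
  induction T with
  | leaf b a => exact absurd trivial hB
  | nil b a => exact absurd trivial hB
  | one b a T ih =>
    obtain ⟨L₁, L₂, L₃, e, x₂, x₃, Td, Tf, hs, h₁, h₂, h₃, hl₁, hl⟩ := ih h.2.2.2 hB
    exact ⟨(b, a) :: L₁, L₂, L₃, e, x₂, x₃, Td, Tf, hs.cons_cons _, h₁.cons rfl rfl h.2.1, h₂, h₃,
      by simp [List.getLast?_cons, hl₁], hl⟩
  | two b a Ud Uf ihd ihf =>
    obtain ⟨ha, hsol, hd, hf, hLd, hLf⟩ := h
    by_cases hBd : Balanced Z Ud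
    · by_cases hBf : Balanced Z Uf
      · have hg : ¬ (gNode a Ud Uf ⊆ Z ∨ Above (gNode a Ud Uf) Ud ∨ Above (gNode a Ud Uf) Uf) :=
          fun hg => hB ⟨hg, hBd, hBf⟩
        simp only [Above] at hg
        push Not at hg
        obtain ⟨hgZ, ⟨x₂, hx₂, hg₂⟩, x₃, hx₃, hg₃⟩ := hg
        obtain ⟨L₂, h₂, hs₂, hl₂⟩ := exists_path hLd hx₂
        obtain ⟨L₃, h₃, hs₃, hl₃⟩ := exists_path hLf hx₃
        exact ⟨[(b, a)], L₂, L₃, (b, a), x₂, x₃, Ud, Uf, (hs₂.append hs₃).cons_cons _,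
          .singleton rfl rfl, h₂, h₃, by simp, hl₂, hl₃, hsol.1, hsol.2, hgZ, hg₂, hg₃⟩
      · obtain ⟨L₁, L₂, L₃, e, x₂, x₃, Td, Tf, hs, h₁, h₂, h₃, hl₁, hl⟩ := ihf hLf hBf
        exact ⟨(b, a) :: L₁, L₂, L₃, e, x₂, x₃, Td, Tf,
          (hs.trans (List.sublist_append_right _ _)).cons_cons _,
          h₁.cons rfl rfl (Or.inl hsol.2), h₂, h₃, by simp [List.getLast?_cons, hl₁], hl⟩
    · obtain ⟨L₁, L₂, L₃, e, x₂, x₃, Td, Tf, hs, h₁, h₂, h₃, hl₁, hl⟩ := ihd hLd hBd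
      exact ⟨(b, a) :: L₁, L₂, L₃, e, x₂, x₃, Td, Tf,
        (hs.trans (List.sublist_append_left _ _)).cons_cons _,
        h₁.cons rfl rfl (Or.inr hsol.1), h₂, h₃, by simp [List.getLast?_cons, hl₁], hl⟩

/-- The three paths, listed one after the other, are a numbering of the blocks of a tripath: picks
serve as `a`, entries as `b`, and the failure of balancedness gives the three key conditions. -/
theorem balanced_of_not_containsTripath [DecidableEq α] (hD : ¬ q.ContainsTripath D)
    (h : Linked q D T) (hT : KeyNodup T) : Balanced (keySet T.pick) T := by
  by_contra hB
  obtain ⟨L₁, L₂, L₃, e, x₂, x₃, Td, Tf, hs, h₁, h₂, h₃, hl₁, hl₂, hl₃, hd, hf, hgZ, hg₂, hg₃⟩ :=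
    exists_paths_of_not_balanced h hB
  apply hD
  obtain ⟨hpD, L, hnodes, hlink⟩ := h.link
  obtain ⟨K₁, rfl⟩ : ∃ K, L₁ = (T.entry, T.pick) :: K := by
    cases L₁ with
    | nil => simpa using h₁.head
    | cons x K => exact ⟨K, by simpa using h₁.head⟩
  obtain ⟨K₂, rfl⟩ : ∃ K, L₂ = (Td.entry, Td.pick) :: K := by
    cases L₂ with
    | nil => simpa using h₂.head
    | cons x K => exact ⟨K, by simpa using h₂.head⟩
  obtain ⟨K₃, rfl⟩ : ∃ K, L₃ = (Tf.entry, Tf.pick) :: K := by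
    cases L₃ with
    | nil => simpa using h₃.head
    | cons x K => exact ⟨K, by simpa using h₃.head⟩
  set M₁ := (T.entry, T.pick) :: K₁ with hM₁
  set M₂ := (Td.entry, Td.pick) :: K₂ with hM₂
  set M₃ := (Tf.entry, Tf.pick) :: K₃ with hM₃
  set M := M₁ ++ (M₂ ++ M₃) with hM
  have hlen₁ : M₁.length = K₁.length + 1 := rfl
  have hlen₂ : M₂.length = K₂.length + 1 := rfl
  have hlen₃ : M₃.length = K₃.length + 1 := rfl
  have hlen : M.length = M₁.length + (M₂.length + M₃.length) := by simp [hM]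
  let F : ℕ → Term σ α × Term σ α := fun i => M.getD i (T.entry, T.pick)
  have hF : ∀ i (hi : i < M.length), F i = M[i] := fun i hi => List.getD_eq_getElem _ _ hi
  have hF₁ : ∀ i (hi : i < M₁.length), F i = M₁[i] := by
    intro i hi
    rw [hF i (by omega)]
    exact List.getElem_append_left hi
  have hF₂ : ∀ i (hi : i < M₂.length), F (M₁.length + i) = M₂[i] := by
    intro i hi
    rw [hF _ (by omega)]
    simp only [hM]
    rw [List.getElem_append_right (by omega), List.getElem_append_left (by omega)]
    congr 1; omega
  have hF₃ : ∀ i (hi : i < M₃.length), F (M₁.length + M₂.length + i) = M₃[i] := by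
    intro i hi
    rw [hF _ (by omega)]
    simp only [hM]
    rw [List.getElem_append_right (by omega), List.getElem_append_right (by omega)]
    congr 1; omega
  have hlast : ∀ (K : List (Term σ α × Term σ α)) (x y) (_ : (y :: K).getLast? = some x),
      (y :: K)[K.length]'(by simp) = x := by
    intro K x y hx
    rw [List.getLast?_eq_getElem?, List.getElem?_eq_some_iff] at hx
    obtain ⟨_, hx⟩ := hx
    simpa using hx
  have hFe : F K₁.length = e := (hF₁ _ (by omega)).trans (hlast _ _ _ hl₁)
  have hFx₂ : F (K₁.length + M₂.length) = x₂ := by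
    rw [show K₁.length + M₂.length = M₁.length + K₂.length by omega, hF₂ _ (by omega)]
    exact hlast _ _ _ hl₂
  have hFx₃ : F (K₁.length + M₂.length + M₃.length) = x₃ := by
    rw [show K₁.length + M₂.length + M₃.length = M₁.length + M₂.length + K₃.length by omega,
      hF₃ _ (by omega)]
    exact hlast _ _ _ hl₃
  have hF0 : F 0 = (T.entry, T.pick) := hF₁ 0 (by omega)
  have hFd : F (K₁.length + 1) = (Td.entry, Td.pick) := hF₂ 0 (by omega)
  have hFf : F (K₁.length + M₂.length + 1) = (Tf.entry, Tf.pick) := by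
    rw [show K₁.length + M₂.length + 1 = M₁.length + M₂.length + 0 by omega]
    exact hF₃ 0 (by omega)
  have hsub : (K₁ ++ (M₂ ++ M₃)).Sublist L := by
    rw [hnodes] at hs
    exact List.cons_sublist_cons.1 hs
  have hnode : ∀ i < M.length, 1 ≤ i →
      (F i).2 ∈ D ∧ (F i).1 ∈ D ∧ KeyEq (F i).1 (F i).2 ∧ (F i).1 ≠ (F i).2 := by
    intro i hi h1
    refine hlink _ (hsub.subset ?_)
    obtain ⟨j, rfl⟩ : ∃ j, i = j + 1 := ⟨i - 1, by omega⟩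
    rw [hF _ hi]
    exact List.getElem_mem (l := K₁ ++ (M₂ ++ M₃)) (by simp at hlen hi ⊢; omega)
  have hnd : (M.map fun n => keyTuple n.2).Nodup := hT.sublist (hs.map _)
  have hinj : ∀ i < M.length, ∀ j < M.length, KeyEq (F i).2 (F j).2 → i = j := by
    intro i hi j hj hij
    rw [hF i hi, hF j hj] at hij
    refine (hnd.getElem_inj_iff (hi := by simpa using hi) (hj := by simpa using hj)).1 ?_
    simpa [KeyEq] using hij
  have hedge₁ := List.isChain_iff_getElem.1 h₁.chain
  have hedge₂ := List.isChain_iff_getElem.1 h₂.chain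
  have hedge₃ := List.isChain_iff_getElem.1 h₃.chain
  -- The branching node is not the root: `g` is contained in the key of the branching fact, but not
  -- in `Z`, the key of the root.
  have hF0' : 1 ≤ K₁.length := by
    by_contra hlt
    have : K₁.length = 0 := by omega
    rw [this, hF0] at hFe
    apply hgZ
    rw [← hFe]
    exact gSet_subset _ _ _
  refine Query.containsTripath_of_numbering (fun i => (F i).2) (fun i => (F i).1) K₁.length
    M₂.length M₃.length hF0' (by omega) (by omega) ?_ ?_ ?_ ?_ ?_ ?_ ?_ ?_ ?_
  · intro i hi
    rcases Nat.eq_zero_or_pos i with rfl | h0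
    · simpa [hF0] using hpD
    · exact (hnode i (by omega) h0).1
  · exact fun i hi j hj => hinj i (by omega) j (by omega)
  · exact fun i hi h1 => (hnode i (by omega) h1).2
  · intro i hi h1
    by_cases hif : i = K₁.length + M₂.length + 1
    · rw [if_pos hif, hif, hFe, hFf]
      exact Or.inl hf
    rw [if_neg hif]
    by_cases hi₁ : i < M₁.length
    · obtain ⟨j, rfl⟩ : ∃ j, i = j + 1 := ⟨i - 1, by omega⟩
      rw [Nat.add_sub_cancel, hF₁ j (by omega), hF₁ (j + 1) hi₁]
      exact hedge₁ j _
    by_cases hi₂ : i = M₁.length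
    · rw [hi₂, hlen₁, Nat.add_sub_cancel, hFe, hFd]
      exact Or.inr hd
    by_cases hi₃ : i < M₁.length + M₂.length
    · obtain ⟨j, rfl⟩ : ∃ j, i = M₁.length + (j + 1) := ⟨i - M₁.length - 1, by omega⟩
      rw [← add_assoc, Nat.add_sub_cancel, add_assoc, hF₂ j (by omega), hF₂ (j + 1) (by omega)]
      exact hedge₂ j _
    · obtain ⟨j, rfl⟩ : ∃ j, i = M₁.length + M₂.length + (j + 1) :=
        ⟨i - (M₁.length + M₂.length) - 1, by omega⟩
      rw [← add_assoc, Nat.add_sub_cancel, add_assoc _ j 1, hF₃ j (by omega),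
        hF₃ (j + 1) (by omega)]
      exact hedge₃ j _
  · rw [hFd, hFe]; exact hd
  · rw [hFf, hFe]; exact hf
  · rw [hFd, hFe, hFf, hF0]; exact hgZ
  · rw [hFd, hFe, hFf, (hnode (K₁.length + M₂.length) (by omega) (by omega)).2.2.1.keySet_eq, hFx₂]
    exact hg₂
  · rw [hFd, hFe, hFf, (hnode (K₁.length + M₂.length + M₃.length) (by omega)
      (by omega)).2.2.1.keySet_eq, hFx₃]
    exact hg₃

end ExpTree

/-! ### From a finished exploration to a repair without solutions -/

theorem isRepair_of_forall_exists_keyEq {D r : Database σ α} (hr : r ⊆ D) (hc : Consistent r)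
    (h : ∀ v ∈ D, ∃ u ∈ r, KeyEq u v) : IsRepair D r := by
  refine ⟨⟨hr, hc⟩, fun s hs hrs v hv => ?_⟩
  obtain ⟨u, hu, huv⟩ := h v (hs.1 hv)
  exact hs.2 u (hrs hu) v hv huv ▸ hu

namespace ExpTree

theorem keyNodup_iff {T : ExpTree (Term σ α)} :
    KeyNodup T ↔ ((picks T).map keyTuple).Nodup := by
  rw [← coe_map_nodes, Multiset.map_coe, Multiset.coe_nodup, List.map_map]
  rfl

theorem IsExpansion.picks_eq {F : Type*} {b a : F} {R : ExpTree F} (h : IsExpansion b a R) :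
    picks R = a ::ₘ active R := by
  cases h <;> rfl

theorem IsExpansion.processed_eq {F : Type*} {b a : F} {R : ExpTree F} (h : IsExpansion b a R) :
    processed R = {a} := by
  cases h <;> rfl

theorem picks_expand {Z : Set α} {T R : ExpTree (Term σ α)} (hw : 0 < width T)
    (hR : IsExpansion (sel Z T).1 (sel Z T).2 R) : picks (expand Z R T) = picks T + active R := by
  obtain ⟨rest, h₁, h₂⟩ := expand_collect (Z := Z) (R := R)
    (fun _ a => ({a} : Multiset (Term σ α))) (fun _ a => {a}) hw
  have h₃ : picks R = {(sel Z T).2} + active R := hR.picks_eq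
  rw [picks] at h₃ ⊢
  rw [picks, h₂, h₁, h₃]
  abel

theorem processed_expand {Z : Set α} {T R : ExpTree (Term σ α)} (hw : 0 < width T)
    (hR : IsExpansion (sel Z T).1 (sel Z T).2 R) :
    processed (expand Z R T) = (sel Z T).2 ::ₘ processed T := by
  obtain ⟨rest, h₁, h₂⟩ := expand_collect (Z := Z) (R := R)
    (fun _ _ => (0 : Multiset (Term σ α))) (fun _ a => {a}) hw
  have h₃ := hR.processed_eq
  rw [processed] at h₃ ⊢
  rw [processed, h₂, h₁, h₃, zero_add, Multiset.singleton_add]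

theorem active_expand {Z : Set α} {T R : ExpTree (Term σ α)} (hw : 0 < width T) :
    ∃ rest, active T = (sel Z T).2 ::ₘ rest ∧ active (expand Z R T) = active R + rest :=
  expand_collect (Z := Z) (R := R) (fun _ a => ({a} : Multiset (Term σ α))) (fun _ _ => 0) hw

theorem keyNodup_expand {Z : Set α} {T R : ExpTree (Term σ α)} (hw : 0 < width T)
    (hR : IsExpansion (sel Z T).1 (sel Z T).2 R) (hT : KeyNodup T)
    (hnew : ∀ u ∈ active R, ∀ y ∈ picks T, ¬ KeyEq y u)
    (hnd : ((active R).map keyTuple).Nodup) : KeyNodup (expand Z R T) := by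
  rw [keyNodup_iff] at hT ⊢
  rw [picks_expand hw hR, Multiset.map_add, Multiset.nodup_add]
  refine ⟨hT, hnd, ?_⟩
  rw [Multiset.disjoint_left]
  intro t ht ht'
  obtain ⟨y, hy, rfl⟩ := Multiset.mem_map.1 ht
  obtain ⟨u, hu, huy⟩ := Multiset.mem_map.1 ht'
  exact hnew u hu y hy huy.symm

variable [DecidableEq α] {q : Query σ V} {k : ℕ} {D : Database σ α}

/-- An exploration of `D`: the picked facts do not satisfy `q`, the algorithm does not derive any
set of leaves, and the blocks of the solution partners of processed facts are all explored. -/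
structure Explored (q : Query σ V) (k : ℕ) (D : Database σ α) (T : ExpTree (Term σ α)) :
    Prop where
  linked : Linked q D T
  keyNodup : KeyNodup T
  narrow : Narrow (keySet T.pick) T
  underived : Underived q k D (active T).toFinset
  not_sol : ∀ x ∈ picks T, ∀ y ∈ picks T, ¬ q.Sol x y
  closed : ∀ x ∈ processed T, ∀ v ∈ D, q.SolSymm x v → ∃ y ∈ picks T, KeyEq y v

/-- Separate from `Explored.expand` because the bound on the width is also needed for a provisional
expansion that is not known to be underived. -/
theorem narrow_expand (hD : ¬ q.ContainsTripath D) {T R : ExpTree (Term σ α)} (hL : Linked q D T)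
    (hT : KeyNodup T) (hN : Narrow (keySet T.pick) T) (hw : 0 < width T)
    (hR : IsExpansion (sel (keySet T.pick) T).1 (sel (keySet T.pick) T).2 R) (hLR : Linked q D R)
    (hT' : KeyNodup (expand (keySet T.pick) R T)) :
    Linked q D (expand (keySet T.pick) R T) ∧
      Narrow (keySet (expand (keySet T.pick) R T).pick) (expand (keySet T.pick) R T) := by
  have hL' := Linked.expand hw hR hL hLR
  have hB' := balanced_of_not_containsTripath hD hL' hT'
  rw [(expand_root hw hR).2] at hB' ⊢
  exact ⟨hL', Narrow.expand hL hLR hw hR hN (balanced_of_not_containsTripath hD hL hT) hB'⟩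

/-- A new fact forms no solution with a processed fact, since its block would then have been
explored before. It forms none with an active fact because all active and new facts together are
underived. This set still contains the expanded leaf, which is dropped only afterwards, when its
partners' blocks are all explored. -/
theorem Explored.expand (hk : 2 ≤ k) (hD : ¬ q.ContainsTripath D) {T R : ExpTree (Term σ α)}
    (h : Explored q k D T) (hw : 0 < width T)
    (hR : IsExpansion (sel (keySet T.pick) T).1 (sel (keySet T.pick) T).2 R) (hLR : Linked q D R)
    (hU : Underived q k D (active T + active R).toFinset)
    (hnew : ∀ u ∈ active R, ∀ y ∈ picks T, ¬ KeyEq y u)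
    (hnd : ((active R).map keyTuple).Nodup)
    (hcl : ∀ v ∈ D, q.SolSymm (sel (keySet T.pick) T).2 v →
      ∃ y ∈ picks T + active R, KeyEq y v) :
    Explored q k D (expand (keySet T.pick) R T) := by
  have hT' := keyNodup_expand hw hR h.keyNodup hnew hnd
  obtain ⟨hL', hN'⟩ := narrow_expand hD h.linked h.keyNodup h.narrow hw hR hLR hT'
  obtain ⟨rest, hrest, hact⟩ := active_expand (Z := keySet T.pick) (R := R) hw
  have hUm : ∀ x ∈ active T + active R, ∀ y ∈ active T + active R, ¬ q.Sol x y :=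
    fun x hx y hy => hU.not_sol hk (Multiset.mem_toFinset.2 hx) (Multiset.mem_toFinset.2 hy)
  have hnewD : ∀ u ∈ active R, u ∈ D := fun u hu =>
    hU.subset (Multiset.mem_toFinset.2 (Multiset.mem_add.2 (Or.inr hu)))
  have hmix : ∀ x ∈ picks T, ∀ u ∈ active R, ¬ q.SolSymm x u := by
    intro x hx u hu hs
    rw [picks_eq, Multiset.mem_add] at hx
    rcases hx with hx | hx
    · obtain ⟨y, hy, hyu⟩ := h.closed x hx u (hnewD u hu) hs
      exact hnew u hu y hy hyu
    · rcases hs with hs | hs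
      · exact hUm x (Multiset.mem_add.2 (Or.inl hx)) u (Multiset.mem_add.2 (Or.inr hu)) hs
      · exact hUm u (Multiset.mem_add.2 (Or.inr hu)) x (Multiset.mem_add.2 (Or.inl hx)) hs
  refine ⟨hL', hT', hN', hU.mono ?_, ?_, ?_⟩
  · intro x hx
    rw [hact, Multiset.mem_toFinset, Multiset.mem_add] at hx
    rw [hrest, Multiset.mem_toFinset, Multiset.mem_add, Multiset.mem_cons]
    tauto
  · rw [picks_expand hw hR]
    intro x hx y hy hs
    rcases Multiset.mem_add.1 hx with hx | hx <;> rcases Multiset.mem_add.1 hy with hy | hy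
    · exact h.not_sol x hx y hy hs
    · exact hmix x hx y hy (Or.inl hs)
    · exact hmix y hy x hx (Or.inr hs)
    · exact hUm x (Multiset.mem_add.2 (Or.inr hx)) y (Multiset.mem_add.2 (Or.inr hy)) hs
  · rw [processed_expand hw hR, picks_expand hw hR]
    intro x hx v hv hs
    rcases Multiset.mem_cons.1 hx with rfl | hx
    · exact hcl v hv hs
    · obtain ⟨y, hy, hyv⟩ := h.closed x hx v hv hs
      exact ⟨y, Multiset.mem_add.2 (Or.inl hy), hyv⟩

theorem Explored.card_processed_le {T : ExpTree (Term σ α)} (h : Explored q k D T) :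
    Multiset.card (processed T) ≤ D.card := by
  have hnd : (picks T).Nodup := (keyNodup_iff.1 h.keyNodup).of_map _
  have hsub : picks T ⊆ D.val := by
    intro x hx
    rw [← coe_map_nodes, Multiset.mem_coe] at hx
    obtain ⟨n, hn, rfl⟩ := List.mem_map.1 hx
    obtain ⟨hp, L, hL, hl⟩ := h.linked.link
    rw [hL] at hn
    rcases List.mem_cons.1 hn with rfl | hn
    · exact hp
    · exact (hl n hn).1
  have h₁ := Multiset.card_le_card ((Multiset.le_iff_subset hnd).2 hsub)
  rw [picks_eq, Multiset.card_add] at h₁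
  exact (Nat.le_add_right _ _).trans h₁

/-- There are three cases, according to whether the partners of the selected fact `x` lie in no, one
or two new blocks. In each new block a fact is chosen that keeps the set underived. The absence of
tripaths enters only through the width bound, which makes the sets small enough to be extended. -/
theorem Explored.exists_step (hq : q.TwoWayDetermined)
    (hk : k = 2 ^ (2 * σ.kappa + 1) + σ.kappa - 1) (hD : ¬ q.ContainsTripath D)
    {T : ExpTree (Term σ α)} (h : Explored q k D T) (hw : 0 < width T) :
    ∃ T', Explored q k D T' ∧
      Multiset.card (processed T') = Multiset.card (processed T) + 1 := by
  have hl := hq.keyLen_pos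
  have hκ : 1 ≤ σ.kappa := Nat.one_le_pow _ _ hl
  have hk2 : 2 ≤ k := by
    have : 2 ^ 1 ≤ 2 ^ (2 * σ.kappa + 1) := Nat.pow_le_pow_right (by norm_num) (by omega)
    omega
  have hstep : ∀ R, IsExpansion (sel (keySet T.pick) T).1 (sel (keySet T.pick) T).2 R →
      Linked q D R → Underived q k D (active T + active R).toFinset →
      (∀ u ∈ active R, ∀ y ∈ picks T, ¬ KeyEq y u) → ((active R).map keyTuple).Nodup →
      (∀ v ∈ D, q.SolSymm (sel (keySet T.pick) T).2 v → ∃ y ∈ picks T + active R, KeyEq y v) →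
      ∃ T', Explored q k D T' ∧
        Multiset.card (processed T') = Multiset.card (processed T) + 1 := by
    intro R hR hLR hU hnew hnd hcl
    refine ⟨_, h.expand hk2 hD hw hR hLR hU hnew hnd hcl, ?_⟩
    rw [processed_expand hw hR, Multiset.card_cons]
  obtain ⟨rest, hrest, -⟩ := active_expand (Z := keySet T.pick) (R := T) hw
  set b := (sel (keySet T.pick) T).1
  set x := (sel (keySet T.pick) T).2
  have hxa : x ∈ (active T).toFinset := by rw [hrest]; simp
  have hxD : x ∈ D := h.underived.subset hxa
  have hSk : (active T).toFinset.card ≤ k := by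
    refine (Multiset.toFinset_card_le _).trans ?_
    rw [hk]
    exact width_le hl h.linked h.keyNodup h.narrow
      (balanced_of_not_containsTripath hD h.linked h.keyNodup)
  have hpa : ∀ s ∈ (active T).toFinset, s ∈ picks T := fun s hs => by
    rw [picks_eq]; exact Multiset.mem_add.2 (Or.inr (Multiset.mem_toFinset.1 hs))
  -- The chosen `u` differs from the partner `v`, since `v` forms a solution with `x ∈ S` and `u`
  -- does not.
  have hext : ∀ S : Database σ α, Underived q k D S → x ∈ S → S.card ≤ k → ∀ v ∈ D,
      q.SolSymm x v → (∀ s ∈ S, ¬ KeyEq s v) →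
      ∃ u ∈ D, KeyEq v u ∧ v ≠ u ∧ Underived q k D (insert u S) := by
    intro S hS hxS hSk v hv hs hn
    obtain ⟨u, hu, huS⟩ := hS.exists_insert hSk hv hn
    obtain ⟨huD, huv⟩ := mem_blockOf.1 hu
    refine ⟨u, huD, huv.symm, ?_, huS⟩
    rintro rfl
    rcases hs with hs | hs
    · exact huS.not_sol hk2 (Finset.mem_insert_of_mem hxS) (Finset.mem_insert_self _ _) hs
    · exact huS.not_sol hk2 (Finset.mem_insert_self _ _) (Finset.mem_insert_of_mem hxS) hs
  by_cases hN : ∃ v ∈ D, q.SolSymm x v ∧ ∀ y ∈ picks T, ¬ KeyEq y v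
  swap
  · push Not at hN
    refine hstep (.nil b x) .nil hxD ?_ ?_ ?_ ?_
    · simpa [active, collect] using h.underived
    · simp [active, collect]
    · simp [active, collect]
    · intro v hv hs
      obtain ⟨y, hy, hyv⟩ := hN v hv hs
      exact ⟨y, Multiset.mem_add.2 (Or.inl hy), hyv⟩
  by_cases hN2 : ∃ d ∈ D, ∃ f ∈ D, q.Sol d x ∧ q.Sol x f ∧ ¬ KeyEq d f ∧
      (∀ y ∈ picks T, ¬ KeyEq y d) ∧ ∀ y ∈ picks T, ¬ KeyEq y f
  · obtain ⟨d, hdD, f, hfD, hdx, hxf, hdf, hd, hf⟩ := hN2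
    obtain ⟨u, huD, hdu, hdu', hU₁⟩ := hext _ h.underived hxa hSk d hdD (Or.inr hdx)
      fun s hs => hd s (hpa s hs)
    -- This `w` is provisional and need not be compatible with `u`. It only completes a linked tree
    -- to which the width bound applies.
    obtain ⟨w, hwD, hfw, hfw', -⟩ := hext _ h.underived hxa hSk f hfD (Or.inl hxf)
      fun s hs => hf s (hpa s hs)
    have hLR : ∀ w ∈ D, KeyEq f w → f ≠ w → Linked q D (.two b x (.leaf d u) (.leaf f w)) :=
      fun w hwD hfw hfw' => ⟨hxD, ⟨hdx, hxf⟩, ⟨hdD, hdu, hdu'⟩, ⟨hfD, hfw, hfw'⟩, huD, hwD⟩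
    have hnew : ∀ w, KeyEq f w → ∀ t ∈ active (.two b x (.leaf d u) (.leaf f w)),
        ∀ y ∈ picks T, ¬ KeyEq y t := by
      intro w hfw t ht y hy hyt
      have : t = u ∨ t = w := by simpa [active, collect] using ht
      rcases this with rfl | rfl
      · exact hd y hy (hyt.trans hdu.symm)
      · exact hf y hy (hyt.trans hfw.symm)
    have hnd : ∀ w, KeyEq f w →
        ((active (.two b x (.leaf d u) (.leaf f w))).map keyTuple).Nodup := by
      intro w hfw
      have : keyTuple u ≠ keyTuple w := fun h' => hdf (hdu.trans (KeyEq.trans h' hfw.symm))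
      simpa [active, collect] using this
    -- The second choice is made while `x` is still kept. The set then has at most `width T + 1`
    -- facts, which is the width of the tree with `x` replaced by two leaves, hence at most `k`.
    have hSk1 : (insert u (active T).toFinset).card ≤ k := by
      have hT' := keyNodup_expand hw (.two d u f w) h.keyNodup (hnew w hfw) (hnd w hfw)
      obtain ⟨hL', hN'⟩ := narrow_expand hD h.linked h.keyNodup h.narrow hw (.two d u f w)
        (hLR w hwD hfw hfw') hT'
      have hw' := width_le hl hL' hT' hN' (balanced_of_not_containsTripath hD hL' hT')
      obtain ⟨rest', hr₁, hr₂⟩ := active_expand (Z := keySet T.pick)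
        (R := .two b x (.leaf d u) (.leaf f w)) hw
      rw [width, hr₂, Multiset.card_add] at hw'
      have h₁ := congrArg Multiset.card hr₁
      rw [Multiset.card_cons] at h₁
      have h₂ : Multiset.card (active (.two b x (.leaf d u) (.leaf f w))) = 2 := rfl
      have h₃ := Multiset.toFinset_card_le (active T)
      have h₄ := Finset.card_insert_le u (active T).toFinset
      omega
    obtain ⟨w', hwD', hfw₁, hfw₂, hU₂⟩ := hext _ hU₁ (Finset.mem_insert_of_mem hxa) hSk1 f hfD
      (Or.inl hxf) fun s hs => by
        rcases Finset.mem_insert.1 hs with rfl | hs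
        · exact fun hsf => hdf (hdu.trans hsf)
        · exact hf s (hpa s hs)
    refine hstep _ (.two d u f w') (hLR w' hwD' hfw₁ hfw₂) (hU₂.mono ?_) (hnew w' hfw₁)
      (hnd w' hfw₁) ?_
    · intro t ht
      have : t = u ∨ t = w' ∨ t ∈ active T := by simpa [active, collect] using ht
      simp only [Finset.mem_insert, Multiset.mem_toFinset]
      tauto
    · intro v hv hs
      rcases hs with hs | hs
      · exact ⟨w', by simp [active, collect], hfw₁.symm.trans (hq.keyEq_right hxf hs)⟩
      · exact ⟨u, by simp [active, collect], hdu.symm.trans (hq.keyEq_left hdx hs)⟩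
  · obtain ⟨v, hvD, hxv, hv⟩ := hN
    -- Two new partners in different blocks would lie on opposite sides of `x`, which is the case
    -- treated before.
    have hall : ∀ v' ∈ D, q.SolSymm x v' → (∀ y ∈ picks T, ¬ KeyEq y v') → KeyEq v v' := by
      intro v' hv'D hxv' hv'
      by_contra hne
      push Not at hN2
      rcases hxv with h₁ | h₁ <;> rcases hxv' with h₂ | h₂
      · exact hne (hq.keyEq_right h₁ h₂)
      · obtain ⟨y, hy, hyf⟩ := hN2 v' hv'D v hvD h₂ h₁ (fun h => hne h.symm) hv'
        exact hv y hy hyf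
      · obtain ⟨y, hy, hyf⟩ := hN2 v hvD v' hv'D h₁ h₂ hne hv
        exact hv' y hy hyf
      · exact hne (hq.keyEq_left h₁ h₂)
    obtain ⟨u, huD, hvu, hvu', hU⟩ := hext _ h.underived hxa hSk v hvD hxv
      fun s hs => hv s (hpa s hs)
    refine hstep (.one b x (.leaf v u)) (.one v u) ⟨hxD, hxv, ⟨hvD, hvu, hvu'⟩, huD⟩ (hU.mono ?_)
      ?_ (by simp [active, collect]) ?_
    · intro t ht
      have : t = u ∨ t ∈ active T := by simpa [active, collect] using ht
      simp only [Finset.mem_insert, Multiset.mem_toFinset]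
      tauto
    · intro t ht y hy hyt
      have : t = u := by simpa [active, collect] using ht
      subst this
      exact hv y hy (hyt.trans hvu.symm)
    · intro v' hv'D hxv'
      by_cases hc : ∀ y ∈ picks T, ¬ KeyEq y v'
      · exact ⟨u, by simp [active, collect], hvu.symm.trans (hall v' hv'D hxv' hc)⟩
      · push Not at hc
        obtain ⟨y, hy, hyv⟩ := hc
        exact ⟨y, Multiset.mem_add.2 (Or.inl hy), hyv⟩

/-- Every step processes one more leaf, and the processed facts are distinct facts of `D`, so the
exploration ends. -/
theorem exists_explored (hq : q.TwoWayDetermined)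
    (hk : k = 2 ^ (2 * σ.kappa + 1) + σ.kappa - 1) (hD : ¬ q.ContainsTripath D)
    (hne : D.Nonempty) (hC : ¬ q.Cert k D) : ∃ T, Explored q k D T ∧ width T = 0 := by
  have hk2 : 2 ≤ k := by
    have hκ : 1 ≤ σ.kappa := Nat.one_le_pow _ _ hq.keyLen_pos
    have : 2 ^ 1 ≤ 2 ^ (2 * σ.kappa + 1) := Nat.pow_le_pow_right (by norm_num) (by omega)
    omega
  have hex : ∀ n, ∃ T, Explored q k D T ∧
      (width T = 0 ∨ n ≤ Multiset.card (processed T)) := by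
    intro n
    induction n with
    | zero =>
      obtain ⟨b, hb⟩ := hne
      obtain ⟨u, -, hu⟩ := (Underived.empty hC).exists_insert (by simp) hb (by simp)
      -- The root block is not entered through a solution, so its entry fact is a dummy.
      refine ⟨.leaf u u, ⟨?_, ?_, trivial, ?_, ?_, ?_⟩, Or.inr (Nat.zero_le _)⟩
      · exact hu.subset (by simp)
      · simp [KeyNodup, nodes]
      · simpa [active, collect] using hu
      · intro x hx y hy
        have hx : x = u := by simpa [picks, collect] using hx
        have hy : y = u := by simpa [picks, collect] using hy
        exact hu.not_sol hk2 (by simp [hx]) (by simp [hy])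
      · simp [processed, collect]
    | succ n ih =>
      obtain ⟨T, hT, h | h⟩ := ih
      · exact ⟨T, hT, Or.inl h⟩
      · rcases Nat.eq_zero_or_pos (width T) with h0 | h0
        · exact ⟨T, hT, Or.inl h0⟩
        · obtain ⟨T', hT', hc⟩ := hT.exists_step hq hk hD h0
          exact ⟨T', hT', Or.inr (by omega)⟩
  obtain ⟨T, hT, h | h⟩ := hex (D.card + 1)
  · exact ⟨T, hT, h⟩
  · have := hT.card_processed_le
    omega

end ExpTree

/-- All picks of a finished exploration are processed, so no picked fact has a solution partner
outside the explored blocks. Their union with a repair of the remaining blocks that falsifies `q`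
creates no new solution. Both hypotheses pass to the remaining blocks, of which there are fewer. -/
theorem Query.exists_isRepair_not_sat [DecidableEq α] {q : Query σ V} (hq : q.TwoWayDetermined)
    {k : ℕ} (hk : k = 2 ^ (2 * σ.kappa + 1) + σ.kappa - 1) (D : Database σ α)
    (hD : ¬ q.ContainsTripath D) (hC : ¬ q.Cert k D) : ∃ r, IsRepair D r ∧ ¬ q.Sat r := by
  induction D using Finset.strongInduction with
  | H D ih =>
    rcases D.eq_empty_or_nonempty with rfl | hne
    · refine ⟨∅, isRepair_of_forall_exists_keyEq subset_rfl ?_ (by simp), ?_⟩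
      · exact fun a ha => absurd ha (Finset.notMem_empty a)
      · rintro ⟨a, ha, -⟩
        exact absurd ha (Finset.notMem_empty a)
    obtain ⟨T, hT, hw⟩ := ExpTree.exists_explored hq hk hD hne hC
    have hproc : ∀ x ∈ T.picks, x ∈ T.processed := by
      intro x hx
      rw [ExpTree.picks_eq, Multiset.card_eq_zero.1 hw, add_zero] at hx
      exact hx
    obtain ⟨hp, L, hL, hl⟩ := hT.linked.link
    have hpD : ∀ x ∈ T.picks, x ∈ D := by
      intro x hx
      rw [← ExpTree.coe_map_nodes, Multiset.mem_coe] at hx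
      obtain ⟨n, hn, rfl⟩ := List.mem_map.1 hx
      rw [hL] at hn
      rcases List.mem_cons.1 hn with rfl | hn
      · exact hp
      · exact (hl n hn).1
    have hroot : T.pick ∈ T.picks := by
      rw [← ExpTree.coe_map_nodes, Multiset.mem_coe]
      exact List.mem_map.2 ⟨_, T.root_mem_nodes, rfl⟩
    set E := D.filter fun v => ∀ y ∈ T.picks, ¬ KeyEq y v with hE
    have hED : E ⊆ D := Finset.filter_subset _ _
    have hEss : E ⊂ D := by
      refine (Finset.ssubset_iff_of_subset hED).2 ⟨T.pick, hp, fun h => ?_⟩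
      exact (Finset.mem_filter.1 h).2 _ hroot (KeyEq.refl _)
    obtain ⟨r, hr, hrs⟩ := ih E hEss
      (fun ⟨Θ, hΘ, h⟩ => hD ⟨Θ, hΘ.trans hED, h⟩)
      (fun h => hC (Query.Delta.mono_database hED (fun b hb v hv => by
        rw [mem_blockOf] at hv
        rw [hE, Finset.mem_filter] at hb ⊢
        exact ⟨hv.1, fun y hy hyv => hb.2 y hy (hyv.trans hv.2)⟩) h))
    have hrE : ∀ v ∈ r, v ∈ D ∧ ∀ y ∈ T.picks, ¬ KeyEq y v := fun v hv =>
      Finset.mem_filter.1 (hr.prop.1 hv)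
    have hmem : ∀ v, v ∈ T.picks.toFinset ∪ r ↔ v ∈ T.picks ∨ v ∈ r := by
      intro v; rw [Finset.mem_union, Multiset.mem_toFinset]
    have hinj : ∀ x ∈ T.picks, ∀ y ∈ T.picks, KeyEq x y → x = y := by
      intro x hx y hy hxy
      exact Multiset.inj_on_of_nodup_map (ExpTree.keyNodup_iff.1 hT.keyNodup) x hx y hy hxy
    have hmix : ∀ x ∈ T.picks, ∀ v ∈ r, ¬ q.SolSymm x v := by
      intro x hx v hv hs
      obtain ⟨y, hy, hyv⟩ := hT.closed x (hproc x hx) v (hrE v hv).1 hs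
      exact (hrE v hv).2 y hy hyv
    refine ⟨T.picks.toFinset ∪ r, isRepair_of_forall_exists_keyEq ?_ ?_ ?_, ?_⟩
    · intro v hv
      rcases (hmem v).1 hv with hv | hv
      · exact hpD v hv
      · exact (hrE v hv).1
    · intro x hx y hy hxy
      rcases (hmem x).1 hx with hx | hx <;> rcases (hmem y).1 hy with hy | hy
      · exact hinj x hx y hy hxy
      · exact absurd hxy ((hrE y hy).2 x hx)
      · exact absurd hxy.symm ((hrE x hx).2 y hy)
      · exact hr.prop.2 x hx y hy hxy
    · intro v hv
      by_cases hc : ∀ y ∈ T.picks, ¬ KeyEq y v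
      · obtain ⟨u, hu, huv⟩ := hr.exists_keyEq (Finset.mem_filter.2 ⟨hv, hc⟩)
        exact ⟨u, (hmem u).2 (Or.inr hu), huv⟩
      · push Not at hc
        obtain ⟨y, hy, hyv⟩ := hc
        exact ⟨y, (hmem y).2 (Or.inl hy), hyv⟩
    · rintro ⟨x, hx, y, hy, hs⟩
      rcases (hmem x).1 hx with hx | hx <;> rcases (hmem y).1 hy with hy | hy
      · exact hT.not_sol x hx y hy hs
      · exact hmix x hx y hy (Or.inl hs)
      · exact hmix y hy x hx (Or.inr hs)
      · exact hrs ⟨x, hx, y, hy, hs⟩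

theorem Query.certain_iff_cert [DecidableEq α] {q : Query σ V} (hq : q.TwoWayDetermined)
    (D : Database σ α) (hD : ¬ q.ContainsTripath D) :
    q.Certain D ↔ q.Cert (2 ^ (2 * σ.kappa + 1) + σ.kappa - 1) D := by
  refine ⟨fun h => ?_, Query.Cert.certain⟩
  by_contra hC
  obtain ⟨r, hr, hrs⟩ := q.exists_isRepair_not_sat hq rfl D hD hC
  exact hrs (h r hr)

/-! ### A loop language over words and its compilation to multi-stack machines -/

open Computability Turing

/-- Programs over registers that hold words, with a finite control. A loop runs through the letters
that its register holds when the loop is entered. -/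
inductive Prog (S K : Type)
  | upd (f : S → S)
  | push (k : K) (f : S → Γ')
  | pop (k : K) (f : S → Option Γ' → S)
  | seq (p p' : Prog S K)
  | ite (c : S → Bool) (p p' : Prog S K)
  | loop (k : K) (f : S → Γ' → S) (p : Prog S K)

namespace Prog
variable {S K : Type}

/-- The sum of the costs `c` along the iteration of `step` over a list. -/
def foldCost {A B : Type*} (step : A → B → A) (c : A → B → ℕ) : List B → A → ℕ
  | [], _ => 0
  | x :: l, a => c a x + foldCost step c l (step a x)

variable [DecidableEq K]

/-- The semantics of programs. -/
def run : Prog S K → S × (K → List Γ') → S × (K → List Γ')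
  | upd f, st => (f st.1, st.2)
  | push k f, st => (st.1, Function.update st.2 k (f st.1 :: st.2 k))
  | pop k f, st => (f st.1 (st.2 k).head?, Function.update st.2 k (st.2 k).tail)
  | seq p p', st => run p' (run p st)
  | ite c p p', st => if c st.1 then run p st else run p' st
  | loop k f p, st => (st.2 k).foldl (fun st x => run p (f st.1 x, st.2)) st

/-- The number of machine steps that the execution of a program takes. -/
def cost : Prog S K → S × (K → List Γ') → ℕ
  | upd _, _ => 1
  | push _ _, _ => 1
  | pop _ _, _ => 1
  | seq p p', st => cost p st + cost p' (run p st)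
  | ite c p p', st => 1 + if c st.1 then cost p st else cost p' st
  | loop k f p, st => 2 * (st.2 k).length + 3 +
      foldCost (fun st x => run p (f st.1 x, st.2)) (fun st x => 1 + cost p (f st.1 x, st.2))
        (st.2 k) st

/-- The positions of a program, which are the labels of its machine. -/
inductive Pos {S K : Type} : Prog S K → Type
  | upd (f) : Pos (.upd f)
  | push (k f) : Pos (.push k f)
  | pop (k f) : Pos (.pop k f)
  | fst {p} (p') (x : Pos p) : Pos (.seq p p')
  | snd (p) {p'} (x : Pos p') : Pos (.seq p p')
  | test (c p p') : Pos (.ite c p p')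
  | thn (c) {p} (p') (x : Pos p) : Pos (.ite c p p')
  | els (c p) {p'} (x : Pos p') : Pos (.ite c p p')
  | save (k f p) : Pos (.loop k f p)
  | copy (k f p) : Pos (.loop k f p)
  | next (k f p) : Pos (.loop k f p)
  | body (k f) {p} (x : Pos p) : Pos (.loop k f p)

omit [DecidableEq K] in
theorem finite_pos (p : Prog S K) : Finite (Pos p) := by
  induction p with
  | upd f => exact Finite.of_surjective (fun _ : Unit => Pos.upd f) fun x => by cases x; simp
  | push k f => exact Finite.of_surjective (fun _ : Unit => Pos.push k f) fun x => by cases x; simp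
  | pop k f => exact Finite.of_surjective (fun _ : Unit => Pos.pop k f) fun x => by cases x; simp
  | seq p p' ih ih' =>
    refine Finite.of_surjective (Sum.elim (Pos.fst p') (Pos.snd p)) fun x => ?_
    cases x <;> simp
  | ite c p p' ih ih' =>
    refine Finite.of_surjective (fun o : Option (Pos p ⊕ Pos p') =>
      o.elim (Pos.test c p p') (Sum.elim (Pos.thn c p') (Pos.els c p))) fun x => ?_
    cases x with
    | test => exact ⟨none, rfl⟩
    | thn _ _ x => exact ⟨some (Sum.inl x), rfl⟩
    | els _ _ x => exact ⟨some (Sum.inr x), rfl⟩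
  | loop k f p ih =>
    refine Finite.of_surjective (fun o : Option (Option (Option (Pos p))) =>
      o.elim (Pos.save k f p) fun o => o.elim (Pos.copy k f p) fun o =>
        o.elim (Pos.next k f p) (Pos.body k f)) fun x => ?_
    cases x with
    | save => exact ⟨none, rfl⟩
    | copy => exact ⟨some none, rfl⟩
    | next => exact ⟨some (some none), rfl⟩
    | body _ _ x => exact ⟨some (some (some x)), rfl⟩

/-- The first position of a program. -/
def entry : (p : Prog S K) → Pos p
  | upd f => .upd f
  | push k f => .push k f
  | pop k f => .pop k f
  | seq p p' => .fst p' (entry p)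
  | ite c p p' => .test c p p'
  | loop k f p => .save k f p

section Machine
variable {Λ : Type}

/-- The stack alphabets: the output stack `none` holds Booleans. There is one stack for each
register, and one auxiliary stack for each label. -/
@[reducible] def Alphabet (K Λ : Type) : Option (K ⊕ Λ) → Type
  | none => Bool
  | some _ => Γ'

/-- The stacks of a configuration with an empty output stack. -/
def stk (r : K → List Γ') (aux : Λ → List Γ') : ∀ k, List (Alphabet K Λ k)
  | none => ([] : List Bool)
  | some (Sum.inl k) => r k
  | some (Sum.inr l) => aux l

/-- The register `k` as a stack. -/
abbrev regStack (k : K) : Option (K ⊕ Λ) := some (Sum.inl k)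

/-- The auxiliary stack of the label `l`. -/
abbrev auxStack (l : Λ) : Option (K ⊕ Λ) := some (Sum.inr l)

open TM2.Stmt in
/-- The machine code of a program whose positions are embedded into the labels by `e`, and which
continues at the label `exit`. -/
def code : {p : Prog S K} → Pos p → (Pos p → Λ) → Λ → TM2.Stmt (Alphabet K Λ) Λ (S × Option Γ')
  | _, .upd f, _, exit => load (fun s => (f s.1, s.2)) (goto fun _ => exit)
  | _, .push k f, _, exit => TM2.Stmt.push (regStack k) (fun s => f s.1) (goto fun _ => exit)
  | _, .pop k f, _, exit =>
      TM2.Stmt.pop (regStack k) (fun s o => (f s.1 o, s.2)) (goto fun _ => exit)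
  | _, .fst p' x, e, _ => code x (fun y => e (.fst p' y)) (e (.snd _ (entry p')))
  | _, .snd p x, e, exit => code x (fun y => e (.snd p y)) exit
  | _, .test c p p', e, _ => branch (fun s => c s.1) (goto fun _ => e (.thn c p' (entry p)))
      (goto fun _ => e (.els c p (entry p')))
  | _, .thn c p' x, e, exit => code x (fun y => e (.thn c p' y)) exit
  | _, .els c p x, e, exit => code x (fun y => e (.els c p y)) exit
  | _, .save k f p, e, _ => TM2.Stmt.pop (regStack k) (fun s o => (s.1, o))
      (branch (fun s => s.2.isSome)
        (TM2.Stmt.push (auxStack (e (.save k f p))) (fun s => s.2.getD Γ'.blank)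
          (load (fun s => (s.1, none)) (goto fun _ => e (.save k f p))))
        (goto fun _ => e (.copy k f p)))
  | _, .copy k f p, e, _ => TM2.Stmt.pop (auxStack (e (.save k f p))) (fun s o => (s.1, o))
      (branch (fun s => s.2.isSome)
        (TM2.Stmt.push (regStack k) (fun s => s.2.getD Γ'.blank)
          (TM2.Stmt.push (auxStack (e (.copy k f p))) (fun s => s.2.getD Γ'.blank)
            (load (fun s => (s.1, none)) (goto fun _ => e (.copy k f p)))))
        (goto fun _ => e (.next k f p)))
  | _, .next k f p, e, exit => TM2.Stmt.pop (auxStack (e (.copy k f p))) (fun s o => (s.1, o))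
      (branch (fun s => s.2.isSome)
        (load (fun s => (f s.1 (s.2.getD Γ'.blank), none))
          (goto fun _ => e (.body k f (entry p))))
        (goto fun _ => exit))
  | _, .body k f x, e, _ => code x (fun y => e (.body k f y)) (e (.next k f _))

variable [DecidableEq Λ]

omit [DecidableEq Λ] in
theorem update_regStack [DecidableEq (Option (K ⊕ Λ))] (r : K → List Γ') (aux : Λ → List Γ')
    (k : K) (w : List Γ') :
    Function.update (stk r aux) (regStack k) w = stk (Function.update r k w) aux := by
  funext j
  by_cases hj : j = regStack k
  · subst hj
    rw [Function.update_self]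
    exact (Function.update_self k w r).symm
  · rw [Function.update_of_ne hj]
    rcases j with _ | j | j
    · rfl
    · exact (Function.update_of_ne (β := fun _ => List Γ') (a := j) (a' := k)
        (fun h => hj (by rw [h])) w r).symm
    · rfl

omit [DecidableEq K] in
theorem update_auxStack [DecidableEq (Option (K ⊕ Λ))] (r : K → List Γ') (aux : Λ → List Γ')
    (l : Λ) (w : List Γ') :
    Function.update (stk r aux) (auxStack l) w = stk r (Function.update aux l w) := by
  funext j
  by_cases hj : j = auxStack l
  · subst hj
    rw [Function.update_self]
    exact (Function.update_self l w aux).symm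
  · rw [Function.update_of_ne hj]
    rcases j with _ | j | j
    · rfl
    · rfl
    · exact (Function.update_of_ne (β := fun _ => List Γ') (a := j) (a' := l)
        (fun h => hj (by rw [h])) w aux).symm

section StepAux
variable {τ : Type} (v : τ) (r : K → List Γ') (aux : Λ → List Γ')
  (q : TM2.Stmt (Alphabet K Λ) Λ τ)

theorem stepAux_pop_regStack (k : K) (g : τ → Option Γ' → τ) :
    TM2.stepAux (TM2.Stmt.pop (regStack k) g q) v (stk r aux) =
      TM2.stepAux q (g v (r k).head?) (stk (Function.update r k (r k).tail) aux) := by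
  rw [← update_regStack]
  rfl

theorem stepAux_pop_auxStack (l : Λ) (g : τ → Option Γ' → τ) :
    TM2.stepAux (TM2.Stmt.pop (auxStack l) g q) v (stk r aux) =
      TM2.stepAux q (g v (aux l).head?) (stk r (Function.update aux l (aux l).tail)) := by
  rw [← update_auxStack]
  rfl

theorem stepAux_push_regStack (k : K) (g : τ → Γ') :
    TM2.stepAux (TM2.Stmt.push (regStack k) g q) v (stk r aux) =
      TM2.stepAux q v (stk (Function.update r k (g v :: r k)) aux) := by
  rw [← update_regStack]
  rfl

theorem stepAux_push_auxStack (l : Λ) (g : τ → Γ') :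
    TM2.stepAux (TM2.Stmt.push (auxStack l) g q) v (stk r aux) =
      TM2.stepAux q v (stk r (Function.update aux l (g v :: aux l))) := by
  rw [← update_auxStack]
  rfl

end StepAux

/-- The machine `M` gets from `c` to `c'` in `n` steps. -/
def Steps (M : Λ → TM2.Stmt (Alphabet K Λ) Λ (S × Option Γ')) (n : ℕ)
    (c c' : TM2.Cfg (Alphabet K Λ) Λ (S × Option Γ')) : Prop :=
  (flip bind (TM2.step M))^[n] (some c) = some c'

/-- The configuration at the label `l` between the statements of a program. -/
def conf (l : Λ) (st : S × (K → List Γ')) (aux : Λ → List Γ') :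
    TM2.Cfg (Alphabet K Λ) Λ (S × Option Γ') := ⟨some l, (st.1, none), stk st.2 aux⟩

variable {M : Λ → TM2.Stmt (Alphabet K Λ) Λ (S × Option Γ')}

theorem Steps.trans {m n : ℕ} {c₁ c₂ c₃ : TM2.Cfg (Alphabet K Λ) Λ (S × Option Γ')}
    (h₁ : Steps M m c₁ c₂) (h₂ : Steps M n c₂ c₃) : Steps M (m + n) c₁ c₃ := by
  rw [Steps, add_comm, Function.iterate_add_apply, h₁]
  exact h₂

theorem Steps.one {c c' : TM2.Cfg (Alphabet K Λ) Λ (S × Option Γ')}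
    (h : TM2.step M c = some c') : Steps M 1 c c' := h

theorem steps_conf {l : Λ} {st : S × (K → List Γ')} {aux : Λ → List Γ'}
    {c : TM2.Cfg (Alphabet K Λ) Λ (S × Option Γ')}
    (h : TM2.stepAux (M l) (st.1, none) (stk st.2 aux) = c) : Steps M 1 (conf l st aux) c :=
  Steps.one (congrArg some h)

section Loop
variable {k : K} {f : S → Γ' → S} {p : Prog S K} {e : Pos (loop k f p) → Λ} {exit : Λ}

/-- First phase of a loop: the register is emptied onto an auxiliary stack, which reverses the word.
-/
theorem steps_loop_save (hM : ∀ x, M (e x) = code x e exit) (w : List Γ') (s : S)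
    (r : K → List Γ') (aux : Λ → List Γ') :
    Steps M (w.length + 1) (conf (e (.save k f p)) (s, Function.update r k w) aux)
      (conf (e (.copy k f p)) (s, Function.update r k [])
        (Function.update aux (e (.save k f p)) (w.reverse ++ aux (e (.save k f p))))) := by
  induction w generalizing aux with
  | nil =>
    refine steps_conf ?_
    rw [hM]
    simp only [code, TM2.stepAux.eq_4, TM2.stepAux.eq_5, TM2.stepAux.eq_6, stepAux_pop_regStack,
      stepAux_push_auxStack]
    simp [conf]
  | cons x w ih =>
    rw [List.length_cons, add_comm _ 1]
    refine Steps.trans (steps_conf (c := conf (e (.save k f p)) (s, Function.update r k w)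
      (Function.update aux (e (.save k f p)) (x :: aux (e (.save k f p))))) ?_) ?_
    · rw [hM]
      simp only [code, TM2.stepAux.eq_4, TM2.stepAux.eq_5, TM2.stepAux.eq_6, stepAux_pop_regStack,
        stepAux_push_auxStack]
      simp [conf]
    · have := ih (Function.update aux (e (.save k f p)) (x :: aux (e (.save k f p))))
      simpa using this

/-- Second phase: the saved word goes back to the register and also onto a second auxiliary stack,
which restores the order. The iteration is driven by that stack, so the body may change the
register. -/
theorem steps_loop_copy (hM : ∀ x, M (e x) = code x e exit)
    (he : Function.Injective e) (v w u : List Γ') (s : S)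
    (r : K → List Γ') (aux : Λ → List Γ') :
    Steps M (v.length + 1) (conf (e (.copy k f p)) (s, Function.update r k w)
        (Function.update (Function.update aux (e (.copy k f p)) u) (e (.save k f p)) v))
      (conf (e (.next k f p)) (s, Function.update r k (v.reverse ++ w))
        (Function.update (Function.update aux (e (.copy k f p)) (v.reverse ++ u))
          (e (.save k f p)) [])) := by
  have hne : e (.copy k f p) ≠ e (.save k f p) := fun h => by
    have := he h
    simp at this
  induction v generalizing u w with
  | nil =>
    refine steps_conf ?_
    rw [hM]
    simp only [code, TM2.stepAux.eq_4, TM2.stepAux.eq_5, TM2.stepAux.eq_6, stepAux_pop_auxStack,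
      stepAux_push_regStack, stepAux_push_auxStack]
    simp [conf]
  | cons x v ih =>
    rw [List.length_cons, add_comm _ 1]
    refine Steps.trans (steps_conf (c := conf (e (.copy k f p)) (s, Function.update r k (x :: w))
      (Function.update (Function.update aux (e (.copy k f p)) (x :: u)) (e (.save k f p)) v)) ?_) ?_
    · rw [hM]
      simp only [code, TM2.stepAux.eq_4, TM2.stepAux.eq_5, TM2.stepAux.eq_6, stepAux_pop_auxStack,
        stepAux_push_regStack, stepAux_push_auxStack]
      simp [conf, Function.update_of_ne hne, Function.update_comm hne]
    · simpa using ih (x :: w) (x :: u)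

/-- Third phase: the remaining letters lie on an auxiliary stack that belongs to this loop alone.
The stacks of the body are empty whenever it starts, so nested loops do not interfere. -/
theorem steps_loop_body (hM : ∀ x, M (e x) = code x e exit)
    (he : Function.Injective e) (aux : Λ → List Γ') (haux : ∀ x, aux (e x) = [])
    (hp : ∀ (st : S × (K → List Γ')) (aux : Λ → List Γ'), (∀ x, aux (e (.body k f x)) = []) →
      Steps M (cost p st) (conf (e (.body k f (entry p))) st aux)
        (conf (e (.next k f p)) (run p st) aux)) (w : List Γ') (st : S × (K → List Γ')) :
    Steps M (foldCost (fun st x => run p (f st.1 x, st.2))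
        (fun st x => 1 + cost p (f st.1 x, st.2)) w st + 1)
      (conf (e (.next k f p)) st (Function.update aux (e (.copy k f p)) w))
      (conf exit (w.foldl (fun st x => run p (f st.1 x, st.2)) st) aux) := by
  induction w generalizing st with
  | nil =>
    refine steps_conf ?_
    rw [hM]
    have : Function.update aux (e (.copy k f p)) [] = aux :=
      Function.update_eq_self_iff.2 (haux _).symm
    simp only [code, TM2.stepAux.eq_4, TM2.stepAux.eq_5, TM2.stepAux.eq_6, stepAux_pop_auxStack]
    simp [conf, this]
  | cons x w ih =>
    rw [foldCost, add_assoc, add_assoc]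
    refine Steps.trans (steps_conf (c := conf (e (.body k f (entry p))) (f st.1 x, st.2)
      (Function.update aux (e (.copy k f p)) w)) ?_) (Steps.trans (hp _ _ ?_) (ih _))
    · rw [hM]
      simp only [code, TM2.stepAux.eq_4, TM2.stepAux.eq_5, TM2.stepAux.eq_6, stepAux_pop_auxStack]
      simp [conf]
    · intro y
      rw [Function.update_of_ne, haux]
      intro h
      have := he h
      simp at this

end Loop

/-- The embedding `e` of positions into labels lets subprograms run inside the machine of the whole
program. The invariant is that all auxiliary stacks of a program are empty when it starts, and they
are unchanged when it ends. -/
theorem steps_run (p : Prog S K) (e : Pos p → Λ) (exit : Λ) (hM : ∀ x, M (e x) = code x e exit)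
    (he : Function.Injective e) (st : S × (K → List Γ')) (aux : Λ → List Γ')
    (haux : ∀ x, aux (e x) = []) :
    Steps M (cost p st) (conf (e (entry p)) st aux) (conf exit (run p st) aux) := by
  induction p generalizing exit st aux with
  | upd f =>
    refine steps_conf ?_
    rw [hM]
    simp only [code, entry, TM2.stepAux.eq_4, TM2.stepAux.eq_6]
    simp [conf, run]
  | push k f =>
    refine steps_conf ?_
    rw [hM]
    simp only [code, entry, TM2.stepAux.eq_6, stepAux_push_regStack]
    simp [conf, run]
  | pop k f =>
    refine steps_conf ?_
    rw [hM]
    simp only [code, entry, TM2.stepAux.eq_6, stepAux_pop_regStack]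
    simp [conf, run]
  | seq p p' ih ih' =>
    exact (ih (fun y => e (.fst p' y)) _ (fun x => hM (.fst p' x))
      (fun x y h => by simpa using he h) st aux (fun x => haux _)).trans
      (ih' (fun y => e (.snd p y)) _ (fun x => hM (.snd p x))
      (fun x y h => by simpa using he h) _ aux (fun x => haux _))
  | ite c p p' ih ih' =>
    by_cases hc : c st.1
    · rw [cost, run, if_pos hc, if_pos hc]
      refine Steps.trans (steps_conf (c := conf (e (.thn c p' (entry p))) st aux) ?_)
        (ih (fun y => e (.thn c p' y)) _ (fun x => hM (.thn c p' x))
          (fun x y h => by simpa using he h) st aux (fun x => haux _))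
      rw [hM]
      simp only [code, entry, TM2.stepAux.eq_5, TM2.stepAux.eq_6]
      simp [conf, hc]
    · rw [cost, run, if_neg hc, if_neg hc]
      refine Steps.trans (steps_conf (c := conf (e (.els c p (entry p'))) st aux) ?_)
        (ih' (fun y => e (.els c p y)) _ (fun x => hM (.els c p x))
          (fun x y h => by simpa using he h) st aux (fun x => haux _))
      rw [hM]
      simp only [code, entry, TM2.stepAux.eq_5, TM2.stepAux.eq_6]
      simp [conf, hc]
  | loop k f p ih =>
    have h₁ := steps_loop_save hM (st.2 k) st.1 st.2 aux
    have h₂ := steps_loop_copy hM he (st.2 k).reverse [] [] st.1 st.2 aux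
    have h₃ := steps_loop_body hM he aux haux (fun st aux haux =>
      ih (fun y => e (.body k f y)) _ (fun x => hM (.body k f x))
        (fun x y h => by simpa using he h) st aux haux) (st.2 k) st
    have e₀ : Function.update aux (e (.copy k f p)) [] = aux :=
      Function.update_eq_self_iff.2 (haux _).symm
    have hne : e (.save k f p) ≠ e (.copy k f p) := fun h => by
      have := he h
      simp at this
    have e₁ : Function.update (Function.update aux (e (.copy k f p)) (st.2 k)) (e (.save k f p)) [] =
        Function.update aux (e (.copy k f p)) (st.2 k) := by
      refine Function.update_eq_self_iff.2 ?_
      rw [Function.update_of_ne hne, haux]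
    rw [haux, List.append_nil, Function.update_eq_self] at h₁
    rw [e₀, List.reverse_reverse, List.append_nil, e₁, Function.update_eq_self,
      List.length_reverse] at h₂
    have := (h₁.trans h₂).trans h₃
    rw [cost]
    -- Saving and copying take one step per letter and one to notice the end; the last step leaves
    -- the loop.
    have e₂ : ∀ c : ℕ, 2 * (st.2 k).length + 3 + c =
        (st.2 k).length + 1 + ((st.2 k).length + 1) + (c + 1) := fun c => by omega
    rw [e₂]
    exact this

end Machine

/-- A decision problem is in PTIME if a program of polynomial cost decides it. -/
theorem inPTIME_of_run [Finite S] [Finite K] (p : Prog S K) (k₀ : K) (s₀ : S) (out : S → Bool)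
    (time : Polynomial ℕ) {I : Type} (enc : I → List Γ') (P : I → Prop)
    (hrun : ∀ i, (run p (s₀, Function.update (fun _ => []) k₀ (enc i))).2 = (fun _ => []) ∧
      (out (run p (s₀, Function.update (fun _ => []) k₀ (enc i))).1 = true ↔ P i) ∧
      cost p (s₀, Function.update (fun _ => []) k₀ (enc i)) ≤ time.eval (enc i).length) :
    InPTIME enc P := by
  classical
  have := finite_pos p
  let _ := Fintype.ofFinite S
  let _ := Fintype.ofFinite K
  let _ := Fintype.ofFinite (Pos p)
  -- The additional label `none` writes the answer and resets the control. A halting configuration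
  -- must have the initial state and empty stacks except for the output, which is why programs have
  -- to empty all registers.
  let M : Option (Pos p) → TM2.Stmt (Alphabet K (Option (Pos p))) (Option (Pos p))
      (S × Option Γ')
    | some x => code x some none
    | none => TM2.Stmt.push none (fun s => out s.1)
        (TM2.Stmt.load (fun _ => (s₀, none)) TM2.Stmt.halt)
  let tm : FinTM2 :=
    { K := Option (K ⊕ Option (Pos p))
      k₀ := some (Sum.inl k₀)
      k₁ := none
      Γ := Alphabet K (Option (Pos p))
      Λ := Option (Pos p)
      main := some (entry p)
      σ := S × Option Γ'
      initialState := (s₀, none)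
      Γk₀Fin := inferInstanceAs (Fintype Γ')
      m := M }
  refine ⟨{ tm := tm, inputAlphabet := Equiv.refl Γ', outputAlphabet := Equiv.refl Bool,
            time := time + 1, outputsFun := fun i => ⟨⟨cost p (s₀, Function.update (fun _ => []) k₀
              (enc i)) + 1, ?_⟩, ?_⟩ }⟩
  · obtain ⟨h₁, h₂, -⟩ := hrun i
    have hs := steps_run (M := M) p some none (fun _ => rfl) (Option.some_injective _)
      (s₀, Function.update (fun _ => []) k₀ (enc i)) (fun _ => []) (fun _ => rfl)
    set st := run p (s₀, Function.update (fun _ => []) k₀ (enc i)) with hst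
    have hout : out st.1 = decide (P i) := by
      by_cases hP : P i
      · rw [h₂.2 hP, decide_eq_true hP]
      · rw [decide_eq_false hP, ← Bool.not_eq_true, h₂]
        exact hP
    have hfin : Steps M 1 (conf none st (fun _ => []))
        ⟨none, (s₀, none), Function.update (stk st.2 (fun _ => [])) none [out st.1]⟩ :=
      steps_conf rfl
    have := hs.trans hfin
    have hi : initList tm (List.map (Equiv.refl Γ').invFun (enc i)) =
        conf (some (entry p)) (s₀, Function.update (fun _ => []) k₀ (enc i)) (fun _ => []) := by
      have : List.map (Equiv.refl Γ').invFun (enc i) = enc i := List.map_id _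
      rw [this]
      refine congrArg (TM2.Cfg.mk _ _) (funext fun j => ?_)
      by_cases hj : j = some (Sum.inl k₀)
      · subst hj
        rw [dif_pos rfl]
        exact (Function.update_self (β := fun _ => List Γ') k₀ (enc i) (fun _ => [])).symm
      · rw [dif_neg hj]
        rcases j with _ | j | j
        · rfl
        · exact (Function.update_of_ne (β := fun _ => List Γ') (a := j) (a' := k₀)
            (fun h => hj (by rw [h])) (enc i) (fun _ => [])).symm
        · rfl
    have hh : haltList tm (List.map (Equiv.refl Bool).invFun (encodeBool (decide (P i)))) =
        ⟨none, (s₀, none), Function.update (stk st.2 (fun _ => [])) none [out st.1]⟩ := by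
      refine congrArg (TM2.Cfg.mk _ _) (funext fun j => ?_)
      by_cases hj : j = none
      · subst hj
        rw [dif_pos rfl, Function.update_self, hout]
        rfl
      · rw [dif_neg hj, Function.update_of_ne hj, h₁]
        rcases j with _ | j | j
        · exact absurd rfl hj
        · rfl
        · rfl
    rw [hi, Option.map_some, hh]
    exact this
  · have := (hrun i).2.2
    simpa using this

end Prog

/-! ### Basic programs: copying, iteration over pieces, extraction, comparison -/

open Computability Turing

/-- The pieces of a word that are closed by the letter `sep`, where the reversal of `t` is the
beginning of the first piece. -/
def splitAfter (sep : Γ') : List Γ' → List Γ' → List (List Γ')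
  | _, [] => []
  | t, c :: w => if c = sep then t.reverse :: splitAfter sep [] w else splitAfter sep (c :: t) w

/-- The pieces of a word that are closed by the letter `sep`. -/
abbrev pieces (sep : Γ') (w : List Γ') : List (List Γ') := splitAfter sep [] w

/-- For `m ≥ 1`, the `m`-th piece of a word whose pieces are closed by commas. -/
def pick : ℕ → List Γ' → List Γ'
  | _, [] => []
  | m, c :: w => if c = Γ'.comma then pick (m - 1) w else if m = 1 then c :: pick m w else pick m w

namespace Prog

/-- A finite control with a letter, a bounded counter and a flag. -/
structure Ctrl (n : ℕ) where
  chr : Γ'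
  cnt : Fin (n + 1)
  flag : Bool

instance (n : ℕ) : Finite (Ctrl n) :=
  Finite.of_injective (fun s : Ctrl n => (s.chr, s.cnt, s.flag)) fun s s' h => by
    cases s; cases s'; simpa using h

/-- The registers: a stack of truth values, three scratch registers and one for each variable. -/
inductive Reg (X : Type)
  | acc | tmp | lhs | rhs
  | var (x : X)
  deriving DecidableEq

instance (X : Type) [Finite X] : Finite (Reg X) :=
  Finite.of_surjective (fun o : Option (Option (Option (Option X))) =>
    o.elim Reg.acc fun o => o.elim Reg.tmp fun o => o.elim Reg.lhs fun o => o.elim Reg.rhs Reg.var)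
    fun
      | .acc => ⟨none, rfl⟩
      | .tmp => ⟨some none, rfl⟩
      | .lhs => ⟨some (some none), rfl⟩
      | .rhs => ⟨some (some (some none)), rfl⟩
      | .var x => ⟨some (some (some (some x))), rfl⟩

variable {n : ℕ} {K : Type} [DecidableEq K]

/-- From any control state, `p` turns the registers `r` into `r'` at a cost of at most `c`. -/
def Acts {S : Type} (p : Prog S K) (r r' : K → List Γ') (c : ℕ) : Prop :=
  ∀ s, (run p (s, r)).2 = r' ∧ cost p (s, r) ≤ c

/-- From any control state and the registers `r`, which it restores, `p` sets the flag according to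
`P`, at a cost of at most `c`. -/
def Tests (p : Prog (Ctrl n) K) (r : K → List Γ') (P : Prop) (c : ℕ) : Prop :=
  ∀ s, (run p (s, r)).2 = r ∧ ((run p (s, r)).1.flag = true ↔ P) ∧ cost p (s, r) ≤ c

theorem Acts.le {S : Type} {p : Prog S K} {r r' : K → List Γ'} {c c' : ℕ} (h : Acts p r r' c)
    (hc : c ≤ c') : Acts p r r' c' := fun s => ⟨(h s).1, (h s).2.trans hc⟩

theorem Acts.seq {S : Type} {p p' : Prog S K} {r r' r'' : K → List Γ'} {c c' : ℕ}
    (h : Acts p r r' c) (h' : Acts p' r' r'' c') : Acts (.seq p p') r r'' (c + c') := fun s => by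
  have e : run p (s, r) = ((run p (s, r)).1, r') := Prod.ext rfl (h s).1
  rw [run, cost, e]
  exact ⟨(h' _).1, Nat.add_le_add (h s).2 (h' _).2⟩

theorem acts_push {S : Type} (k : K) (x : Γ') (r : K → List Γ') :
    Acts (S := S) (.push k fun _ => x) r (Function.update r k (x :: r k)) 1 :=
  fun _ => ⟨rfl, le_rfl⟩

theorem foldCost_le {A B : Type*} {step : A → B → A} {c : A → B → ℕ} {m : ℕ}
    (h : ∀ a b, c a b ≤ m) (l : List B) (a : A) : foldCost step c l a ≤ l.length * m := by
  induction l generalizing a with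
  | nil => simp [foldCost]
  | cons b l ih =>
    rw [foldCost, List.length_cons, Nat.succ_mul, add_comm]
    exact Nat.add_le_add (ih _) (h a b)

theorem cost_loop_le {S : Type} {k : K} {f : S → Γ' → S} {p : Prog S K} {m : ℕ}
    (h : ∀ st, cost p st ≤ m) (st : S × (K → List Γ')) :
    cost (.loop k f p) st ≤ 2 * (st.2 k).length + 3 + (st.2 k).length * (1 + m) :=
  Nat.add_le_add_left (foldCost_le (fun _ _ => Nat.add_le_add_left (h _) 1) _ _) _

/-- Empty the register `k`. -/
def clear {S : Type} (k : K) : Prog S K := .loop k (fun s _ => s) (.pop k fun s _ => s)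

/-- The number of rounds is the length of the word at the entry of the loop, so popping the same
register in the body removes exactly all letters. -/
theorem run_clear {S : Type} (k : K) (s : S) (r : K → List Γ') :
    run (clear k) (s, r) = (s, Function.update r k []) := by
  have : ∀ (w : List Γ') (r : K → List Γ'),
      w.foldl (fun st _ => (st.1, Function.update st.2 k (st.2 k).tail)) (s, r) =
        (s, Function.update r k ((r k).drop w.length)) := by
    intro w
    induction w with
    | nil => simp
    | cons x w ih => intro r; simp [ih]
  have h := this (r k) r
  rwa [List.drop_length] at h

theorem acts_clear {S : Type} (k : K) (r : K → List Γ') :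
    Acts (S := S) (clear k) r (Function.update r k []) (4 * (r k).length + 3) := fun s => by
  rw [run_clear]
  refine ⟨rfl, (cost_loop_le (m := 1) (fun _ => le_rfl) _).trans ?_⟩
  dsimp only
  omega

/-- Keep the letter that a loop has read. -/
def read (s : Ctrl n) (x : Γ') : Ctrl n := { s with chr := x }

/-- Put the reversal of the register `k` in front of the register `k'`. -/
def revPrepend (k k' : K) : Prog (Ctrl n) K := .loop k read (.push k' Ctrl.chr)

theorem acts_revPrepend (k k' : K) (r : K → List Γ') :
    Acts (revPrepend (n := n) k k') r (Function.update r k' ((r k).reverse ++ r k'))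
      (4 * (r k).length + 3) := fun s => by
  have : ∀ (w : List Γ') (s : Ctrl n) (r : K → List Γ'),
      (w.foldl (fun st x => run (.push k' Ctrl.chr) (read st.1 x, st.2)) (s, r)).2 =
        Function.update r k' (w.reverse ++ r k') := by
    intro w
    induction w with
    | nil => simp
    | cons x w ih =>
      intro s r
      have e : run (.push k' Ctrl.chr) (read s x, r) =
        (read s x, Function.update r k' (x :: r k')) := rfl
      rw [List.foldl_cons, e, ih]
      simp
  refine ⟨this _ _ _, (cost_loop_le (m := 1) (fun _ => le_rfl) _).trans ?_⟩
  dsimp only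
  omega

/-- Put the register `k` in front of the register `k'`, by means of the register `t`. -/
def prepend (t k k' : K) : Prog (Ctrl n) K :=
  .seq (revPrepend k t) (.seq (revPrepend t k') (clear t))

theorem acts_prepend {t k k' : K} (hk' : k' ≠ t) {r : K → List Γ'} (ht : r t = []) :
    Acts (prepend (n := n) t k k') r (Function.update r k' (r k ++ r k'))
      (12 * (r k).length + 9) := by
  have h := (acts_revPrepend (n := n) k t r).seq ((acts_revPrepend t k' _).seq (acts_clear t _))
  simp only [ht, Function.update_self, Function.update_of_ne hk', Function.update_of_ne hk'.symm,
    List.append_nil, List.reverse_reverse, List.length_reverse, Function.update_comm hk',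
    Function.update_idem] at h
  rw [(Function.update_eq_self_iff (f := r)).2 ht.symm] at h
  refine h.le ?_
  omega

/-- Run through the pieces of the register `x`, put them into the register `v` and execute `p`. -/
def forEach (t v x : K) (sep : Γ') (p : Prog (Ctrl n) K) : Prog (Ctrl n) K :=
  .seq (.loop x read (.ite (fun s => decide (s.chr = sep))
    (.seq (revPrepend t v) (.seq (clear t) (.seq p (clear v)))) (.push t Ctrl.chr))) (clear t)

/-- The register `t` collects the current piece in reverse until its separator appears, and putting
it into `v` reverses it again. The family `e` describes the registers between the pieces, where `t`
and `v` are empty. What follows the last separator is discarded at the end. -/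
theorem acts_forEach {t v x : K} (hv : v ≠ t) (sep : Γ') {p : Prog (Ctrl n) K}
    {e : ℕ → K → List Γ'} (ht : ∀ j, e j t = []) (hev : ∀ j, e j v = []) {c : ℕ}
    (hp : ∀ j (hj : j < (pieces sep (e 0 x)).length),
      Acts p (Function.update (e j) v (pieces sep (e 0 x))[j])
        (Function.update (e (j + 1)) v (pieces sep (e 0 x))[j]) c) :
    Acts (forEach t v x sep p) (e 0) (e (pieces sep (e 0 x)).length)
      (((e 0 x).length + 1) * (c + 12 * (e 0 x).length + 17)) := by
  set q : Prog (Ctrl n) K := .ite (fun s => decide (s.chr = sep))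
    (.seq (revPrepend t v) (.seq (clear t) (.seq p (clear v)))) (.push t Ctrl.chr) with hq
  -- Generalized to a partially read piece `u`; here `m` bounds the length of every piece that can
  -- still occur.
  have key : ∀ (m : ℕ) (w u : List Γ') (e : ℕ → K → List Γ'), (∀ j, e j t = []) →
      (∀ j, e j v = []) → (∀ j (hj : j < (splitAfter sep u w).length),
        Acts p (Function.update (e j) v (splitAfter sep u w)[j])
          (Function.update (e (j + 1)) v (splitAfter sep u w)[j]) c) →
      u.length + w.length ≤ m → ∀ s : Ctrl n, ∃ u' : List Γ', u'.length ≤ m ∧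
        (w.foldl (fun st x => run q (read st.1 x, st.2)) (s, Function.update (e 0) t u)).2 =
          Function.update (e (splitAfter sep u w).length) t u' ∧
        foldCost (fun st x => run q (read st.1 x, st.2)) (fun st x => 1 + cost q (read st.1 x, st.2))
          w (s, Function.update (e 0) t u) ≤ w.length * (c + 12 * m + 11) := by
    intro m w
    induction w with
    | nil =>
      intro u e _ _ _ hm s
      exact ⟨u, by simpa using hm, rfl, by simp [foldCost]⟩
    | cons y w ih =>
      intro u e ht hev hp hm s
      rw [List.length_cons] at hm
      by_cases hy : y = sep
      · have hs : splitAfter sep u (y :: w) = u.reverse :: splitAfter sep [] w := by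
          rw [splitAfter, if_pos hy]
        have h₀ : Acts (.seq (revPrepend t v) (.seq (clear t) (.seq p (clear v))))
            (Function.update (e 0) t u) (Function.update (e 1) t []) (c + 12 * m + 9) := by
          have h₁ := acts_revPrepend (n := n) t v (Function.update (e 0) t u)
          have h₂ := acts_clear (S := Ctrl n) t
            (Function.update (Function.update (e 0) t u) v u.reverse)
          have h₃ := hp 0 (by simp [hs])
          have h₄ := acts_clear (S := Ctrl n) v (Function.update (e 1) v u.reverse)
          simp only [hs, List.getElem_cons_zero, zero_add] at h₃
          have e₂ : Function.update (Function.update (Function.update (e 0) t u) v u.reverse) t [] =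
              Function.update (e 0) v u.reverse := by
            rw [Function.update_comm hv.symm, Function.update_idem]
            exact Function.update_eq_self_iff.2 (by rw [Function.update_of_ne hv.symm, ht])
          simp only [Function.update_self, Function.update_of_ne hv, Function.update_of_ne hv.symm,
            hev, List.append_nil] at h₁ h₂
          rw [e₂] at h₂
          have e₁ : Function.update (e 1) t [] = Function.update (e 1) v [] := by
            rw [← ht 1, Function.update_eq_self, ht 1, ← hev 1, Function.update_eq_self]
          rw [e₁]
          simp only [Function.update_idem, Function.update_self, List.length_reverse] at h₄
          refine (h₁.seq (h₂.seq (h₃.seq h₄))).le ?_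
          omega
        obtain ⟨u', hu', h₁, h₂⟩ := ih [] (fun j => e (j + 1)) (fun j => ht _) (fun j => hev _)
          (fun j hj => by
            have := hp (j + 1) (by rw [hs]; simpa using hj)
            simpa only [hs, List.getElem_cons_succ] using this) (by simp; omega)
            (run q (read s y, Function.update (e 0) t u)).1
        have e₀ : run q (read s y, Function.update (e 0) t u) =
            ((run q (read s y, Function.update (e 0) t u)).1, Function.update (e 1) t []) := by
          refine Prod.ext rfl ?_
          rw [hq, run, if_pos (by simp [read, hy])]
          exact (h₀ _).1
        have e₁ : cost q (read s y, Function.update (e 0) t u) ≤ 1 + (c + 12 * m + 9) := by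
          rw [hq, cost, if_pos (by simp [read, hy])]
          exact Nat.add_le_add_left (h₀ _).2 1
        refine ⟨u', hu', ?_, ?_⟩
        · rw [List.foldl_cons, e₀, hs]
          exact h₁
        · rw [foldCost, e₀, List.length_cons, Nat.succ_mul, add_comm]
          exact Nat.add_le_add h₂ (by dsimp only; omega)
      · have hs : splitAfter sep u (y :: w) = splitAfter sep (y :: u) w := by
          rw [splitAfter, if_neg hy]
        rw [hs] at hp
        have e₀ : run q (read s y, Function.update (e 0) t u) =
            (read s y, Function.update (e 0) t (y :: u)) := by
          rw [hq, run, if_neg (by simp [read, hy])]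
          simp [run, read]
        have e₁ : cost q (read s y, Function.update (e 0) t u) = 2 := by
          rw [hq, cost, if_neg (by simp [read, hy])]
          rfl
        obtain ⟨u', hu', h₁, h₂⟩ := ih (y :: u) e ht hev hp (by simp; omega) (read s y)
        refine ⟨u', hu', ?_, ?_⟩
        · rw [List.foldl_cons, e₀, hs]
          exact h₁
        · rw [foldCost, e₀, List.length_cons, Nat.succ_mul, add_comm]
          exact Nat.add_le_add h₂ (by dsimp only; omega)
  intro s
  obtain ⟨u', hu', h₁, h₂⟩ := key (e 0 x).length (e 0 x) [] e ht hev hp (by simp) s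
  have e₀ : Function.update (e 0) t [] = e 0 := by rw [← ht 0, Function.update_eq_self]
  rw [e₀] at h₁ h₂
  have hr : run (forEach t v x sep p) (s, e 0) =
      run (clear t) (run (.loop x read q) (s, e 0)) := rfl
  have hc : cost (forEach t v x sep p) (s, e 0) =
      cost (.loop x read q) (s, e 0) + cost (clear t) (run (.loop x read q) (s, e 0)) := rfl
  have e₁ : run (.loop x read q) (s, e 0) = ((run (.loop x read q) (s, e 0)).1,
      Function.update (e (pieces sep (e 0 x)).length) t u') := Prod.ext rfl h₁
  have h₃ := acts_clear (S := Ctrl n) t (Function.update (e (pieces sep (e 0 x)).length) t u')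
    (run (.loop x read q) (s, e 0)).1
  rw [Function.update_idem, Function.update_self] at h₃
  constructor
  · rw [hr, e₁, h₃.1, ← ht, Function.update_eq_self]
  · rw [hc, e₁]
    refine (Nat.add_le_add (Nat.add_le_add_left h₂ _) h₃.2).trans ?_
    dsimp only
    nlinarith

/-- Keep the letter that a loop has read, and count commas down. -/
def countRead (s : Ctrl n) (y : Γ') : Ctrl n :=
  { s with chr := y, cnt := if y = Γ'.comma then ⟨s.cnt - 1, by omega⟩ else s.cnt }

/-- Put the last read letter in front of the register `k` if it belongs to the piece that the
counter asks for. -/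
def pushCounted (k : K) : Prog (Ctrl n) K :=
  .ite (fun s => decide (s.chr ≠ Γ'.comma ∧ s.cnt.val = 1)) (.push k Ctrl.chr) (.upd id)

/-- Put the reversal of the `i`-th piece of the register `x`, where pieces are closed by commas, in
front of the register `k`. -/
def extract (x : K) (i : Fin n) (k : K) : Prog (Ctrl n) K :=
  .seq (.upd fun s => { s with cnt := i.succ }) (.loop x countRead (pushCounted k))

/-- The counter starts at `i + 1` and decreases at each comma, so it equals `1` exactly inside the
wanted piece. At `0` it stays there by truncated subtraction, and nothing more is selected. -/
theorem acts_extract (x : K) (i : Fin n) (k : K) (r : K → List Γ') :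
    Acts (extract x i k) r (Function.update r k ((pick (i + 1) (r x)).reverse ++ r k))
      (5 * (r x).length + 4) := by
  have : ∀ (w : List Γ') (s : Ctrl n) (r : K → List Γ'),
      (w.foldl (fun st y => run (pushCounted k) (countRead st.1 y, st.2)) (s, r)).2 =
        Function.update r k ((pick s.cnt w).reverse ++ r k) := by
    intro w
    induction w with
    | nil => simp [pick]
    | cons y w ih =>
      intro s r
      rw [List.foldl_cons, pick]
      by_cases hy : y = Γ'.comma
      · have e : run (pushCounted k) (countRead s y, r) = (countRead s y, r) := by
          simp [pushCounted, run, countRead, hy]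
        rw [e, ih, if_pos hy]
        simp [countRead, hy]
      · by_cases hs : (s.cnt : ℕ) = 1
        · have e : run (pushCounted k) (countRead s y, r) =
              (countRead s y, Function.update r k (y :: r k)) := by
            simp [pushCounted, run, countRead, hy, hs]
          rw [e, ih, if_neg hy, if_pos hs]
          simp [countRead, hy]
        · have e : run (pushCounted k) (countRead s y, r) = (countRead s y, r) := by
            simp [pushCounted, run, countRead, hy, hs]
          rw [e, ih, if_neg hy, if_neg hs]
          simp [countRead, hy]
  intro s
  refine ⟨this _ _ _, ?_⟩
  have := cost_loop_le (k := x) (f := countRead) (p := pushCounted k) (m := 2) (fun st => by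
    rw [pushCounted, cost]
    split_ifs <;> simp [cost]) ({ s with cnt := i.succ }, r)
  rw [extract, cost]
  refine (Nat.add_le_add_left this _).trans ?_
  rw [cost]
  dsimp only
  omega

/-- Empty the registers `k` and `k'`, and set the flag if they were equal. -/
def compare (k k' : K) : Prog (Ctrl n) K :=
  .seq (.upd fun s => { s with flag := true })
    (.seq (.loop k read (.pop k' fun s o => { s with flag := s.flag && decide (o = some s.chr) }))
      (.seq (.pop k' fun s o => { s with flag := s.flag && o.isNone })
        (.seq (clear k) (clear k'))))

/-- One letter of `k'` is popped per letter of `k`, and popping an empty register counts as a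
mismatch. The words are equal if no mismatch occurred and nothing remains of `k'`. -/
theorem compare_spec {k k' : K} (hk : k ≠ k') (r : K → List Γ') (s : Ctrl n) :
    (run (compare k k') (s, r)).2 = Function.update (Function.update r k []) k' [] ∧
    ((run (compare k k') (s, r)).1.flag = true ↔ r k = r k') ∧
    cost (compare k k') (s, r) ≤ 8 * (r k).length + 4 * (r k').length + 11 := by
  have key : ∀ (w : List Γ') (s : Ctrl n) (r : K → List Γ'), ∃ s' : Ctrl n, ∃ u : List Γ',
      w.foldl (fun st y => run (.pop k' fun s o =>
        { s with flag := s.flag && decide (o = some s.chr) }) (read st.1 y, st.2)) (s, r) =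
        (s', Function.update r k' u) ∧ u.length ≤ (r k').length ∧
      (s'.flag = true ∧ u = [] ↔ s.flag = true ∧ w = r k') := by
    intro w
    induction w with
    | nil =>
      intro s r
      exact ⟨s, r k', by simp, le_rfl, by rw [eq_comm (a := r k')]⟩
    | cons y w ih =>
      intro s r
      obtain ⟨s', u, h₁, h₂, h₃⟩ := ih { s with
        chr := y, flag := s.flag && decide ((r k').head? = some y) }
        (Function.update r k' (r k').tail)
      refine ⟨s', u, ?_, ?_, ?_⟩
      · rw [List.foldl_cons, run, read]
        rw [h₁, Function.update_idem]
      · rw [Function.update_self] at h₂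
        exact h₂.trans (by simp)
      · rw [h₃, Function.update_self]
        cases hr : r k' with
        | nil => simp
        | cons z u => simp [and_assoc, eq_comm (a := z)]
  obtain ⟨s', u, h₁, h₂, h₃⟩ := key (r k) { s with flag := true } r
  have e₁ : run (compare k k') (s, r) = ({ s' with flag := s'.flag && u.head?.isNone },
      Function.update (Function.update r k []) k' []) := by
    have : run (.loop k read (.pop k' fun s o =>
        { s with flag := s.flag && decide (o = some s.chr) })) ({ s with flag := true }, r) =
        (s', Function.update r k' u) := h₁
    rw [compare, run, run, run, this, run, run, run, run_clear, run_clear]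
    simp [Function.update_comm hk]
  refine ⟨by rw [e₁], ?_, ?_⟩
  · rw [e₁]
    have : (s'.flag && u.head?.isNone) = true ↔ s'.flag = true ∧ u = [] := by simp
    rw [this, h₃]
    simp
  · have : run (.loop k read (.pop k' fun s o =>
        { s with flag := s.flag && decide (o = some s.chr) })) ({ s with flag := true }, r) =
        (s', Function.update r k' u) := h₁
    have h₄ := cost_loop_le (k := k) (f := read) (p := .pop k' fun (s : Ctrl n) o =>
        { s with flag := s.flag && decide (o = some s.chr) }) (m := 1) (fun st => le_rfl)
        ({ s with flag := true }, r)
    have h₅ := ((acts_clear k (Function.update r k' u.tail)).seq (acts_clear k' _)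
      { s' with flag := s'.flag && u.head?.isNone }).2
    have e₂ : run (.pop k' fun (s : Ctrl n) o => { s with flag := s.flag && o.isNone })
        (s', Function.update r k' u) =
        ({ s' with flag := s'.flag && u.head?.isNone }, Function.update r k' u.tail) := by
      simp [run]
    rw [Function.update_of_ne hk, Function.update_of_ne hk.symm, Function.update_self,
      List.length_tail] at h₅
    rw [compare, cost, cost, run, cost, this, cost, cost, e₂]
    dsimp only at h₄ ⊢
    omega

end Prog

/-! ### Evaluation of first-order formulas over words -/

open Computability Turing

theorem length_pick_le (m : ℕ) (w : List Γ') : (pick m w).length ≤ w.length := by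
  induction w generalizing m with
  | nil => simp [pick]
  | cons c w ih =>
    rw [pick]
    split_ifs
    · exact (ih _).trans (by simp)
    · simpa using ih m
    · exact (ih _).trans (by simp)

theorem length_le_of_mem_splitAfter {sep : Γ'} {t w u : List Γ'} (h : u ∈ splitAfter sep t w) :
    u.length ≤ t.length + w.length := by
  induction w generalizing t with
  | nil => simp [splitAfter] at h
  | cons c w ih =>
    rw [splitAfter] at h
    split_ifs at h
    · rcases List.mem_cons.1 h with rfl | h
      · simp
      · refine (ih h).trans ?_
        simp only [List.length_nil, List.length_cons]
        omega
    · refine (ih h).trans ?_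
      simp only [List.length_cons]
      omega

/-- First-order formulas about the words that are assigned to the variables: the atoms compare
pieces, and the quantifiers range over the pieces of a word. -/
inductive Form (X : Type) (n : ℕ)
  | coord (x : X) (i : Fin n) (y : X) (j : Fin n)
  | neg (φ : Form X n)
  | and (φ ψ : Form X n)
  | ex (v x : X) (sep : Γ') (φ : Form X n)

namespace Form
variable {X : Type} [DecidableEq X] {n : ℕ}

/-- The truth value of a formula. -/
def val : Form X n → (X → List Γ') → Prop
  | coord x i y j, ρ => pick (i + 1) (ρ x) = pick (j + 1) (ρ y)
  | neg φ, ρ => ¬ val φ ρ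
  | and φ ψ, ρ => val φ ρ ∧ val ψ ρ
  | ex v x sep φ, ρ => ∃ w ∈ pieces sep (ρ x), val φ (Function.update ρ v w)

/-- The variables that are bound by quantifiers are empty outside of the scope of these. -/
def Fits : Form X n → (X → List Γ') → Prop
  | coord _ _ _ _, _ => True
  | neg φ, ρ => Fits φ ρ
  | and φ ψ, ρ => Fits φ ρ ∧ Fits ψ ρ
  | ex v _ _ φ, ρ => ρ v = [] ∧ ∀ w, Fits φ (Function.update ρ v w)

open Prog in
/-- A program that evaluates a formula. -/
def comp : Form X n → Prog (Ctrl n) (Reg X)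
  | coord x i y j => .seq (extract (.var x) i .lhs) (.seq (extract (.var y) j .rhs)
      (compare .lhs .rhs))
  | neg φ => .seq (comp φ) (.upd fun s => { s with flag := !s.flag })
  | and φ ψ => .seq (comp φ) (.seq (.push .acc fun s => Γ'.bit s.flag) (.seq (comp ψ)
      (.pop .acc fun s o => { s with flag := s.flag && decide (o = some (Γ'.bit true)) })))
  | ex v x sep φ => .seq (.push .acc fun _ => Γ'.bit false) (.seq
      (forEach .tmp (.var v) (.var x) sep (.seq (comp φ) (.seq
        (.pop .acc fun s o => { s with flag := s.flag || decide (o = some (Γ'.bit true)) })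
        (.push .acc fun s => Γ'.bit s.flag))))
      (.pop .acc fun s o => { s with flag := decide (o = some (Γ'.bit true)) }))

/-- A bound for the cost of the evaluation of a formula, in terms of the lengths of the words. -/
noncomputable def time : Form X n → Polynomial ℕ
  | coord _ _ _ _ => 22 * Polynomial.X + 19
  | neg φ => time φ + 1
  | and φ ψ => time φ + time ψ + 2
  | ex _ _ _ φ => (Polynomial.X + 1) * (time φ + 12 * Polynomial.X + 19) + 2

-- Each quantifier is a loop over pieces, so the cost is polynomial for a fixed formula; pieces are
-- no longer than the word that they come from, so one `M` serves all levels. There is only one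
-- flag, hence intermediate truth values are kept on the stack `acc`. The condition `Fits` provides
-- the empty register that `forEach` needs for a bound variable.
open Prog in
theorem tests_comp (φ : Form X n) {r : Reg X → List Γ'} {M : ℕ} (ht : r .tmp = [])
    (hl : r .lhs = []) (hr : r .rhs = []) (hM : ∀ x, (r (.var x)).length ≤ M)
    (hφ : φ.Fits fun x => r (.var x)) :
    Tests φ.comp r (φ.val fun x => r (.var x)) (φ.time.eval M) := by
  induction φ generalizing r with
  | coord x i y j =>
    intro s
    have h₁ := (acts_extract (.var x) i .lhs r).seq (acts_extract (.var y) j .rhs _) s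
    set st := run (.seq (extract (.var x) i .lhs) (extract (.var y) j .rhs)) (s, r) with hst
    have h₂ := compare_spec (n := n) (show (Reg.lhs : Reg X) ≠ .rhs by simp) st.2 st.1
    have hrun : run (comp (coord x i y j)) (s, r) = run (compare .lhs .rhs) st := rfl
    have hcost : cost (comp (coord x i y j)) (s, r) =
        cost (.seq (extract (.var x) i .lhs) (extract (.var y) j .rhs)) (s, r) +
          cost (compare .lhs .rhs) st := by
      rw [comp, cost, cost, cost, hst, run, add_assoc]
    have e₁ : st.2 .lhs = (pick (i + 1) (r (.var x))).reverse := by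
      rw [h₁.1]
      simp [hl]
    have e₂ : st.2 .rhs = (pick (j + 1) (r (.var y))).reverse := by
      rw [h₁.1]
      simp [hr]
    have l₁ : (st.2 .lhs).length ≤ M := by
      rw [e₁, List.length_reverse]
      exact (length_pick_le _ _).trans (hM x)
    have l₂ : (st.2 .rhs).length ≤ M := by
      rw [e₂, List.length_reverse]
      exact (length_pick_le _ _).trans (hM y)
    rw [hrun, hcost]
    refine ⟨?_, ?_, ?_⟩
    · rw [h₂.1, h₁.1]
      funext k
      cases k <;> simp [hl, hr]
    · rw [h₂.2.1, e₁, e₂, List.reverse_inj, val]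
    · have l₃ := h₁.2
      rw [Function.update_of_ne (show (Reg.var y : Reg X) ≠ .lhs by simp)] at l₃
      have := hM x
      have := hM y
      have : cost (compare .lhs .rhs) st ≤ _ := h₂.2.2
      simp only [time, Polynomial.eval_add, Polynomial.eval_mul, Polynomial.eval_ofNat,
        Polynomial.eval_X]
      omega
  | neg φ ih =>
    intro s
    obtain ⟨h₁, h₂, h₃⟩ := ih ht hl hr hM hφ s
    refine ⟨h₁, ?_, ?_⟩
    · rw [val, ← h₂, comp, run, run]
      simp
    · rw [comp, cost, time, Polynomial.eval_add, Polynomial.eval_one]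
      exact Nat.add_le_add h₃ le_rfl
  | and φ ψ ih ih' =>
    intro s
    obtain ⟨h₁, h₂, h₃⟩ := ih ht hl hr hM hφ.1 s
    set s₁ := (run φ.comp (s, r)).1 with hs₁
    set r₁ : Reg X → List Γ' := Function.update r .acc (Γ'.bit s₁.flag :: r .acc) with hr₁
    have e₁ : run φ.comp (s, r) = (s₁, r) := Prod.ext rfl h₁
    have e₂ : (fun x => r₁ (.var x)) = fun x => r (.var x) := rfl
    obtain ⟨h₄, h₅, h₆⟩ := ih' (r := r₁) ht hl hr hM hφ.2 s₁
    set s₂ := (run ψ.comp (s₁, r₁)).1 with hs₂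
    have e₃ : run ψ.comp (s₁, r₁) = (s₂, r₁) := Prod.ext rfl h₄
    have e₄ : run (comp (and φ ψ)) (s, r) =
        ({ s₂ with flag := s₂.flag && s₁.flag }, r) := by
      rw [comp, run, e₁, run, run, run]
      dsimp only
      rw [← hr₁, e₃, run]
      simp [hr₁]
    rw [e₄]
    refine ⟨rfl, ?_, ?_⟩
    · rw [val, ← h₂, ← e₂, ← h₅]
      simp [and_comm]
    · rw [comp, cost, cost, cost, e₁, run]
      dsimp only
      rw [← hr₁, cost, cost, time, Polynomial.eval_add, Polynomial.eval_add, Polynomial.eval_ofNat]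
      omega
  | ex v x sep φ ih =>
    classical
    set ρ : X → List Γ' := fun x => r (.var x) with hρ
    set ws := pieces sep (ρ x) with hws
    -- The truth value on top of `acc` after `j` rounds: a witness occurs among the first `j`
    -- pieces.
    set b : ℕ → Bool := fun j => decide (∃ w ∈ ws.take j, φ.val (Function.update ρ v w)) with hb
    set e : ℕ → Reg X → List Γ' := fun j => Function.update r .acc (Γ'.bit (b j) :: r .acc) with he
    have hb₀ : b 0 = false := by simp [hb]
    have hex : e 0 (.var x) = ρ x := rfl
    have hbody : ∀ j (hj : j < ws.length), Acts (.seq (comp φ) (.seq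
        (.pop .acc fun s o => { s with flag := s.flag || decide (o = some (Γ'.bit true)) })
        (.push .acc fun s => Γ'.bit s.flag))) (Function.update (e j) (.var v) ws[j])
        (Function.update (e (j + 1)) (.var v) ws[j]) (φ.time.eval M + 2) := by
      intro j hj s
      set r₁ := Function.update (e j) (.var v) ws[j] with hr₁
      have e₂ : (fun x => r₁ (.var x)) = Function.update ρ v ws[j] := by
        funext y
        by_cases hy : y = v
        · subst hy
          simp [hr₁]
        · simp [hr₁, hy, he, hρ]
      have hacc : r₁ .acc = Γ'.bit (b j) :: r .acc := by simp [hr₁, he]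
      obtain ⟨h₁, h₂, h₃⟩ := ih (r := r₁) (by simp [hr₁, he, ht]) (by simp [hr₁, he, hl])
        (by simp [hr₁, he, hr]) (fun y => by
          rw [show r₁ (.var y) = Function.update ρ v ws[j] y from congrFun e₂ y]
          by_cases hy : y = v
          · subst hy
            rw [Function.update_self]
            refine (length_le_of_mem_splitAfter (List.getElem_mem hj)).trans ?_
            simpa using hM x
          · rw [Function.update_of_ne hy]
            exact hM y) (by
          rw [e₂]
          exact hφ.2 _) s
      rw [e₂] at h₂
      set s₁ := (run φ.comp (s, r₁)).1
      have e₃ : run φ.comp (s, r₁) = (s₁, r₁) := Prod.ext rfl h₁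
      constructor
      · have hflag : (s₁.flag || b j) = b (j + 1) := by
          rw [Bool.eq_iff_iff, Bool.or_eq_true, h₂]
          simp only [hb, decide_eq_true_eq]
          rw [← List.take_append_getElem hj]
          simp only [List.mem_append, List.mem_singleton, or_and_right, exists_or, exists_eq_left]
          rw [or_comm]
        rw [run, e₃, run, run, run]
        simp only [hacc, List.head?_cons, List.tail_cons, Function.update_self, Function.update_idem,
          Option.some.injEq, Γ'.bit.injEq, Bool.decide_eq_true, hflag]
        rw [hr₁, Function.update_comm (by simp)]
        simp [he]
      · rw [cost, cost, cost, cost]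
        omega
    have hv : r (.var v) = [] := hφ.1
    have hfor := acts_forEach (n := n) (x := .var x) (show (Reg.var v : Reg X) ≠ .tmp by simp) sep
      (e := e) (by simp [he, ht]) (by simp [he, hv]) (by
        rw [hex]
        exact hbody)
    rw [hex] at hfor
    have hpush := acts_push (S := Ctrl n) .acc (Γ'.bit false) r
    rw [← hb₀] at hpush
    intro s
    obtain ⟨h₁, h₂⟩ := (hpush.seq hfor) s
    set p : Prog (Ctrl n) (Reg X) := .seq (.push .acc fun _ => Γ'.bit (b 0))
      (forEach .tmp (.var v) (.var x) sep (.seq (comp φ) (.seq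
        (.pop .acc fun s o => { s with flag := s.flag || decide (o = some (Γ'.bit true)) })
        (.push .acc fun s => Γ'.bit s.flag)))) with hp
    have hrun : run (comp (ex v x sep φ)) (s, r) =
        run (.pop .acc fun s o => { s with flag := decide (o = some (Γ'.bit true)) })
          (run p (s, r)) := by
      rw [hp, hb₀]
      rfl
    have hcost : cost (comp (ex v x sep φ)) (s, r) = cost p (s, r) + 1 := by
      rw [hp, hb₀]
      rfl
    rw [hrun, hcost, run, h₁]
    refine ⟨?_, ?_, ?_⟩
    · simp [he]
    · simp [he, hb, ← hws, val]
    · refine (Nat.add_le_add_right h₂ 1).trans ?_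
      have hx : (ρ x).length ≤ M := hM x
      rw [time]
      simp only [Polynomial.eval_add, Polynomial.eval_mul, Polynomial.eval_ofNat,
        Polynomial.eval_X, Polynomial.eval_one]
      have := Nat.mul_le_mul (Nat.add_le_add_right hx 1) (show φ.time.eval M + 2 +
        12 * (ρ x).length + 17 ≤ φ.time.eval M + 12 * M + 19 by omega)
      omega

end Form

/-! ### Words of facts and of lists of facts -/

open Computability Turing

/-- The word of a fact: its elements in binary, each closed by a comma. -/
def factWord (t : Term σ ℕ) : List Γ' :=
  (List.ofFn t).flatMap fun x => (encodeNat x).map Γ'.bit ++ [Γ'.comma]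

/-- The word of a list of lists of facts. -/
def encodeLists (C : List (List (Term σ ℕ))) : List Γ' :=
  C.flatMap fun T => encodeFacts T ++ [Γ'.bra]

theorem encodeFacts_eq (L : List (Term σ ℕ)) :
    encodeFacts L = L.flatMap fun t => factWord t ++ [Γ'.ket] := rfl

theorem encodeFacts_cons (t : Term σ ℕ) (L : List (Term σ ℕ)) :
    encodeFacts (t :: L) = factWord t ++ Γ'.ket :: encodeFacts L := by
  simp [encodeFacts_eq]

theorem encodeLists_cons (T : List (Term σ ℕ)) (C : List (List (Term σ ℕ))) :
    encodeLists (T :: C) = encodeFacts T ++ Γ'.bra :: encodeLists C := by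
  simp [encodeLists]

theorem splitAfter_append {sep : Γ'} {u : List Γ'} (hu : sep ∉ u) (t w : List Γ') :
    splitAfter sep t (u ++ sep :: w) = (t.reverse ++ u) :: splitAfter sep [] w := by
  induction u generalizing t with
  | nil => simp [splitAfter]
  | cons c u ih =>
    rw [List.mem_cons, not_or] at hu
    rw [List.cons_append, splitAfter, if_neg (Ne.symm hu.1), ih hu.2]
    simp

theorem pieces_flatMap {A : Type*} {sep : Γ'} {f : A → List Γ'} (hf : ∀ a, sep ∉ f a)
    (l : List A) : pieces sep (l.flatMap fun a => f a ++ [sep]) = l.map f := by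
  induction l with
  | nil => rfl
  | cons a l ih =>
    rw [List.flatMap_cons, List.append_assoc, List.singleton_append, pieces,
      splitAfter_append (hf a), List.map_cons, ← ih]
    rfl

theorem mem_factWord {t : Term σ ℕ} {c : Γ'} (h : c ∈ factWord t) :
    c = Γ'.comma ∨ ∃ b, c = Γ'.bit b := by
  simp only [factWord, List.mem_flatMap, List.mem_append, List.mem_map, List.mem_singleton] at h
  obtain ⟨x, -, ⟨b, -, rfl⟩ | rfl⟩ := h
  · exact Or.inr ⟨b, rfl⟩
  · exact Or.inl rfl

/-- The levels of the encoding have different separators: commas close elements, `ket` closes facts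
and `bra` closes lists. Cutting at one level never cuts inside a lower one. -/
theorem pieces_encodeFacts (L : List (Term σ ℕ)) :
    pieces Γ'.ket (encodeFacts L) = L.map factWord :=
  pieces_flatMap (fun t h => by simpa using mem_factWord h) L

theorem pieces_encodeLists (C : List (List (Term σ ℕ))) :
    pieces Γ'.bra (encodeLists C) = C.map encodeFacts :=
  pieces_flatMap (fun T h => by
    rw [encodeFacts_eq, List.mem_flatMap] at h
    obtain ⟨t, -, h⟩ := h
    rcases List.mem_append.1 h with h | h
    · simpa using mem_factWord h
    · simp at h) C

theorem pick_zero (w : List Γ') : pick 0 w = [] := by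
  induction w with
  | nil => rfl
  | cons c w ih => simp [pick, ih]

theorem pick_append {u : List Γ'} (hu : Γ'.comma ∉ u) (m : ℕ) (w : List Γ') :
    pick (m + 1) (u ++ Γ'.comma :: w) = if m = 0 then u else pick m w := by
  induction u with
  | nil =>
    rw [List.nil_append, pick, if_pos rfl, Nat.add_sub_cancel]
    split_ifs with hm
    · rw [hm, pick_zero]
    · rfl
  | cons c u ih =>
    rw [List.mem_cons, not_or] at hu
    rw [List.cons_append, pick, if_neg (Ne.symm hu.1), ih hu.2]
    by_cases hm : m = 0 <;> simp [hm]

theorem pick_flatMap (l : List ℕ) (m : ℕ) (hm : m < l.length) :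
    pick (m + 1) (l.flatMap fun x => (encodeNat x).map Γ'.bit ++ [Γ'.comma]) =
      (encodeNat l[m]).map Γ'.bit := by
  induction l generalizing m with
  | nil => simp at hm
  | cons x l ih =>
    rw [List.flatMap_cons, List.append_assoc, List.singleton_append, pick_append (by simp)]
    cases m with
    | zero => simp
    | succ m => simpa using ih m (by simpa using hm)

theorem pick_factWord (t : Term σ ℕ) (i : Fin σ.arity) :
    pick (i + 1) (factWord t) = (encodeNat (t i)).map Γ'.bit := by
  rw [factWord, pick_flatMap _ _ (by simp), List.getElem_ofFn]

theorem pick_factWord_eq_iff {a b : Term σ ℕ} {i j : Fin σ.arity} :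
    pick (i + 1) (factWord a) = pick (j + 1) (factWord b) ↔ a i = b j := by
  rw [pick_factWord, pick_factWord]
  refine ⟨fun h => ?_, fun h => by rw [h]⟩
  have h' := congrArg decodeNat (List.map_injective_iff.2 (fun a b h => by simpa using h) h)
  simpa using h'

/-- A suitable assignment exists as soon as equal variables meet equal entries, so being a solution
is a conjunction of comparisons of entries. Nonemptiness provides values for variables that occur in
neither atom. -/
theorem Query.sol_iff_forall [Nonempty α] {q : Query σ V} {a b : Term σ α} :
    q.Sol a b ↔ (∀ i j, q.A i = q.A j → a i = a j) ∧ (∀ i j, q.B i = q.B j → b i = b j) ∧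
      ∀ i j, q.A i = q.B j → a i = b j := by
  classical
  constructor
  · rintro ⟨μ, rfl, rfl⟩
    exact ⟨fun i j h => congrArg μ h, fun i j h => congrArg μ h, fun i j h => congrArg μ h⟩
  · rintro ⟨h₁, h₂, h₃⟩
    refine ⟨fun v => if h : ∃ i, q.A i = v then a h.choose else
      if h : ∃ i, q.B i = v then b h.choose else Classical.arbitrary α, ?_, ?_⟩
    · funext i
      have h : ∃ j, q.A j = q.A i := ⟨i, rfl⟩
      rw [Function.comp_apply, dif_pos h]
      exact h₁ _ _ h.choose_spec
    · funext i
      rw [Function.comp_apply]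
      split_ifs with h h'
      · exact h₃ _ _ h.choose_spec
      · exact h₂ _ _ h'.choose_spec
      · exact absurd ⟨i, rfl⟩ h'

/-! ### The derivation step as a first-order formula -/

/-- The variables of the program that decides the query. -/
inductive Var
  | inp | cand | next | delta | rnd | tup | blk | fact | set | mem | mem'
  deriving DecidableEq

instance : Finite Var :=
  Finite.of_surjective (![.inp, .cand, .next, .delta, .rnd, .tup, .blk, .fact, .set, .mem, .mem'] :
    Fin 11 → Var) fun x => by
    cases x
    exacts [⟨0, rfl⟩, ⟨1, rfl⟩, ⟨2, rfl⟩, ⟨3, rfl⟩, ⟨4, rfl⟩, ⟨5, rfl⟩, ⟨6, rfl⟩, ⟨7, rfl⟩, ⟨8, rfl⟩,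
      ⟨9, rfl⟩, ⟨10, rfl⟩]

namespace Form

/-- A true formula. -/
def truth (σ : Signature) : Form Var σ.arity :=
  .coord .inp ⟨0, σ.arity_pos⟩ .inp ⟨0, σ.arity_pos⟩

/-- The conjunction of a list of formulas. -/
def conj (l : List (Form Var σ.arity)) : Form Var σ.arity := l.foldr .and (truth σ)

/-- Disjunction. -/
def or {X : Type} {n : ℕ} (φ ψ : Form X n) : Form X n := .neg (.and (.neg φ) (.neg ψ))

/-- Implication. -/
def imp {X : Type} {n : ℕ} (φ ψ : Form X n) : Form X n := .neg (.and φ (.neg ψ))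

/-- Universal quantification. -/
def all {X : Type} {n : ℕ} (v x : X) (sep : Γ') (φ : Form X n) : Form X n :=
  .neg (.ex v x sep (.neg φ))

/-- The facts `x` and `y` are equal. -/
def eq (x y : Var) : Form Var σ.arity := conj ((List.finRange σ.arity).map fun i => .coord x i y i)

/-- The facts `x` and `y` are key-equal. -/
def keyEq (x y : Var) : Form Var σ.arity :=
  conj ((List.finRange σ.keyLen).map fun i =>
    .coord x (Fin.castLE σ.keyLen_le i) y (Fin.castLE σ.keyLen_le i))

open Classical in
/-- The facts `x` and `y` are a solution of the query. -/
noncomputable def sol (q : Query σ V) (x y : Var) : Form Var σ.arity :=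
  conj ((List.finRange σ.arity).flatMap fun i => (List.finRange σ.arity).flatMap fun j =>
    [if q.A i = q.A j then .coord x i x j else truth σ,
      if q.B i = q.B j then .coord y i y j else truth σ,
      if q.A i = q.B j then .coord x i y j else truth σ])

/-- The list of facts `tup` is consistent. -/
def consistent (σ : Signature) : Form Var σ.arity :=
  .all .mem .tup .ket (.all .mem' .tup .ket (.imp (keyEq .mem .mem') (eq .mem .mem')))

/-- The list of facts `tup` satisfies the query. -/
noncomputable def sat (q : Query σ V) : Form Var σ.arity :=
  .ex .mem .tup .ket (.ex .mem' .tup .ket (sol q .mem .mem'))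

/-- The list of facts `tup` can be derived from the lists in `delta`. -/
def derivable (σ : Signature) : Form Var σ.arity :=
  .ex .blk .inp .ket (.all .fact .inp .ket (.imp (keyEq .fact .blk)
    (.ex .set .delta .bra (.all .mem .set .ket
      (.or (eq .mem .fact) (.ex .mem' .tup .ket (eq .mem .mem')))))))

/-- The list of facts `tup` should be put into `delta`. -/
noncomputable def addable (q : Query σ V) : Form Var σ.arity :=
  .and (consistent σ) (.or (sat q) (derivable σ))

/-- The empty list is in `delta`. -/
def accepting (σ : Signature) : Form Var σ.arity :=
  .ex .set .delta .bra (.all .mem .set .ket (.neg (truth σ)))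

variable {ρ : Var → List Γ'}

theorem val_or {X : Type} [DecidableEq X] {n : ℕ} {φ ψ : Form X n} {ρ : X → List Γ'}
    {P Q : Prop} (h : φ.val ρ ↔ P) (h' : ψ.val ρ ↔ Q) : (or φ ψ).val ρ ↔ P ∨ Q := by
  simp only [or, val, h, h']
  tauto

theorem val_imp {X : Type} [DecidableEq X] {n : ℕ} {φ ψ : Form X n} {ρ : X → List Γ'}
    {P Q : Prop} (h : φ.val ρ ↔ P) (h' : ψ.val ρ ↔ Q) : (imp φ ψ).val ρ ↔ (P → Q) := by
  simp only [imp, val, h, h']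
  tauto

theorem val_ex {A : Type*} {X : Type} [DecidableEq X] {n : ℕ} {φ : Form X n} {ρ : X → List Γ'}
    {v x : X} {sep : Γ'} {l : List A} {f : A → List Γ'} {P : A → Prop}
    (hx : pieces sep (ρ x) = l.map f) (h : ∀ a, φ.val (Function.update ρ v (f a)) ↔ P a) :
    (ex v x sep φ).val ρ ↔ ∃ a ∈ l, P a := by
  simp only [val, hx, List.mem_map, exists_exists_and_eq_and, h]

theorem val_all {A : Type*} {X : Type} [DecidableEq X] {n : ℕ} {φ : Form X n} {ρ : X → List Γ'}
    {v x : X} {sep : Γ'} {l : List A} {f : A → List Γ'} {P : A → Prop}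
    (hx : pieces sep (ρ x) = l.map f) (h : ∀ a, φ.val (Function.update ρ v (f a)) ↔ P a) :
    (all v x sep φ).val ρ ↔ ∀ a ∈ l, P a := by
  simp only [all, val, hx, List.mem_map, exists_exists_and_eq_and, h]
  simp

theorem val_conj (l : List (Form Var σ.arity)) : (conj l).val ρ ↔ ∀ φ ∈ l, φ.val ρ := by
  induction l with
  | nil => simp [conj, truth, val]
  | cons φ l ih => simpa [conj, val] using fun _ => ih

theorem fits_conj {l : List (Form Var σ.arity)} (h : ∀ φ ∈ l, φ.Fits ρ) : (conj l).Fits ρ := by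
  induction l with
  | nil => exact trivial
  | cons φ l ih => exact ⟨h φ (by simp), ih fun ψ hψ => h ψ (by simp [hψ])⟩

theorem fits_eq (x y : Var) : (eq (σ := σ) x y).Fits ρ :=
  fits_conj fun φ hφ => by
    obtain ⟨i, -, rfl⟩ := List.mem_map.1 hφ
    exact trivial

theorem fits_keyEq (x y : Var) : (keyEq (σ := σ) x y).Fits ρ :=
  fits_conj fun φ hφ => by
    obtain ⟨i, -, rfl⟩ := List.mem_map.1 hφ
    exact trivial

theorem fits_sol (q : Query σ V) (x y : Var) : (sol q x y).Fits ρ :=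
  fits_conj fun φ hφ => by
    simp only [List.mem_flatMap, List.mem_cons, List.not_mem_nil, or_false] at hφ
    obtain ⟨i, -, j, -, rfl | rfl | rfl⟩ := hφ <;> split_ifs <;> exact trivial

variable {x y : Var} {a b : Term σ ℕ}

theorem val_eq (hx : ρ x = factWord a) (hy : ρ y = factWord b) :
    (eq (σ := σ) x y).val ρ ↔ a = b := by
  simp [eq, val_conj, val, hx, hy, pick_factWord_eq_iff, funext_iff]

theorem val_keyEq (hx : ρ x = factWord a) (hy : ρ y = factWord b) :
    (keyEq (σ := σ) x y).val ρ ↔ KeyEq a b := by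
  simp only [keyEq, val_conj, List.mem_map, List.mem_finRange, true_and, forall_exists_index,
    forall_apply_eq_imp_iff, val, hx, hy, pick_factWord_eq_iff]
  exact funext_iff.symm

theorem val_sol {q : Query σ V} (hx : ρ x = factWord a) (hy : ρ y = factWord b) :
    (sol q x y).val ρ ↔ q.Sol a b := by
  classical
  have hif : ∀ {P : Prop} [Decidable P] {φ : Form Var σ.arity},
      (if P then φ else truth σ).val ρ ↔ (P → φ.val ρ) := by
    intro P _ φ
    split_ifs with h <;> simp [h, truth, val]
  rw [Query.sol_iff_forall, sol, val_conj]
  simp only [List.mem_flatMap, List.mem_finRange, true_and, List.mem_cons, List.not_mem_nil,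
    or_false]
  have : (∀ φ : Form Var σ.arity, (∃ i j, φ = (if q.A i = q.A j then .coord x i x j else truth σ) ∨
      φ = (if q.B i = q.B j then .coord y i y j else truth σ) ∨
      φ = (if q.A i = q.B j then .coord x i y j else truth σ)) → φ.val ρ) ↔
      ∀ i j, (q.A i = q.A j → a i = a j) ∧ (q.B i = q.B j → b i = b j) ∧
        (q.A i = q.B j → a i = b j) := by
    constructor
    · intro h i j
      have h₁ := h _ ⟨i, j, Or.inl rfl⟩
      have h₂ := h _ ⟨i, j, Or.inr (Or.inl rfl)⟩
      have h₃ := h _ ⟨i, j, Or.inr (Or.inr rfl)⟩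
      rw [hif, val, hx, pick_factWord_eq_iff] at h₁
      rw [hif, val, hy, pick_factWord_eq_iff] at h₂
      rw [hif, val, hx, hy, pick_factWord_eq_iff] at h₃
      exact ⟨h₁, h₂, h₃⟩
    · rintro h φ ⟨i, j, rfl | rfl | rfl⟩
      · rw [hif, val, hx, pick_factWord_eq_iff]
        exact (h i j).1
      · rw [hif, val, hy, pick_factWord_eq_iff]
        exact (h i j).2.1
      · rw [hif, val, hx, hy, pick_factWord_eq_iff]
        exact (h i j).2.2
  rw [this]
  exact ⟨fun h => ⟨fun i j => (h i j).1, fun i j => (h i j).2.1, fun i j => (h i j).2.2⟩,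
    fun h i j => ⟨h.1 i j, h.2.1 i j, h.2.2 i j⟩⟩

end Form

/-- The list `S` should be added to the collection `Δ` of lists of facts from `L`. -/
def Addable (q : Query σ V) (L S : List (Term σ ℕ)) (Δ : List (List (Term σ ℕ))) : Prop :=
  (∀ x ∈ S, ∀ y ∈ S, KeyEq x y → x = y) ∧ ((∃ x ∈ S, ∃ y ∈ S, q.Sol x y) ∨
    ∃ b ∈ L, ∀ u ∈ L, KeyEq u b → ∃ T ∈ Δ, ∀ x ∈ T, x = u ∨ ∃ y ∈ S, x = y)

namespace Form
variable {ρ : Var → List Γ'} {L S : List (Term σ ℕ)} {Δ : List (List (Term σ ℕ))}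

theorem val_addable (q : Query σ V) (hL : ρ .inp = encodeFacts L) (hS : ρ .tup = encodeFacts S)
    (hΔ : ρ .delta = encodeLists Δ) : (addable q).val ρ ↔ Addable q L S Δ := by
  have pL := pieces_encodeFacts L
  have pS := pieces_encodeFacts S
  have pΔ := pieces_encodeLists Δ
  rw [← hL] at pL
  rw [← hS] at pS
  rw [← hΔ] at pΔ
  refine and_congr (val_all pS fun x => val_all pS fun y => val_imp (val_keyEq rfl rfl)
    (val_eq rfl rfl)) (val_or (val_ex pS fun x => val_ex pS fun y => val_sol rfl rfl)
    (val_ex pL fun b => val_all pL fun u => val_imp (val_keyEq rfl rfl)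
      (val_ex pΔ fun T => val_all (pieces_encodeFacts T) fun x => val_or (val_eq rfl rfl)
        (val_ex pS fun y => val_eq rfl rfl))))

theorem val_accepting (hΔ : ρ .delta = encodeLists Δ) : (accepting σ).val ρ ↔ [] ∈ Δ := by
  have pΔ := pieces_encodeLists Δ
  rw [← hΔ] at pΔ
  have : (accepting σ).val ρ ↔ ∃ T ∈ Δ, ∀ x ∈ T, False :=
    val_ex pΔ fun T => val_all (pieces_encodeFacts T) fun x => by simp [truth, val]
  rw [this]
  constructor
  · rintro ⟨T, hT, h⟩
    rwa [← List.eq_nil_iff_forall_not_mem.2 h]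
  · exact fun h => ⟨[], h, by simp⟩

theorem fits_addable (q : Query σ V) (h₁ : ρ .blk = []) (h₂ : ρ .fact = []) (h₃ : ρ .set = [])
    (h₄ : ρ .mem = []) (h₅ : ρ .mem' = []) : (addable q).Fits ρ :=
  ⟨⟨h₄, fun _ => ⟨h₅, fun _ => ⟨fits_keyEq _ _, fits_eq _ _⟩⟩⟩,
    ⟨h₄, fun _ => ⟨h₅, fun _ => fits_sol _ _ _⟩⟩,
    ⟨h₁, fun _ => ⟨h₂, fun _ => ⟨fits_keyEq _ _, h₃, fun _ => ⟨h₄, fun _ => ⟨fits_eq _ _, h₅,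
      fun _ => fits_eq _ _⟩⟩⟩⟩⟩⟩

theorem fits_accepting (h₃ : ρ .set = []) (h₄ : ρ .mem = []) : (accepting σ).Fits ρ :=
  ⟨h₃, fun _ => ⟨h₄, fun _ => trivial⟩⟩

end Form

/-! ### The fixpoint on lists of facts -/

/-- Extend the lists in `C` by at most one fact from `L`. -/
def extendLists (L : List (Term σ ℕ)) (C : List (List (Term σ ℕ))) : List (List (Term σ ℕ)) :=
  C.foldl (fun N T => L.foldl (fun N x => (x :: T) :: N) (T :: N)) []

theorem mem_extendLists {L S : List (Term σ ℕ)} {C : List (List (Term σ ℕ))} :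
    S ∈ extendLists L C ↔ ∃ T ∈ C, S = T ∨ ∃ x ∈ L, S = x :: T := by
  have h₁ : ∀ (L T : List (Term σ ℕ)) (N : List (List (Term σ ℕ))),
      S ∈ L.foldl (fun N x => (x :: T) :: N) N ↔ (∃ x ∈ L, S = x :: T) ∨ S ∈ N := by
    intro L T
    induction L with
    | nil => simp
    | cons x L ih =>
      intro N
      simp only [List.foldl_cons, ih, List.mem_cons, exists_eq_or_imp, or_assoc, or_left_comm]
  have h₂ : ∀ (C N : List (List (Term σ ℕ))),
      S ∈ C.foldl (fun N T => L.foldl (fun N x => (x :: T) :: N) (T :: N)) N ↔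
        (∃ T ∈ C, S = T ∨ ∃ x ∈ L, S = x :: T) ∨ S ∈ N := by
    intro C
    induction C with
    | nil => simp
    | cons T C ih =>
      intro N
      simp only [List.foldl_cons, ih, h₁, List.mem_cons, exists_eq_or_imp, or_assoc, or_left_comm]
  simp only [extendLists, h₂, List.not_mem_nil, or_false]

/-- All lists of at most `k` facts from `L`. -/
def listsUpTo (L : List (Term σ ℕ)) (k : ℕ) : List (List (Term σ ℕ)) := (extendLists L)^[k] [[]]

theorem mem_listsUpTo {L S : List (Term σ ℕ)} {k : ℕ} :
    S ∈ listsUpTo L k ↔ S.length ≤ k ∧ S ⊆ L := by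
  induction k generalizing S with
  | zero =>
    simp only [listsUpTo, Function.iterate_zero, id_eq, List.mem_singleton, Nat.le_zero,
      List.length_eq_zero_iff]
    exact ⟨fun h => ⟨h, by simp [h]⟩, fun h => h.1⟩
  | succ k ih =>
    rw [listsUpTo, Function.iterate_succ_apply', ← listsUpTo, mem_extendLists]
    constructor
    · rintro ⟨T, hT, rfl | ⟨x, hx, rfl⟩⟩
      · exact ⟨(ih.1 hT).1.trans (Nat.le_succ k), (ih.1 hT).2⟩
      · exact ⟨Nat.succ_le_succ (ih.1 hT).1, List.cons_subset.2 ⟨hx, (ih.1 hT).2⟩⟩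
    · rintro ⟨hk, hS⟩
      cases S with
      | nil => exact ⟨[], ih.2 ⟨by simp, hS⟩, Or.inl rfl⟩
      | cons x T =>
        rw [List.cons_subset] at hS
        exact ⟨T, ih.2 ⟨by simpa using hk, hS.2⟩, Or.inr ⟨x, hS.1, rfl⟩⟩

variable (q : Query σ V) (L : List (Term σ ℕ))

open Classical in
/-- Add the list `S` to the collection `Δ` if it is derivable. -/
noncomputable def addList (Δ : List (List (Term σ ℕ))) (S : List (Term σ ℕ)) :
    List (List (Term σ ℕ)) := if Addable q L S Δ then S :: Δ else Δ

/-- Add all derivable lists from `C` to the collection `Δ`. -/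
noncomputable def addLists (C Δ : List (List (Term σ ℕ))) : List (List (Term σ ℕ)) :=
  C.foldl (addList q L) Δ

variable {q L} {S : List (Term σ ℕ)} {C Δ Δ' : List (List (Term σ ℕ))}

theorem Addable.mono (h : Addable q L S Δ) (hΔ : Δ ⊆ Δ') : Addable q L S Δ' := by
  refine ⟨h.1, h.2.imp_right ?_⟩
  rintro ⟨b, hb, h⟩
  refine ⟨b, hb, fun u hu hub => ?_⟩
  obtain ⟨T, hT, h⟩ := h u hu hub
  exact ⟨T, hΔ hT, h⟩

theorem mem_addList {T : List (Term σ ℕ)} :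
    T ∈ addList q L Δ S ↔ T ∈ Δ ∨ T = S ∧ Addable q L S Δ := by
  rw [addList]
  split_ifs with h
  · simp [h, or_comm]
  · simp [h]

theorem subset_addList : Δ ⊆ addList q L Δ S := fun _ h => mem_addList.2 (Or.inl h)

theorem subset_addLists : Δ ⊆ addLists q L C Δ := by
  induction C generalizing Δ with
  | nil => exact List.Subset.refl _
  | cons S C ih => exact List.Subset.trans subset_addList ih

theorem addable_mem_addLists (hS : S ∈ C) (h : Addable q L S Δ) : S ∈ addLists q L C Δ := by
  induction C generalizing Δ with
  | nil => simp at hS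
  | cons T C ih =>
    rcases List.mem_cons.1 hS with rfl | hS
    · exact subset_addLists (C := C) (mem_addList.2 (Or.inr ⟨rfl, h⟩))
    · exact ih hS (h.mono subset_addList)

/-- The collection grows while `C` is being traversed, so a list may be added on the basis of lists
from the same round. The step must therefore hold for every intermediate collection. -/
theorem addLists_induction {P : List (Term σ ℕ) → Prop} (h₀ : ∀ S ∈ Δ, P S)
    (h : ∀ S ∈ C, ∀ Δ, (∀ T ∈ Δ, P T) → Addable q L S Δ → P S) : ∀ S ∈ addLists q L C Δ, P S := by
  induction C generalizing Δ with
  | nil => exact h₀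
  | cons T C ih =>
    refine ih (fun S hS => ?_) fun S hS => h S (List.mem_cons_of_mem _ hS)
    rcases mem_addList.1 hS with hS | ⟨rfl, hS⟩
    · exact h₀ S hS
    · exact h S (by simp) Δ h₀ hS

/-- All lists from `C` that can be added to `Δ` are in `Δ`. -/
def Closed (q : Query σ V) (L : List (Term σ ℕ)) (C Δ : List (List (Term σ ℕ))) : Prop :=
  ∀ S ∈ C, Addable q L S Δ → S ∈ Δ

theorem Closed.addLists (h : Closed q L C Δ) : Closed q L C (addLists q L C Δ) := by
  have hsub : TwoAtomCQA.addLists q L C Δ ⊆ Δ :=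
    addLists_induction (P := (· ∈ Δ)) (fun _ hS => hS) fun S hS Δ' hΔ' hadd =>
      h S hS (hadd.mono hΔ')
  exact fun S hS hadd => subset_addLists (h S hS (hadd.mono hsub))

theorem iterate_addLists_subset (i : ℕ) : (addLists q L C)^[i] [] ⊆ C := by
  induction i with
  | zero => simp
  | succ i ih =>
    rw [Function.iterate_succ_apply']
    exact addLists_induction (P := (· ∈ C)) ih fun S hS _ _ _ => hS

/-- A round that starts from a collection that is not closed adds a new list from `C`. After as many
rounds as `C` has entries, the collection is closed or contains all of `C`, and in the latter case
it is closed as well. -/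
theorem closed_iterate_addLists : Closed q L C ((addLists q L C)^[C.length] []) := by
  classical
  have key : ∀ i, Closed q L C ((addLists q L C)^[i] []) ∨
      i ≤ ((addLists q L C)^[i] []).toFinset.card := by
    intro i
    induction i with
    | zero => exact Or.inr (Nat.zero_le _)
    | succ i ih =>
      rw [Function.iterate_succ_apply']
      by_cases h : Closed q L C ((addLists q L C)^[i] [])
      · exact Or.inl h.addLists
      · refine Or.inr ((ih.resolve_left h).trans_lt (Finset.card_lt_card ?_))
        obtain ⟨S, hS, hadd, hnot⟩ : ∃ S ∈ C, Addable q L S ((addLists q L C)^[i] []) ∧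
            S ∉ (addLists q L C)^[i] [] := by
          simpa [Closed] using h
        refine (Finset.ssubset_iff_of_subset fun T hT => ?_).2 ⟨S, ?_, by simpa using hnot⟩
        · rw [List.mem_toFinset] at hT ⊢
          exact subset_addLists hT
        · rw [List.mem_toFinset]
          exact addable_mem_addLists hS hadd
  rcases key C.length with h | h
  · exact h
  · have hsub : ((addLists q L C)^[C.length] []).toFinset ⊆ C.toFinset := fun S hS => by
      rw [List.mem_toFinset] at hS ⊢
      exact iterate_addLists_subset _ hS
    have := Finset.eq_of_subset_of_card_le hsub (C.toFinset_card_le.trans h)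
    intro S hS _
    rwa [← List.mem_toFinset, this, List.mem_toFinset]

theorem Addable.isKSet {k : ℕ} (h : Addable q L S Δ) (hS : S ∈ listsUpTo L k) :
    IsKSet k L.toFinset S.toFinset := by
  rw [mem_listsUpTo] at hS
  refine isKSet_iff.2 ⟨S.toFinset_card_le.trans hS.1, fun x hx => ?_, fun x hx y hy => ?_⟩
  · rw [List.mem_toFinset] at hx ⊢
    exact hS.2 hx
  · rw [List.mem_toFinset] at hx hy
    exact h.1 x hx y hy

theorem Delta.isKSet {q : Query σ V} [DecidableEq α] {k : ℕ} {D S : Database σ α}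
    (h : Delta q k D S) : IsKSet k D S := by
  cases h with
  | base S hS => exact hS
  | step S hS => exact hS

theorem addLists_sound {k i : ℕ} :
    ∀ S ∈ (addLists q L (listsUpTo L k))^[i] [], Delta q k L.toFinset S.toFinset := by
  induction i with
  | zero => simp
  | succ i ih =>
    rw [Function.iterate_succ_apply']
    refine addLists_induction (P := fun S => Delta q k L.toFinset S.toFinset) ih
      fun S hS Δ hΔ hadd => ?_
    have hK := hadd.isKSet hS
    rcases hadd.2 with ⟨x, hx, y, hy, hxy⟩ | ⟨b, hb, h⟩
    · exact .base _ hK ⟨x, by simpa using hx, y, by simpa using hy, hxy⟩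
    -- The rule asks for a total function `T`; outside the block its value is the arbitrary choice
    -- `∅`.
    · have h' : ∀ u, ∃ T : Database σ ℕ, u ∈ blockOf L.toFinset b →
          T ⊆ insert u S.toFinset ∧ Delta q k L.toFinset T := by
        intro u
        by_cases hu : u ∈ blockOf L.toFinset b
        · rw [blockOf, Finset.mem_filter, List.mem_toFinset] at hu
          obtain ⟨T, hT, hTS⟩ := h u hu.1 hu.2
          refine ⟨T.toFinset, fun _ => ⟨fun x hx => ?_, hΔ T hT⟩⟩
          rw [List.mem_toFinset] at hx
          simpa using hTS x hx
        · exact ⟨∅, fun h => absurd h hu⟩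
      choose T hT using h'
      exact .step _ hK b (by simpa using hb) T (fun u hu => (hT u hu).1) fun u hu => (hT u hu).2

/-- A set has many listings, and the claim for all listings of length at most `k` makes the
induction work: a premise `T u` is used through the listing `(T u).toList`, which is short enough
because derived sets are `k`-sets. -/
theorem Closed.mem_of_delta {k : ℕ} (h : Closed q L (listsUpTo L k) Δ) {D : Database σ ℕ}
    (hD : Delta q k L.toFinset D) : ∀ S : List (Term σ ℕ), S.toFinset = D → S.length ≤ k →
      S ∈ Δ := by
  have hmem : ∀ S : List (Term σ ℕ), IsKSet k L.toFinset S.toFinset → S.length ≤ k →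
      S ∈ listsUpTo L k ∧ ∀ x ∈ S, ∀ y ∈ S, KeyEq x y → x = y := by
    intro S hS hlen
    rw [isKSet_iff] at hS
    refine ⟨mem_listsUpTo.2 ⟨hlen, fun x hx => ?_⟩, fun x hx y hy => ?_⟩
    · have := hS.2.1 (List.mem_toFinset.2 hx)
      simpa using this
    · exact hS.2.2 x (List.mem_toFinset.2 hx) y (List.mem_toFinset.2 hy)
  induction hD with
  | base D hD hq =>
    rintro S rfl hlen
    obtain ⟨x, hx, y, hy, hxy⟩ := hq
    exact h S (hmem S hD hlen).1 ⟨(hmem S hD hlen).2,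
      Or.inl ⟨x, by simpa using hx, y, by simpa using hy, hxy⟩⟩
  | step D hD b hb T hT hΔ ih =>
    rintro S rfl hlen
    refine h S (hmem S hD hlen).1 ⟨(hmem S hD hlen).2, Or.inr ⟨b, by simpa using hb,
      fun u hu hub => ⟨(T u).toList, ?_, fun x hx => ?_⟩⟩⟩
    · have hu' : u ∈ blockOf L.toFinset b := by
        rw [blockOf, Finset.mem_filter, List.mem_toFinset]
        exact ⟨hu, hub⟩
      refine ih u hu' _ (Finset.toList_toFinset _) ?_
      rw [Finset.length_toList]
      exact (hΔ u hu').isKSet.1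
    · have hu' : u ∈ blockOf L.toFinset b := by
        rw [blockOf, Finset.mem_filter, List.mem_toFinset]
        exact ⟨hu, hub⟩
      have := hT u hu' (Finset.mem_toList.1 hx)
      simpa using this

theorem nil_mem_iterate_addLists_iff {k : ℕ} :
    [] ∈ (addLists q L (listsUpTo L k))^[(listsUpTo L k).length] [] ↔ q.Cert k L.toFinset :=
  ⟨fun h => by simpa [Query.Cert] using addLists_sound _ h,
    fun h => closed_iterate_addLists.mem_of_delta h [] rfl (Nat.zero_le _)⟩

/-! ### Polynomial bounds on word lengths, and the generation of candidates -/

open Computability Turing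

section Lengths
variable {L T : List (Term σ ℕ)} {C N : List (List (Term σ ℕ))}

theorem length_encodeLists_cons :
    (encodeLists (T :: C)).length = (encodeFacts T).length + 1 + (encodeLists C).length := by
  simp [encodeLists_cons]
  omega

theorem length_encodeFacts_cons (x : Term σ ℕ) :
    (encodeFacts (x :: T)).length = (factWord x).length + 1 + (encodeFacts T).length := by
  simp [encodeFacts_cons]
  omega

theorem length_le_length_encodeLists : C.length ≤ (encodeLists C).length := by
  induction C with
  | nil => simp
  | cons T C ih =>
    rw [length_encodeLists_cons, List.length_cons]
    omega

theorem length_lt_length_encodeLists (h : T ∈ C) :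
    (encodeFacts T).length < (encodeLists C).length := by
  induction C with
  | nil => simp at h
  | cons S C ih =>
    rw [length_encodeLists_cons]
    rcases List.mem_cons.1 h with rfl | h
    · omega
    · have := ih h
      omega

theorem length_lt_length_encodeFacts {x : Term σ ℕ} (h : x ∈ L) :
    (factWord x).length < (encodeFacts L).length := by
  induction L with
  | nil => simp at h
  | cons y L ih =>
    rw [length_encodeFacts_cons]
    rcases List.mem_cons.1 h with rfl | h
    · omega
    · have := ih h
      omega

/-- Each list is copied once, and once more together with each fact of `L`. The number of facts and
their total length are both at most the length of the word of `L`, whence the factor. For fixed `k`,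
iteration gives a polynomial. -/
theorem length_encodeLists_extendLists :
    (encodeLists (extendLists L C)).length ≤
      (encodeLists C).length * (2 * (encodeFacts L).length + 1) := by
  have h₁ : ∀ (L T : List (Term σ ℕ)) (N : List (List (Term σ ℕ))),
      (encodeLists (L.foldl (fun N x => (x :: T) :: N) N)).length ≤
        (encodeLists N).length + (encodeFacts L).length * ((encodeFacts T).length + 2) := by
    intro L T
    induction L with
    | nil => simp
    | cons x L ih =>
      intro N
      refine (ih _).trans ?_
      rw [length_encodeLists_cons, length_encodeFacts_cons, length_encodeFacts_cons]
      nlinarith [Nat.zero_le ((factWord x).length * (encodeFacts T).length)]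
  have h₂ : ∀ C N : List (List (Term σ ℕ)),
      (encodeLists (C.foldl (fun N T => L.foldl (fun N x => (x :: T) :: N) (T :: N)) N)).length ≤
        (encodeLists N).length + (encodeLists C).length * (2 * (encodeFacts L).length + 1) := by
    intro C
    induction C with
    | nil => simp
    | cons T C ih =>
      intro N
      refine (ih _).trans ((Nat.add_le_add_right (h₁ L T (T :: N)) _).trans ?_)
      rw [length_encodeLists_cons, length_encodeLists_cons]
      nlinarith [Nat.zero_le ((encodeFacts L).length * (encodeFacts T).length)]
  exact (h₂ C []).trans (by simp [encodeLists])

theorem length_encodeLists_listsUpTo (j : ℕ) :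
    (encodeLists (listsUpTo L j)).length ≤ (2 * (encodeFacts L).length + 1) ^ j := by
  induction j with
  | zero => simp [listsUpTo, encodeLists, encodeFacts]
  | succ j ih =>
    rw [listsUpTo, Function.iterate_succ_apply', ← listsUpTo, pow_succ]
    exact length_encodeLists_extendLists.trans (Nat.mul_le_mul_right _ ih)

theorem length_encodeLists_addList (q : Query σ V) :
    (encodeLists (addList q L N T)).length ≤ (encodeLists N).length + ((encodeFacts T).length + 1) := by
  rw [addList]
  split_ifs
  · rw [length_encodeLists_cons]
    omega
  · omega

end Lengths

namespace Prog

/-- Here the registers are a function `e` of an abstract state that the loop folds over. The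
invariant `I` lets the cost bound of the body rely on the sizes of the states that are actually
reached. -/
theorem acts_forEach_foldl {n : ℕ} {K : Type} [DecidableEq K] {A B : Type*} {t v x : K}
    (hv : v ≠ t) (sep : Γ') {p : Prog (Ctrl n) K} {f : A → List Γ'} {l : List A}
    {e : B → K → List Γ'} {b : B} (step : B → A → B) (hl : pieces sep (e b x) = l.map f)
    (ht : ∀ b, e b t = []) (hev : ∀ b, e b v = []) {c : ℕ} (I : ℕ → B → Prop) (hI : I 0 b)
    (hp : ∀ j (hj : j < l.length) b, I j b → I (j + 1) (step b l[j]) ∧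
      Acts p (Function.update (e b) v (f l[j])) (Function.update (e (step b l[j])) v (f l[j])) c) :
    I l.length (l.foldl step b) ∧ Acts (forEach t v x sep p) (e b) (e (l.foldl step b))
      (((e b x).length + 1) * (c + 12 * (e b x).length + 17)) := by
  have hs : ∀ j (hj : j < l.length), (l.take (j + 1)).foldl step b =
      step ((l.take j).foldl step b) l[j] := fun j hj => by
    rw [← List.take_append_getElem hj, List.foldl_append, List.foldl_cons, List.foldl_nil]
  have hI' : ∀ j ≤ l.length, I j ((l.take j).foldl step b) := by
    intro j
    induction j with
    | zero => exact fun _ => hI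
    | succ j ih =>
      intro hj
      rw [hs j hj]
      exact (hp j hj _ (ih (Nat.le_of_succ_le hj))).1
  have h := acts_forEach (x := x) hv sep (p := p) (e := fun j => e ((l.take j).foldl step b))
    (fun j => ht _) (fun j => hev _) (c := c) (fun j hj => by
      have hj' : j < l.length := by
        have : j < (pieces sep (e b x)).length := hj
        rwa [hl, List.length_map] at this
      have hg : (pieces sep (e b x))[j]'hj = f l[j] := by simp [hl]
      have := (hp j hj' _ (hI' j hj'.le)).2
      rw [← hs j hj'] at this
      change Acts p (Function.update _ v ((pieces sep (e b x))[j]'hj))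
        (Function.update _ v ((pieces sep (e b x))[j]'hj)) c
      rw [hg]
      exact this)
  have hlen : (pieces sep (e b x)).length = l.length := by rw [hl, List.length_map]
  refine ⟨by simpa using hI' l.length le_rfl, ?_⟩
  simp only [List.take_zero, List.foldl_nil, hlen, List.take_length] at h
  exact h

variable {n : ℕ}

/-- Put the word of the variable `x`, closed by `c`, in front of the word of the variable `y`. -/
def addClosed (x y : Var) (c : Γ') : Prog (Ctrl n) (Reg Var) :=
  .seq (.push (.var y) fun _ => c) (prepend .tmp (.var x) (.var y))

theorem acts_addClosed {x y : Var} (hxy : x ≠ y) (c : Γ') {r : Reg Var → List Γ'}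
    (ht : r .tmp = []) : Acts (addClosed (n := n) x y c) r
      (Function.update r (.var y) (r (.var x) ++ c :: r (.var y)))
      (12 * (r (.var x)).length + 10) := by
  have h := (acts_push (.var y) c r).seq (acts_prepend (n := n) (t := .tmp) (k := .var x)
    (k' := .var y) (by simp) (r := Function.update r (.var y) (c :: r (.var y))) (by simp [ht]))
  rw [Function.update_idem, Function.update_self, Function.update_of_ne (by simpa using hxy)] at h
  refine h.le ?_
  omega

/-- Put the extensions of the list `tup` by one fact into `next`. -/
def extendOne : Prog (Ctrl n) (Reg Var) :=
  forEach .tmp (.var .fact) (.var .inp) .ket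
    (.seq (addClosed .tup .next .bra) (addClosed .fact .next .ket))

variable {L T : List (Term σ ℕ)} {C N Δ : List (List (Term σ ℕ))} {r : Reg Var → List Γ'} {M : ℕ}

theorem acts_extendOne (ht : r .tmp = []) (hf : r (.var .fact) = [])
    (hL : r (.var .inp) = encodeFacts L) (hT : r (.var .tup) = encodeFacts T)
    (hN : r (.var .next) = encodeLists N) (hLM : (encodeFacts L).length ≤ M)
    (hTM : (encodeFacts T).length ≤ M) :
    Acts (extendOne (n := n)) r (Function.update r (.var .next)
      (encodeLists (L.foldl (fun N x => (x :: T) :: N) N))) ((M + 1) * (36 * M + 37)) := by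
  have h := (acts_forEach_foldl (n := n) (x := .var .inp)
    (show (Reg.var .fact : Reg Var) ≠ .tmp by simp) Γ'.ket (f := factWord) (l := L) (b := N)
    (p := .seq (addClosed .tup .next .bra) (addClosed .fact .next .ket))
    (e := fun N => Function.update r (.var .next) (encodeLists N)) (c := 24 * M + 20)
    (fun N x => (x :: T) :: N) (by simp [hL, pieces_encodeFacts]) (by simp [ht]) (by simp [hf])
    (fun _ _ => True) trivial (fun j hj N _ => ⟨trivial, ?_⟩)).2
  · rw [← hN, Function.update_eq_self, hL] at h
    exact h.le (Nat.mul_le_mul (by omega) (by omega))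
  · have hx := length_lt_length_encodeFacts (List.getElem_mem hj)
    have h := (acts_addClosed (n := n) (show Var.tup ≠ Var.next by simp) .bra
      (r := Function.update (Function.update r (.var .next) (encodeLists N)) (.var .fact)
        (factWord L[j])) (by simp [ht])).seq (acts_addClosed (n := n)
          (show Var.fact ≠ Var.next by simp) .ket (by simp [ht]))
    have he : ∀ w w' w'' : List Γ', Function.update (Function.update (Function.update (Function.update
        r (.var .next) w) (.var .fact) (factWord L[j])) (.var .next) w') (.var .next) w'' =
        Function.update (Function.update r (.var .next) w'') (.var .fact) (factWord L[j]) := by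
      intro w w' w''
      rw [Function.update_idem, Function.update_comm (by simp), Function.update_idem]
    rw [he] at h
    simp [hT] at h
    rw [encodeLists_cons, encodeFacts_cons, List.append_assoc, List.cons_append]
    refine h.le ?_
    omega

/-- Put the extensions of the lists in `cand` by at most one fact into `next`. -/
def extend : Prog (Ctrl n) (Reg Var) :=
  forEach .tmp (.var .tup) (.var .cand) .bra (.seq (addClosed .tup .next .bra) extendOne)

theorem acts_extend (ht : r .tmp = []) (hf : r (.var .fact) = []) (hu : r (.var .tup) = [])
    (hn : r (.var .next) = []) (hL : r (.var .inp) = encodeFacts L)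
    (hC : r (.var .cand) = encodeLists C) (hLM : (encodeFacts L).length ≤ M)
    (hCM : (encodeLists C).length ≤ M) :
    Acts (extend (n := n)) r (Function.update r (.var .next) (encodeLists (extendLists L C)))
      ((M + 1) * ((M + 1) * (36 * M + 37) + 24 * M + 27)) := by
  have h := (acts_forEach_foldl (n := n) (x := .var .cand)
    (show (Reg.var .tup : Reg Var) ≠ .tmp by simp) Γ'.bra (f := encodeFacts) (l := C) (b := [])
    (p := .seq (addClosed .tup .next .bra) extendOne)
    (e := fun N => Function.update r (.var .next) (encodeLists N))
    (c := (M + 1) * (36 * M + 37) + 12 * M + 10)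
    (fun N T => L.foldl (fun N x => (x :: T) :: N) (T :: N)) (by simp [hC, pieces_encodeLists])
    (by simp [ht]) (by simp [hu]) (fun _ _ => True) trivial (fun j hj N _ => ⟨trivial, ?_⟩)).2
  · have h₀ : Function.update r (.var .next) (encodeLists ([] : List (List (Term σ ℕ)))) = r :=
      (Function.update_eq_self_iff (f := r)).2 hn.symm
    rw [h₀, hC] at h
    exact h.le (Nat.mul_le_mul (by omega) (by omega))
  · have hx := length_lt_length_encodeLists (List.getElem_mem hj)
    have h := acts_addClosed (n := n) (show Var.tup ≠ Var.next by simp) .bra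
      (r := Function.update (Function.update r (.var .next) (encodeLists N)) (.var .tup)
        (encodeFacts C[j])) (by simp [ht])
    have he : ∀ w w' : List Γ', Function.update (Function.update (Function.update
        r (.var .next) w) (.var .tup) (encodeFacts C[j])) (.var .next) w' =
        Function.update (Function.update r (.var .next) w') (.var .tup) (encodeFacts C[j]) := by
      intro w w'
      rw [Function.update_comm (by simp), Function.update_idem]
    rw [he] at h
    simp at h
    rw [← encodeLists_cons] at h
    have h' := acts_extendOne (n := n) (L := L) (T := C[j]) (N := C[j] :: N) (M := M)
      (r := Function.update (Function.update r (.var .next) (encodeLists (C[j] :: N))) (.var .tup)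
        (encodeFacts C[j])) (by simp [ht]) (by simp [hf]) (by simp [hL]) (by simp) (by simp) hLM
        (by omega)
    rw [he] at h'
    refine (h.seq h').le ?_
    omega

/-- Replace `cand` by its extensions. -/
def extendCand : Prog (Ctrl n) (Reg Var) :=
  .seq extend (.seq (clear (.var .cand)) (.seq (prepend .tmp (.var .next) (.var .cand))
    (clear (.var .next))))

theorem acts_extendCand (ht : r .tmp = []) (hf : r (.var .fact) = []) (hu : r (.var .tup) = [])
    (hn : r (.var .next) = []) (hL : r (.var .inp) = encodeFacts L)
    (hC : r (.var .cand) = encodeLists C) (hLM : (encodeFacts L).length ≤ M)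
    (hCM : (encodeLists C).length ≤ M) (hM : (encodeLists (extendLists L C)).length ≤ M) :
    Acts (extendCand (n := n)) r (Function.update r (.var .cand) (encodeLists (extendLists L C)))
      ((M + 1) * ((M + 1) * (36 * M + 37) + 24 * M + 27) + 20 * M + 15) := by
  have h₁ := acts_extend (n := n) ht hf hu hn hL hC hLM hCM
  set w := encodeLists (extendLists L C) with hw
  have h₂ := acts_clear (S := Ctrl n) (.var .cand) (Function.update r (.var .next) w)
  set r₁ := Function.update (Function.update r (.var .next) w) (.var .cand) [] with hr₁
  have h₃ := acts_prepend (n := n) (t := .tmp) (k := .var .next) (k' := .var .cand) (by simp)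
    (r := r₁) (by simp [hr₁, ht])
  have e₁ : r₁ (.var .next) = w := by simp [hr₁]
  have e₂ : r₁ (.var .cand) = [] := by simp [hr₁]
  rw [e₁, e₂, List.append_nil, hr₁, Function.update_idem, ← hr₁] at h₃
  have h₄ := acts_clear (S := Ctrl n) (.var .next)
    (Function.update (Function.update r (.var .next) w) (.var .cand) w)
  have e₃ : Function.update (Function.update (Function.update r (.var .next) w) (.var .cand) w)
      (.var .next) [] = Function.update r (.var .cand) w := by
    rw [Function.update_comm (show (Reg.var .next : Reg Var) ≠ .var .cand by simp),
      Function.update_idem]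
    exact Function.update_eq_self_iff.2 (by simp [hn])
  rw [e₃, Function.update_of_ne (by simp), Function.update_self] at h₄
  rw [Function.update_of_ne (by simp), hC] at h₂
  refine (h₁.seq (h₂.seq (h₃.seq h₄))).le ?_
  omega

/-- Put all lists of at most `k` facts into `cand`. -/
def makeCand : ℕ → Prog (Ctrl n) (Reg Var)
  | 0 => .push (.var .cand) fun _ => .bra
  | k + 1 => .seq (makeCand k) extendCand

theorem acts_makeCand (ht : r .tmp = []) (hf : r (.var .fact) = []) (hu : r (.var .tup) = [])
    (hn : r (.var .next) = []) (hL : r (.var .inp) = encodeFacts L) (hc : r (.var .cand) = [])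
    (k : ℕ) (hLM : (encodeFacts L).length ≤ M)
    (hM : ∀ j ≤ k, (encodeLists (listsUpTo L j)).length ≤ M) :
    Acts (makeCand (n := n) k) r (Function.update r (.var .cand) (encodeLists (listsUpTo L k)))
      (k * ((M + 1) * ((M + 1) * (36 * M + 37) + 24 * M + 27) + 20 * M + 15) + 1) := by
  induction k with
  | zero =>
    have h := acts_push (S := Ctrl n) (.var .cand) .bra r
    rw [hc] at h
    rw [makeCand]
    simpa [listsUpTo, encodeLists, encodeFacts] using h
  | succ k ih =>
    have hsucc : extendLists L (listsUpTo L k) = listsUpTo L (k + 1) := by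
      rw [listsUpTo, listsUpTo, Function.iterate_succ_apply']
    have h := acts_extendCand (n := n) (L := L) (C := listsUpTo L k) (M := M)
      (r := Function.update r (.var .cand) (encodeLists (listsUpTo L k))) (by simp [ht])
      (by simp [hf]) (by simp [hu]) (by simp [hn]) (by simp [hL]) (by simp) hLM
      (hM k (Nat.le_succ k)) (by
        rw [hsucc]
        exact hM _ le_rfl)
    rw [Function.update_idem, hsucc] at h
    exact ((ih fun j hj => hM j (hj.trans (Nat.le_succ k))).seq h).le (le_of_eq (by ring))

end Prog

/-! ### The program that decides the fixpoint algorithm -/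

open Computability Turing

namespace Prog

variable {L S : List (Term σ ℕ)} {C Δ : List (List (Term σ ℕ))} {r : Reg Var → List Γ'} {m d M : ℕ}

theorem run_test_ite {S' K : Type} [DecidableEq K] {t p p' : Prog S' K} {r : K → List Γ'}
    {out : S' → Bool} (s : S') (h : (run t (s, r)).2 = r) :
    run (.seq t (.ite out p p')) (s, r) =
      if out (run t (s, r)).1 then run p ((run t (s, r)).1, r) else run p' ((run t (s, r)).1, r) := by
  have e : run t (s, r) = ((run t (s, r)).1, r) := Prod.ext rfl h
  rw [run, run, e]

/-- Put the list `tup` into `delta` if it is derivable. -/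
noncomputable def addTup (q : Query σ V) : Prog (Ctrl σ.arity) (Reg Var) :=
  .seq (Form.addable q).comp (.ite Ctrl.flag (addClosed .tup .delta .bra) (.upd id))

theorem acts_addTup (q : Query σ V) (h₁ : r .tmp = []) (h₂ : r .lhs = []) (h₃ : r .rhs = [])
    (h₄ : r (.var .blk) = []) (h₅ : r (.var .fact) = []) (h₆ : r (.var .set) = [])
    (h₇ : r (.var .mem) = []) (h₈ : r (.var .mem') = []) (hL : r (.var .inp) = encodeFacts L)
    (hS : r (.var .tup) = encodeFacts S) (hΔ : r (.var .delta) = encodeLists Δ)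
    (hM : ∀ x, (r (.var x)).length ≤ M) :
    Acts (addTup q) r (Function.update r (.var .delta) (encodeLists (addList q L Δ S)))
      ((Form.addable q).time.eval M + 12 * M + 11) := by
  intro s
  obtain ⟨e₁, e₂, e₃⟩ := Form.tests_comp (Form.addable q) h₁ h₂ h₃ hM
    (Form.fits_addable q h₄ h₅ h₆ h₇ h₈) s
  rw [Form.val_addable q hL hS hΔ] at e₂
  have e : run (Form.addable q).comp (s, r) = ((run (Form.addable q).comp (s, r)).1, r) :=
    Prod.ext rfl e₁
  have h := acts_addClosed (n := σ.arity) (show Var.tup ≠ Var.delta by simp) .bra h₁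
    (run (Form.addable q).comp (s, r)).1
  rw [addTup, run_test_ite _ e₁, cost, e, cost]
  dsimp only
  by_cases hadd : Addable q L S Δ
  · rw [if_pos (e₂.2 hadd), if_pos (e₂.2 hadd), addList, if_pos hadd, encodeLists_cons, ← hS, ← hΔ]
    refine ⟨h.1, ?_⟩
    have := h.2
    have := hM .tup
    omega
  · have hf : ¬ (run (Form.addable q).comp (s, r)).1.flag = true := fun h => hadd (e₂.1 h)
    rw [if_neg hf, if_neg hf, addList, if_neg hadd, ← hΔ, Function.update_eq_self]
    refine ⟨rfl, ?_⟩
    rw [cost]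
    omega

/-- Put all derivable lists from `cand` into `delta`. -/
noncomputable def addCand (q : Query σ V) : Prog (Ctrl σ.arity) (Reg Var) :=
  forEach .tmp (.var .tup) (.var .cand) .bra (addTup q)

/-- There are at most `m` candidates, and each adds at most `m` letters to `delta`, its closing
letter included; hence the bound `d + m * m`. -/
theorem acts_addCand (q : Query σ V) (h₁ : r .tmp = []) (h₂ : r .lhs = []) (h₃ : r .rhs = [])
    (h₄ : r (.var .blk) = []) (h₅ : r (.var .fact) = []) (h₆ : r (.var .set) = [])
    (h₇ : r (.var .mem) = []) (h₈ : r (.var .mem') = []) (h₉ : r (.var .tup) = [])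
    (hL : r (.var .inp) = encodeFacts L)
    (hC : r (.var .cand) = encodeLists C) (hΔ : r (.var .delta) = encodeLists Δ)
    (hCm : (encodeLists C).length ≤ m) (hΔd : (encodeLists Δ).length ≤ d)
    (hM : ∀ x, (r (.var x)).length ≤ M) (hdm : d + m * m ≤ M) :
    (encodeLists (addLists q L C Δ)).length ≤ d + m * m ∧
    Acts (addCand q) r (Function.update r (.var .delta) (encodeLists (addLists q L C Δ)))
      ((M + 1) * ((Form.addable q).time.eval M + 24 * M + 28)) := by
  have hlen : C.length ≤ m := length_le_length_encodeLists.trans hCm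
  obtain ⟨hI, h⟩ := acts_forEach_foldl (n := σ.arity) (x := .var .cand)
    (show (Reg.var .tup : Reg Var) ≠ .tmp by simp) Γ'.bra (f := encodeFacts) (l := C) (b := Δ)
    (p := addTup q) (e := fun Δ => Function.update r (.var .delta) (encodeLists Δ))
    (c := (Form.addable q).time.eval M + 12 * M + 11)
    (addList q L) (by simp [hC, pieces_encodeLists])
    (by simp [h₁]) (by simp [h₉]) (fun j Δ => (encodeLists Δ).length ≤ d + j * m) (by simpa)
    (fun j hj Δ' hΔ' => by
      have hT := length_lt_length_encodeLists (List.getElem_mem hj)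
      constructor
      · refine (length_encodeLists_addList q).trans ?_
        rw [Nat.succ_mul]
        omega
      · have h := acts_addTup q (L := L) (S := C[j]) (Δ := Δ') (M := M)
          (r := Function.update (Function.update r (.var .delta) (encodeLists Δ')) (.var .tup)
            (encodeFacts C[j])) (by simp [h₁]) (by simp [h₂]) (by simp [h₃]) (by simp [h₄])
            (by simp [h₅]) (by simp [h₆]) (by simp [h₇]) (by simp [h₈]) (by simp [hL]) (by simp)
            (by simp) (fun x => by
              have hx := hM x
              by_cases hx₁ : x = .tup
              · subst hx₁
                rw [Function.update_self]
                have := hM .cand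
                rw [hC] at this
                omega
              · rw [Function.update_of_ne (by simpa using hx₁)]
                by_cases hx₂ : x = .delta
                · subst hx₂
                  rw [Function.update_self]
                  refine hΔ'.trans (le_trans ?_ hdm)
                  exact Nat.add_le_add_left (Nat.mul_le_mul_right _ (hj.le.trans hlen)) _
                · rw [Function.update_of_ne (by simpa using hx₂)]
                  exact hx)
        rw [Function.update_comm (show (Reg.var .tup : Reg Var) ≠ .var .delta by simp),
          Function.update_idem] at h
        exact h)
  refine ⟨hI.trans (Nat.add_le_add_left (Nat.mul_le_mul_right _ hlen) _), ?_⟩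
  have hcand := hM .cand
  rw [← hΔ, Function.update_eq_self] at h
  exact h.le (Nat.mul_le_mul (by omega) (by omega))

/-- Put all derivable lists into `delta`, in as many rounds as there are lists in `cand`. -/
noncomputable def saturate (q : Query σ V) : Prog (Ctrl σ.arity) (Reg Var) :=
  forEach .tmp (.var .rnd) (.var .cand) .bra (addCand q)

/-- The outer loop runs over `cand` only to count rounds; the word in `rnd` is never read. A list
may be added again in every round, but each of the at most `m` rounds adds at most `m * m` letters,
so `delta` stays polynomial. -/
theorem acts_saturate (q : Query σ V) (h₁ : r .tmp = []) (h₂ : r .lhs = []) (h₃ : r .rhs = [])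
    (h₄ : r (.var .blk) = []) (h₅ : r (.var .fact) = []) (h₆ : r (.var .set) = [])
    (h₇ : r (.var .mem) = []) (h₈ : r (.var .mem') = []) (h₉ : r (.var .tup) = [])
    (h₁₀ : r (.var .rnd) = []) (hL : r (.var .inp) = encodeFacts L)
    (hC : r (.var .cand) = encodeLists C) (hΔ : r (.var .delta) = [])
    (hCm : (encodeLists C).length ≤ m) (hM : ∀ x, (r (.var x)).length ≤ M)
    (hm : (m + 1) * (m * m) ≤ M) :
    (encodeLists ((addLists q L C)^[C.length] [])).length ≤ M ∧
    Acts (saturate q) r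
      (Function.update r (.var .delta) (encodeLists ((addLists q L C)^[C.length] [])))
      ((M + 1) * ((M + 1) * ((Form.addable q).time.eval M + 24 * M + 28) + 12 * M + 17)) := by
  have hlen : C.length ≤ m := length_le_length_encodeLists.trans hCm
  obtain ⟨hI, h⟩ := acts_forEach_foldl (n := σ.arity) (x := .var .cand)
    (show (Reg.var .rnd : Reg Var) ≠ .tmp by simp) Γ'.bra (f := encodeFacts) (l := C)
    (b := ([] : List (List (Term σ ℕ)))) (p := addCand q)
    (e := fun Δ => Function.update r (.var .delta) (encodeLists Δ))
    (c := (M + 1) * ((Form.addable q).time.eval M + 24 * M + 28))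
    (fun Δ _ => addLists q L C Δ) (by simp [hC, pieces_encodeLists])
    (by simp [h₁]) (by simp [h₁₀]) (fun j Δ => (encodeLists Δ).length ≤ j * (m * m))
    (by simp [encodeLists])
    (fun j hj Δ' hΔ' => by
      have hT := length_lt_length_encodeLists (List.getElem_mem hj)
      have hj' : j * (m * m) + m * m ≤ M := by
        rw [← Nat.succ_mul]
        exact (Nat.mul_le_mul_right _ (by omega)).trans hm
      obtain ⟨h, h'⟩ := acts_addCand q (L := L) (C := C) (Δ := Δ') (M := M) (m := m)
          (d := j * (m * m))
          (r := Function.update (Function.update r (.var .delta) (encodeLists Δ')) (.var .rnd)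
            (encodeFacts C[j])) (by simp [h₁]) (by simp [h₂]) (by simp [h₃]) (by simp [h₄])
            (by simp [h₅]) (by simp [h₆]) (by simp [h₇]) (by simp [h₈]) (by simp [h₉])
            (by simp [hL]) (by simp [hC]) (by simp) hCm hΔ' (fun x => by
              have hx := hM x
              by_cases hx₁ : x = .rnd
              · subst hx₁
                rw [Function.update_self]
                have := hM .cand
                rw [hC] at this
                omega
              · rw [Function.update_of_ne (by simpa using hx₁)]
                by_cases hx₂ : x = .delta
                · subst hx₂
                  rw [Function.update_self]
                  omega
                · rw [Function.update_of_ne (by simpa using hx₂)]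
                  exact hx) hj'
      refine ⟨by rwa [Nat.succ_mul], ?_⟩
      rw [Function.update_comm (show (Reg.var .rnd : Reg Var) ≠ .var .delta by simp),
        Function.update_idem] at h'
      exact h')
  rw [List.foldl_const] at hI h
  refine ⟨hI.trans ((Nat.mul_le_mul_right _ (by omega)).trans hm), ?_⟩
  have hcand := hM .cand
  have h₀ : Function.update r (.var .delta) (encodeLists ([] : List (List (Term σ ℕ)))) = r :=
    (Function.update_eq_self_iff (f := r)).2 hΔ.symm
  rw [h₀] at h
  exact h.le (Nat.mul_le_mul (by omega) (by omega))

/-- Decide whether the greedy fixpoint algorithm accepts. -/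
noncomputable def decideCert (q : Query σ V) (k : ℕ) : Prog (Ctrl σ.arity) (Reg Var) :=
  .seq (.seq (makeCand k) (saturate q)) (.seq (Form.accepting σ).comp
    (.seq (clear (.var .cand)) (.seq (clear (.var .delta)) (clear (.var .inp)))))

end Prog

open Prog in
theorem Query.inPTIME_cert (q : Query σ V) (k : ℕ) :
    InPTIME (encodeFacts (σ := σ)) fun L => q.Cert k L.toFinset := by
  -- Here `m` bounds the candidates and `M` bounds every register: the input, the candidates, and
  -- `delta` after all rounds.
  let m : Polynomial ℕ := (2 * Polynomial.X + 1) ^ k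
  let M : Polynomial ℕ := Polynomial.X + m + (m + 1) * (m * m)
  let time : Polynomial ℕ :=
    (Polynomial.C k * ((M + 1) * ((M + 1) * (36 * M + 37) + 24 * M + 27) + 20 * M + 15) + 1) +
    ((M + 1) * ((M + 1) * ((Form.addable q).time.comp M + 24 * M + 28) + 12 * M + 17)) +
    ((Form.accepting σ).time.comp M + 12 * M + 9)
  refine inPTIME_of_run (decideCert q k) (.var .inp) ⟨.blank, 0, false⟩ Ctrl.flag time _ _
    fun L => ?_
  set n := (encodeFacts L).length with hn
  have hmn : m.eval n = (2 * n + 1) ^ k := by simp [m]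
  have hMn : M.eval n = n + m.eval n + (m.eval n + 1) * (m.eval n * m.eval n) := by simp [M]
  set m' := m.eval n with hm'
  set M' := M.eval n with hM'
  set r : Reg Var → List Γ' := Function.update (fun _ => []) (.var .inp) (encodeFacts L) with hr
  set s : Ctrl σ.arity := ⟨.blank, 0, false⟩ with hs
  have hlists : ∀ j ≤ k, (encodeLists (listsUpTo L j)).length ≤ m' := fun j hj => by
    rw [hmn]
    exact (length_encodeLists_listsUpTo j).trans (Nat.pow_le_pow_right (by omega) hj)
  have hnM : n ≤ M' := by omega
  have hmM : m' ≤ M' := by omega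
  have a₁ := acts_makeCand (n := σ.arity) (L := L) (M := M') (r := r) (by simp [hr]) (by simp [hr])
    (by simp [hr]) (by simp [hr]) (by simp [hr]) (by simp [hr]) k hnM
    (fun j hj => (hlists j hj).trans hmM)
  set C := listsUpTo L k with hC
  have hCM : (encodeLists C).length ≤ M' := (hlists k le_rfl).trans hmM
  set r₁ := Function.update r (.var .cand) (encodeLists C) with hr₁
  obtain ⟨hΔM, a₂⟩ := acts_saturate q (L := L) (C := C) (m := m') (M := M') (r := r₁)
    (by simp [hr₁, hr]) (by simp [hr₁, hr]) (by simp [hr₁, hr]) (by simp [hr₁, hr])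
    (by simp [hr₁, hr]) (by simp [hr₁, hr]) (by simp [hr₁, hr]) (by simp [hr₁, hr])
    (by simp [hr₁, hr]) (by simp [hr₁, hr]) (by simp [hr₁, hr]) (by simp [hr₁])
    (by simp [hr₁, hr]) (hlists k le_rfl) (fun x => by
      by_cases hx₁ : x = .cand
      · subst hx₁
        rw [hr₁, Function.update_self]
        exact (hlists k le_rfl).trans hmM
      · rw [hr₁, Function.update_of_ne (by simpa using hx₁)]
        by_cases hx₂ : x = .inp
        · subst hx₂
          rw [hr, Function.update_self]
          exact hnM
        · rw [hr, Function.update_of_ne (by simpa using hx₂)]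
          exact Nat.zero_le _) (by omega)
  set Δ := (addLists q L C)^[C.length] [] with hΔ
  set r₂ := Function.update r₁ (.var .delta) (encodeLists Δ) with hr₂
  have hr₂M : ∀ x, (r₂ (.var x)).length ≤ M' := fun x => by
    cases x <;> simp [hr₂, hr₁, hr, hΔM, hCM, ← hn, hnM]
  have t := Form.tests_comp (Form.accepting σ) (r := r₂) (M := M') (by simp [hr₂, hr₁, hr])
    (by simp [hr₂, hr₁, hr]) (by simp [hr₂, hr₁, hr]) hr₂M
    (Form.fits_accepting (by simp [hr₂, hr₁, hr]) (by simp [hr₂, hr₁, hr]))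
  rw [Form.val_accepting (Δ := Δ) (by simp [hr₂]), hΔ, hC, nil_mem_iterate_addLists_iff] at t
  obtain ⟨b₁, c₁⟩ := a₁.seq a₂ s
  set s₁ := (run (.seq (makeCand k) (saturate q)) (s, r)).1 with hs₁
  have e₁ : run (.seq (makeCand k) (saturate q)) (s, r) = (s₁, r₂) := Prod.ext rfl b₁
  obtain ⟨b₂, b₃, c₂⟩ := t s₁
  set s₂ := (run (Form.accepting σ).comp (s₁, r₂)).1 with hs₂
  have e₂ : run (Form.accepting σ).comp (s₁, r₂) = (s₂, r₂) := Prod.ext rfl b₂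
  -- Only `cand`, `delta` and `inp` are nonempty at this point, and the final part empties them.
  have hrun : run (decideCert q k) (s, r) = (s₂, fun _ => []) := by
    rw [decideCert, run, e₁, run, e₂, run, run_clear, run, run_clear, run_clear]
    refine Prod.ext rfl (funext fun k => ?_)
    simp only [hr₂, hr₁, hr, Function.update_apply]
    split_ifs <;> rfl
  have c₃ := ((acts_clear (.var .cand) r₂).seq ((acts_clear (.var .delta) _).seq
    (acts_clear (.var .inp) _)) s₂).2
  rw [Function.update_of_ne (by simp), Function.update_of_ne (by simp),
    Function.update_of_ne (by simp)] at c₃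
  refine ⟨by rw [hrun], by rw [hrun, b₃], ?_⟩
  set p := Prog.seq (makeCand k) (saturate q) with hp
  set p' : Prog (Ctrl σ.arity) (Reg Var) := .seq (clear (.var .cand)) (.seq (clear (.var .delta))
    (clear (.var .inp))) with hp'
  have hcost : cost (decideCert q k) (s, r) = cost p (s, r) +
      (cost (Form.accepting σ).comp (run p (s, r)) +
        cost p' (run (Form.accepting σ).comp (run p (s, r)))) := rfl
  rw [hcost, e₁, e₂]
  have l₁ := hr₂M .cand
  have l₂ := hr₂M .delta
  have l₃ := hr₂M .inp
  have htime : time.eval n =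
      (k * ((M' + 1) * ((M' + 1) * (36 * M' + 37) + 24 * M' + 27) + 20 * M' + 15) + 1) +
      ((M' + 1) * ((M' + 1) * ((Form.addable q).time.eval M' + 24 * M' + 28) + 12 * M' + 17)) +
      ((Form.accepting σ).time.eval M' + 12 * M' + 9) := by
    simp only [time, Polynomial.eval_add, Polynomial.eval_mul, Polynomial.eval_ofNat,
      Polynomial.eval_one, Polynomial.eval_C, Polynomial.eval_comp, ← hM']
  rw [htime]
  refine (Nat.add_le_add c₁ (Nat.add_le_add c₂ c₃)).trans ?_
  omega

theorem Query.certainInPTIME (q : Query σ V) (hq : q.TwoWayDetermined)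
    (h : ¬ q.AdmitsTripath) : q.CertainInPTIME := by
  have hcert := q.inPTIME_cert (2 ^ (2 * σ.kappa + 1) + σ.kappa - 1)
  have heq : (fun L : List (Term σ ℕ) => q.Certain L.toFinset) =
      fun L => q.Cert (2 ^ (2 * σ.kappa + 1) + σ.kappa - 1) L.toFinset :=
    funext fun L => propext (q.certain_iff_cert hq L.toFinset fun hL => h ⟨_, hL⟩)
  rw [Query.CertainInPTIME, heq]
  exact hcert

end TwoAtomCQA

theorem mainTheorem4 {σ : TwoAtomCQA.Signature} {V : Type*} (q : TwoAtomCQA.Query σ V)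
    (hq : q.TwoWayDetermined) :
    (∀ {α : Type*} [DecidableEq α] (D : TwoAtomCQA.Database σ α), ¬ q.ContainsTripath D →
      (q.Certain D ↔ q.Cert (2 ^ (2 * σ.kappa + 1) + σ.kappa - 1) D)) ∧
    (¬ q.AdmitsTripath → q.CertainInPTIME) := by
  exact ⟨fun D hD => q.certain_iff_cert hq D hD, q.certainInPTIME hq⟩
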